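/- **Setting.** An affine manifold of dimension $n$ is a (Hausdorff, second countable) manifold with an atlas modelled on $\mathbb R^n$ whose transition maps are locally restrictions of affine maps; a map is affine if it is continuous and locally affine in such charts. Let $M$ and $B$ be affine manifolds of dimensions $m+l$ and $m$, with $B$ connected, and let $f:M\to B$ be a surjective affine map which is a smoothly locally trivial bundle with connected typical fibre $F=f^{-1}(b_0)$. Each fibre is an affine submanifold of $M$ of dimension $l$. Assume that the fibres are compact, or that all fibres are complete affine manifolds (affinely covered by $\mathbb R^l$). Let $h_B:\pi_1(B)\to \mathrm{Aff}(\mathbb R^m)$ be the holonomy of $B$, $h_F:\pi_1(F)\to \mathrm{Aff}(\mathbb R^l)$ the holonomy of $F$ (both defined by developing maps on the universal covers), and $L=L(h_F):\pi_1(F)\to GL(\mathbb R^l)$ its linear part. Let $G$ be the gauge group, the group of pairs $(g,A)$ with $g\in\mathrm{Aut}(\pi_1(F))$, $A\in GL(\mathbb R^l)$ and $L(g(\gamma))=A\,L(\gamma)\,A^{-1}$ for all $\gamma$. It acts on $H^1(\pi_1(F),\mathbb R^l)$ (coefficients twisted by $L$) by $[c]\mapsto[A\circ c\circ g^{-1}]$.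 Let $\mathcal A\subseteq H^1(\pi_1(F),\mathbb R^l)$ be the set of classes of affine structures on the smooth manifold $F$ with linear holonomy $L$, i.e. of the classes $[c]$ such that some local diffeomorphism $D:\widehat F\to\mathbb R^l$ of the universal cover satisfies $D(\gamma y)=L(\gamma)D(y)+c(\gamma)$. Let $U$ be $\mathcal A$, or any set with $\mathcal A\subseteq U\subseteq H^1(\pi_1(F),\mathbb R^l)$ (for instance all of $H^1$). Let $E(F,L)=U/G$ be the quotient of $U$ by the relation of lying in the same $G$-orbit, and $t:U\to E(F,L)$ the canonical projection. **Proposition 3.1.** Suppose that $E(F,L)$ carries a structure of real algebraic variety for which $t$ is algebraic. (Such a structure is a finite atlas of bijections from subsets of $E(F,L)$ onto real algebraic sets, with Zariski open overlaps and regular transition maps. That $t$ is algebraic means that $t$ is continuous for the Zariski topologies and is given by regular functions, i.e. Zariski-locally quotients of polynomials, in the charts.) Suppose also that the Zariski closure of $h_B(\pi_1(B))$ in $\mathrm{Aff}(\mathbb R^m)$ acts transitively on $\mathbb R^m$. Then any two fibres of $f$ are isomorphic as affine manifolds. -/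

import Mathlib

open Set Filter Topology
open scoped Manifold ContDiff

noncomputable section

/-! ### Affine manifolds and affine maps -/

/-- The model space `ℝⁿ`. -/
abbrev Euc (n : ℕ) : Type := EuclideanSpace ℝ (Fin n)

/-- Maps between open subsets of `ℝⁿ` that are locally restrictions of affine maps. -/
def affinePregroupoid (n : ℕ) : Pregroupoid (Euc n) where
  property f s := ∀ x ∈ s, ∃ A : Euc n →ᵃ[ℝ] Euc n, ∀ᶠ y in 𝓝 x, f y = A y
  comp := by
    intro f g u v hf hg hu hv huv x hx
    obtain ⟨A, hA⟩ := hf x hx.1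
    obtain ⟨A', hA'⟩ := hg (f x) hx.2
    refine ⟨A'.comp A, ?_⟩
    have hc : ContinuousAt f x :=
      (A.continuous_of_finiteDimensional.continuousAt).congr (hA.mono fun y hy => hy.symm)
    filter_upwards [hA, hc.eventually hA'] with y h1 h2
    simp only [Function.comp_apply, AffineMap.coe_comp]
    rw [h2, h1]
  id_mem := fun x _ => ⟨AffineMap.id ℝ _, by simp⟩
  locality := by
    intro f u _ h x hx
    obtain ⟨v, _, hxv, hv⟩ := h x hx
    exact hv x ⟨hx, hxv⟩
  congr := by
    intro f g u hu hfg hf x hx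
    obtain ⟨A, hA⟩ := hf x hx
    refine ⟨A, ?_⟩
    filter_upwards [hA, hu.mem_nhds hx] with y h1 h2
    rw [hfg y h2, h1]

/-- The structure groupoid of locally affine transition maps. An affine manifold of dimension `n` is
a manifold charted on `ℝⁿ` whose transition maps belong to this groupoid. -/
def affineGroupoid (n : ℕ) : StructureGroupoid (Euc n) :=
  (affinePregroupoid n).groupoid

/-- `φ : X → Y` is continuous and affine for the affine structures which `X` and `Y` receive from
affine manifolds `M`, `N` through `i : X → M` and `j : Y → N` (inclusions of affine submanifolds,
covering maps, or compositions of such maps): read in affine charts of `M` and `N`, it is locally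
the restriction of an affine map. -/
def IsAffineAlong {n k : ℕ} {X Y M N : Type*} [TopologicalSpace X] [TopologicalSpace Y]
    [TopologicalSpace M] [ChartedSpace (Euc n) M] [TopologicalSpace N] [ChartedSpace (Euc k) N]
    (i : X → M) (j : Y → N) (φ : X → Y) : Prop :=
  Continuous φ ∧ ∀ x, ∃ A : Euc n →ᵃ[ℝ] Euc k,
    ∀ᶠ x' in 𝓝 x, chartAt (Euc k) (j (φ x)) (j (φ x')) = A (chartAt (Euc n) (i x) (i x'))

/-- The fibres of `f` over `b` and `b'` are isomorphic as affine manifolds. -/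
def FibresAffinelyIsomorphic (n : ℕ) {M B : Type*} [TopologicalSpace M] [ChartedSpace (Euc n) M]
    (f : M → B) (b b' : B) : Prop :=
  ∃ φ : (f ⁻¹' {b}) ≃ₜ (f ⁻¹' {b'}),
    IsAffineAlong (n := n) (k := n) (Subtype.val : f ⁻¹' {b} → M)
      (Subtype.val : f ⁻¹' {b'} → M) φ ∧
    IsAffineAlong (n := n) (k := n) (Subtype.val : f ⁻¹' {b'} → M)
      (Subtype.val : f ⁻¹' {b} → M) φ.symm

/-- The `l`-dimensional fibre of `f` over `b` is a complete affine manifold: it is covered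
affinely by `ℝˡ`. -/
def FibreComplete (n l : ℕ) {M B : Type*} [TopologicalSpace M] [ChartedSpace (Euc n) M]
    (f : M → B) (b : B) : Prop :=
  ∃ q : Euc l → f ⁻¹' {b}, IsCoveringMap q ∧ Function.Surjective q ∧
    IsAffineAlong (n := l) (k := n) (id : Euc l → Euc l) (Subtype.val : f ⁻¹' {b} → M) q

/-- `f : M → B` is a locally trivial bundle in the smooth category, with typical fibre the
fibre over `b₀`: over a neighbourhood `V` of every point there are mutually inverse smooth maps
`V × f⁻¹(b₀) → f⁻¹(V)`, `(v, y) ↦ Φ (v, y)` and `f⁻¹(V) → V × f⁻¹(b₀)`, `p ↦ (f p, Ψ p)`. -/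
def IsSmoothlyLocallyTrivial (n m : ℕ) {M B : Type*} [TopologicalSpace M]
    [ChartedSpace (Euc n) M] [TopologicalSpace B] [ChartedSpace (Euc m) B]
    (f : M → B) (b₀ : B) : Prop :=
  ∀ b : B, ∃ (V : Set B) (Φ : B × M → M) (Ψ : M → M), IsOpen V ∧ b ∈ V ∧
    ContMDiffOn (𝓘(ℝ, Euc m).prod 𝓘(ℝ, Euc n)) 𝓘(ℝ, Euc n) ∞ Φ (V ×ˢ (f ⁻¹' {b₀})) ∧
    ContMDiffOn 𝓘(ℝ, Euc n) 𝓘(ℝ, Euc n) ∞ Ψ (f ⁻¹' V) ∧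
    (∀ v ∈ V, ∀ y ∈ f ⁻¹' {b₀}, f (Φ (v, y)) = v ∧ Ψ (Φ (v, y)) = y) ∧
    (∀ p ∈ f ⁻¹' V, Ψ p ∈ f ⁻¹' {b₀} ∧ Φ (f p, Ψ p) = p)

/-! ### Universal covers, developing maps and holonomy -/

/-- `p` is a universal covering map. -/
structure IsUniversalCover {X' X : Type*} [TopologicalSpace X'] [TopologicalSpace X]
    (p : X' → X) : Prop where
  isCoveringMap : IsCoveringMap p
  surjective : Function.Surjective p
  simplyConnected : SimplyConnectedSpace X'

/-- The group of deck transformations of `p`; for a universal cover of a connected manifold `X`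
it is the fundamental group `π₁(X)`. -/
def deckGroup {X' X : Type*} [TopologicalSpace X'] (p : X' → X) : Subgroup (X' ≃ₜ X') where
  carrier := {γ | ∀ x, p (γ x) = p x}
  one_mem' := fun _ => rfl
  mul_mem' := by
    intro γ δ hγ hδ x
    exact (hγ (δ x)).trans (hδ x)
  inv_mem' := by
    intro γ hγ x
    have h := hγ (γ⁻¹ x)
    have h' : γ (γ⁻¹ x) = x := γ.apply_symm_apply x
    rw [h'] at h
    exact h.symm

/-- `D` is a developing map on the universal cover `p : X' → X`, and `h` is its holonomy
representation. The affine structure of `X` comes from an affine manifold `M` through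
`j : X → M`. -/
structure IsDevelopingPair {n k : ℕ} {X' X M : Type*} [TopologicalSpace X'] [TopologicalSpace M]
    [ChartedSpace (Euc n) M] (p : X' → X) (j : X → M) (D : X' → Euc k)
    (h : deckGroup p →* (Euc k ≃ᵃ[ℝ] Euc k)) : Prop where
  isLocalHomeomorph : IsLocalHomeomorph D
  isAffine : IsAffineAlong (n := n) (k := k) (j ∘ p) (id : Euc k → Euc k) D
  equivariant : ∀ (γ : deckGroup p) (x : X'), D (γ.1 x) = h γ (D x)

/-- The linear part of an affine representation. -/
def linearHolonomy {k : ℕ} {Γ : Type*} [Group Γ] (h : Γ →* (Euc k ≃ᵃ[ℝ] Euc k)) :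
    Γ →* (Euc k ≃ₗ[ℝ] Euc k) :=
  AffineEquiv.linearHom.comp h

/-! ### First cohomology of a group with coefficients in a real representation -/

section Cohomology

variable {Γ V : Type*} [Group Γ] [AddCommGroup V] [Module ℝ V]

/-- `1`-cocycles. -/
def cocycles (L : Γ →* (V ≃ₗ[ℝ] V)) : Submodule ℝ (Γ → V) where
  carrier := {c | ∀ γ δ, c (γ * δ) = c γ + L γ (c δ)}
  zero_mem' := by intro γ δ; simp
  add_mem' := by
    intro c d hc hd γ δ
    simp only [Pi.add_apply, hc γ δ, hd γ δ, map_add]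
    abel
  smul_mem' := by
    intro a c hc γ δ
    simp only [Pi.smul_apply, hc γ δ, map_smul, smul_add]

/-- The coboundary map `v ↦ (γ ↦ L(γ)v - v)`. -/
def coboundary (L : Γ →* (V ≃ₗ[ℝ] V)) : V →ₗ[ℝ] cocycles L where
  toFun v := ⟨fun γ => L γ v - v, by
    intro γ δ
    simp only [map_mul, LinearEquiv.mul_apply, map_sub]
    abel⟩
  map_add' := by
    intro v w
    ext γ
    simp only [map_add, Submodule.coe_add, Pi.add_apply]
    abel
  map_smul' := by
    intro a v
    ext γ
    simp [smul_sub]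

/-- `H¹(Γ, V)`, cocycles modulo coboundaries. -/
abbrev H1 (L : Γ →* (V ≃ₗ[ℝ] V)) : Type _ :=
  cocycles L ⧸ LinearMap.range (coboundary L)

/-- The gauge group: pairs `(g, B)` of an automorphism `g` of `Γ` and an invertible linear map `B`
with `L(g(γ)) = B L(γ) B⁻¹`. -/
def gaugeGroup (L : Γ →* (V ≃ₗ[ℝ] V)) : Subgroup (MulAut Γ × (V ≃ₗ[ℝ] V)) where
  carrier := {p | ∀ γ, L (p.1 γ) = p.2 * L γ * p.2⁻¹}
  one_mem' := by intro γ; simp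
  mul_mem' := by
    intro p q hp hq γ
    have h1 := hp (q.1 γ)
    have h2 := hq γ
    simp only [Prod.fst_mul, Prod.snd_mul, MulAut.mul_apply, mul_inv_rev]
    rw [h1, h2]
    simp only [mul_assoc]
  inv_mem' := by
    intro p hp γ
    have h := hp (p.1⁻¹ γ)
    rw [MulAut.apply_inv_self] at h
    simp only [Prod.fst_inv, Prod.snd_inv, h]
    group

/-- The action of a gauge transformation on cocycles, `c ↦ B ∘ c ∘ g⁻¹`. -/
def gaugeCocycle (L : Γ →* (V ≃ₗ[ℝ] V)) (p : gaugeGroup L) : cocycles L →ₗ[ℝ] cocycles L where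
  toFun c := ⟨fun γ => p.1.2 (c.1 (p.1.1⁻¹ γ)), by
    intro γ δ
    have h := p.2 (p.1.1⁻¹ γ)
    rw [MulAut.apply_inv_self] at h
    change p.1.2 (c.1 (p.1.1⁻¹ (γ * δ))) =
      p.1.2 (c.1 (p.1.1⁻¹ γ)) + L γ (p.1.2 (c.1 (p.1.1⁻¹ δ)))
    rw [map_mul, c.2, map_add, h]
    simp [LinearEquiv.mul_apply]⟩
  map_add' := by intro c d; ext γ; simp
  map_smul' := by intro a c; ext γ; simp

/-- The induced action of a gauge transformation on cohomology classes. -/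
def gaugeH1 (L : Γ →* (V ≃ₗ[ℝ] V)) (p : gaugeGroup L) : H1 L →ₗ[ℝ] H1 L :=
  Submodule.mapQ _ _ (gaugeCocycle L p) (by
    rintro _ ⟨v, rfl⟩
    refine ⟨p.1.2 v, ?_⟩
    ext γ
    have h := p.2 (p.1.1⁻¹ γ)
    rw [MulAut.apply_inv_self] at h
    simp only [coboundary, gaugeCocycle, LinearMap.coe_mk, AddHom.coe_mk, map_sub, h]
    simp [LinearEquiv.mul_apply, LinearEquiv.coe_inv])

instance gaugeAction (L : Γ →* (V ≃ₗ[ℝ] V)) : MulAction (gaugeGroup L) (H1 L) where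
  smul p a := gaugeH1 L p a
  one_smul a := by
    obtain ⟨c, rfl⟩ := Submodule.Quotient.mk_surjective _ a
    rfl
  mul_smul p q a := by
    obtain ⟨c, rfl⟩ := Submodule.Quotient.mk_surjective _ a
    change gaugeH1 L (p * q) _ = gaugeH1 L p (gaugeH1 L q _)
    simp only [gaugeH1, Submodule.mapQ_apply]
    congr 1

/-- The relation on `U ⊆ H¹(Γ, V)` of lying in the same orbit of the gauge group. -/
def gaugeSetoid (L : Γ →* (V ≃ₗ[ℝ] V)) (U : Set (H1 L)) : Setoid U :=
  (MulAction.orbitRel (gaugeGroup L) (H1 L)).comap Subtype.val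

/-- The quotient of `U ⊆ H¹(Γ, V)` by the gauge group. -/
def Moduli (L : Γ →* (V ≃ₗ[ℝ] V)) (U : Set (H1 L)) : Type _ :=
  Quotient (gaugeSetoid L U)

/-- The canonical projection `U → U / G`. -/
def moduliProj (L : Γ →* (V ≃ₗ[ℝ] V)) (U : Set (H1 L)) (u : U) : Moduli L U :=
  Quotient.mk (gaugeSetoid L U) u

end Cohomology

/-- The classes in `H¹(π₁(F), ℝˡ)` of the affine structures on the smooth manifold `F` whose linear
holonomy is `L`. Here `p : F' → F` is the universal cover, and the smooth structure of `F` is the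
one for which the local homeomorphism `D₀ : F' → ℝˡ` is a local diffeomorphism. An affine structure
is given by a developing map `D`, a local diffeomorphism `F' → ℝˡ` which is equivariant under the
affine action `y ↦ L(γ)y + c(γ)` of `π₁(F)`. -/
def affineClasses {l : ℕ} {F' F : Type*} [TopologicalSpace F'] (p : F' → F) (D₀ : F' → Euc l)
    (L : deckGroup p →* (Euc l ≃ₗ[ℝ] Euc l)) : Set (H1 L) :=
  {a | ∃ c : cocycles L, Submodule.Quotient.mk c = a ∧ ∃ D : F' → Euc l,
    (∀ y, ∃ ψ : Euc l → Euc l, ContDiffAt ℝ ∞ ψ (D₀ y) ∧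
      Function.Bijective (fderiv ℝ ψ (D₀ y)) ∧ ∀ᶠ y' in 𝓝 y, D y' = ψ (D₀ y')) ∧
    ∀ (γ : deckGroup p) (y : F'), D (γ.1 y) = L γ (D y) + c.1 γ}

/-! ### Real algebraic structures -/

section Algebraic

variable {W : Type*} [AddCommGroup W] [Module ℝ W]

/-- Polynomial functions on a real vector space: polynomials in linear forms. -/
def polyFun (W : Type*) [AddCommGroup W] [Module ℝ W] : Subalgebra ℝ (W → ℝ) :=
  Algebra.adjoin ℝ {P | ∃ ℓ : W →ₗ[ℝ] ℝ, P = ℓ}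

/-- `S` is an algebraic subset of `W`. -/
def IsAlgebraicSubset (S : Set W) : Prop :=
  ∃ I : Set (W → ℝ), I ⊆ polyFun W ∧ S = {x | ∀ P ∈ I, P x = 0}

/-- `T ⊆ S` is open for the Zariski topology that `S` inherits from `W`. -/
def IsZariskiOpenIn (S T : Set W) : Prop :=
  T ⊆ S ∧ ∀ x ∈ T, ∃ P ∈ polyFun W, P x ≠ 0 ∧ ∀ y ∈ S, P y ≠ 0 → y ∈ T

/-- `φ` is regular on `T`: Zariski-locally a quotient of polynomial functions. -/
def IsRegularOn (T : Set W) (φ : W → ℝ) : Prop :=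
  ∀ x ∈ T, ∃ P ∈ polyFun W, ∃ Q ∈ polyFun W, Q x ≠ 0 ∧
    ∀ y ∈ T, Q y ≠ 0 → φ y = P y / Q y

/-- A structure of real algebraic variety on a set `E`: a finite atlas of charts onto real
algebraic sets, with Zariski open overlaps and regular transition maps. -/
structure RealAlgebraicStructure (E : Type*) where
  ι : Type
  finite : Finite ι
  dim : ι → ℕ
  dom : ι → Set E
  chart : ∀ i, E → (Fin (dim i) → ℝ)
  cover : ∀ e, ∃ i, e ∈ dom i
  injOn : ∀ i, InjOn (chart i) (dom i)
  algebraic : ∀ i, IsAlgebraicSubset (chart i '' dom i)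
  overlap_open : ∀ i j, IsZariskiOpenIn (chart i '' dom i) (chart i '' (dom i ∩ dom j))
  overlap_regular : ∀ i j k, ∃ φ : (Fin (dim i) → ℝ) → ℝ,
    IsRegularOn (chart i '' (dom i ∩ dom j)) φ ∧ ∀ e ∈ dom i ∩ dom j, chart j e k = φ (chart i e)

/-- The map `t` from a subset `U` of a vector space to a real algebraic variety is algebraic:
continuous for the Zariski topologies, and given by regular functions in the charts. -/
def RealAlgebraicStructure.IsAlgebraicMap {E : Type*} (𝒱 : RealAlgebraicStructure E) (U : Set W)
    (t : U → E) : Prop :=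
  ∀ i, IsZariskiOpenIn U (Subtype.val '' (t ⁻¹' 𝒱.dom i)) ∧
    ∀ k, ∃ φ : W → ℝ, IsRegularOn (Subtype.val '' (t ⁻¹' 𝒱.dom i)) φ ∧
      ∀ u, t u ∈ 𝒱.dom i → 𝒱.chart i (t u) k = φ u

end Algebraic

/-- The Zariski closure in `Aff(ℝᵐ)` of a set of affine automorphisms. -/
def affZariskiClosure {m : ℕ} (S : Set (Euc m ≃ᵃ[ℝ] Euc m)) : Set (Euc m ≃ᵃ[ℝ] Euc m) :=
  {g | ∀ P ∈ polyFun (Euc m →ᵃ[ℝ] Euc m),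
    (∀ s ∈ S, P (s : Euc m →ᵃ[ℝ] Euc m) = 0) → P (g : Euc m →ᵃ[ℝ] Euc m) = 0}

end

/-! The affine structures of the fibres, transported to one fibre `F`, vary affinely with the base.
Over a small open set of `B'`, a developing map of the structure induced from `M` can be split as
`(DB, E)`. A deck transformation of `F'` then acts on `E` with linear part `L` independent of the
base point and a translation part affine in `DB` (`exists_datum`). Continuation along `B'` gives one
affine map `r : ℝᵐ → H¹` whose value at `DB v` is the class of the fibre over `pB v`
(`exists_classes`). The holonomy of the base acts on its values through gauge transformations
(`exists_gauge_deck`).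

Hence `t ∘ r` is invariant under the holonomy group on the developing image. If it took two values
there, some polynomial would vanish on an orbit of the holonomy group but not everywhere, against
the transitivity of the Zariski closure (`RealAlgebraicStructure.IsAlgebraicMap.eq_of_invariant`).
So all fibres have classes in a single gauge orbit.

For complete fibres the class determines the structure: developing maps are homeomorphisms, and an
affine conjugacy of the holonomies transports through them
(`fibresAffinelyIsomorphic_of_homeomorph`).

For compact fibres the class determines the structure only locally, and only when the gauge
transformations involved are close to the identity. Now `π₁(F)` is finitely generated, so it has
countably many automorphisms, and two gauge transformations with the same automorphism differ by an
element commuting with `L`. With `C` the commutant of `L`, a measure argument puts all values of `r`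
in one space `C r(x₀)` (`exists_forall_mem_orbitSpan`), and a second use of Zariski transitivity, on
a determinant, shows that `C r(x)` does not depend on `x` (`mem_orbitSpan_of_equivariant`). Near
each fibre the cocycle is therefore `(1 + σ(u))` times the initial one, up to coboundaries, with
`σ(u)` in `C` and linear in `u`. Dividing by the invertible factor gives a family of developing maps
with constant holonomy, and compactness makes it locally trivial (`exists_equivariant_homeomorph`).
Neighbouring fibres are thus isomorphic, and `B'` is connected. -/

set_option linter.unusedSectionVars false

noncomputable section

/-! ### Polynomial functions, Zariski density and invariant algebraic maps -/

section Polynomials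

variable {W W' : Type*} [AddCommGroup W] [Module ℝ W] [AddCommGroup W'] [Module ℝ W']

theorem polyFun_const (a : ℝ) : (fun _ => a) ∈ polyFun W :=
  (polyFun W).algebraMap_mem a

theorem polyFun_comp_affine (r : W →ᵃ[ℝ] W') {P : W' → ℝ} (hP : P ∈ polyFun W') :
    (fun x => P (r x)) ∈ polyFun W := by
  induction hP using Algebra.adjoin_induction with
  | mem P hP =>
    obtain ⟨ℓ, rfl⟩ := hP
    have : (fun x => ℓ (r x)) = (fun x => (ℓ.comp r.linear) x) + (fun _ => ℓ (r 0)) := by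
      ext x
      have := congrFun r.decomp x
      simp only [Pi.add_apply, LinearMap.comp_apply] at this ⊢
      rw [this, map_add]
    rw [this]
    exact add_mem (Algebra.subset_adjoin ⟨_, rfl⟩) (polyFun_const _)
  | algebraMap a => exact polyFun_const a
  | add P Q _ _ hP hQ => exact add_mem hP hQ
  | mul P Q _ _ hP hQ => exact mul_mem hP hQ

theorem polyFun_affine_coord (r : W →ᵃ[ℝ] W') (ℓ : W' →ₗ[ℝ] ℝ) :
    (fun x => ℓ (r x)) ∈ polyFun W :=
  polyFun_comp_affine r (Algebra.subset_adjoin ⟨ℓ, rfl⟩)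

/-- A polynomial which does not vanish identically does not vanish on any orbit of a set of affine
transformations whose Zariski closure acts transitively. -/
theorem exists_apply_ne_zero {m : ℕ} {S : Set (Euc m ≃ᵃ[ℝ] Euc m)}
    (htrans : ∀ x y : Euc m, ∃ g ∈ affZariskiClosure S, g x = y)
    {P : Euc m → ℝ} (hP : P ∈ polyFun (Euc m)) {y : Euc m} (hy : P y ≠ 0) (x : Euc m) :
    ∃ s ∈ S, P (s x) ≠ 0 := by
  by_contra! h
  obtain ⟨g, hg, rfl⟩ := htrans x y
  -- Evaluation at `x` is linear, so `P (A x) = 0` is a polynomial condition on `A`. Holding on `S`,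
  -- it passes to the Zariski closure, hence to the element `g` carrying `x` to `y`.
  let ev : (Euc m →ᵃ[ℝ] Euc m) →ₗ[ℝ] Euc m :=
    { toFun := fun A => A x, map_add' := fun _ _ => rfl, map_smul' := fun _ _ => rfl }
  exact hy (hg (fun A => P (ev.toAffineMap A)) (polyFun_comp_affine _ hP) fun s hs => h s hs)

/-- An algebraic map which is invariant on a set under affine transformations whose
Zariski closure is transitive is constant on that set. -/
theorem RealAlgebraicStructure.IsAlgebraicMap.eq_of_invariant {m : ℕ} {E : Type*}
    {𝒱 : RealAlgebraicStructure E} {U : Set W} {t : U → E} (ht : 𝒱.IsAlgebraicMap U t)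
    {S : Set (Euc m ≃ᵃ[ℝ] Euc m)}
    (htrans : ∀ x y : Euc m, ∃ g ∈ affZariskiClosure S, g x = y)
    (r : Euc m →ᵃ[ℝ] W) {Ω : Set (Euc m)} (hΩ : ∀ x ∈ Ω, r x ∈ U)
    (hS : ∀ s ∈ S, ∀ x (hx : x ∈ Ω), ∃ hx' : s x ∈ Ω, t ⟨r (s x), hΩ _ hx'⟩ = t ⟨r x, hΩ x hx⟩)
    {x y : Euc m} (hx : x ∈ Ω) (hy : y ∈ Ω) : t ⟨r y, hΩ y hy⟩ = t ⟨r x, hΩ x hx⟩ := by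
  by_contra hne
  -- A polynomial that separates `r y` from the whole fibre of `t` through `r x`. Invariance keeps
  -- the orbit of `x` in that fibre, so `P ∘ r` will vanish on the orbit.
  obtain ⟨P, hP, hPy, hPx⟩ : ∃ P ∈ polyFun W, P (r y) ≠ 0 ∧
      ∀ u : U, t u = t ⟨r x, hΩ x hx⟩ → P u = 0 := by
    obtain ⟨i, hi⟩ := 𝒱.cover (t ⟨r y, hΩ y hy⟩)
    obtain ⟨⟨-, hopen⟩, hreg⟩ := ht i
    obtain ⟨P₁, hP₁, hP₁y, hP₁U⟩ := hopen (r y) ⟨⟨r y, hΩ y hy⟩, hi, rfl⟩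
    have hdom : ∀ u : U, P₁ u ≠ 0 → t u ∈ 𝒱.dom i := by
      intro u hu
      obtain ⟨u', hu', he⟩ := hP₁U u u.2 hu
      rwa [← Subtype.ext he]
    by_cases hxi : t ⟨r x, hΩ x hx⟩ ∈ 𝒱.dom i
    · have hch : 𝒱.chart i (t ⟨r y, hΩ y hy⟩) ≠ 𝒱.chart i (t ⟨r x, hΩ x hx⟩) :=
        fun h => hne (𝒱.injOn i hi hxi h)
      obtain ⟨k, hk⟩ := Function.ne_iff.1 hch
      obtain ⟨φ, hφ, hφt⟩ := hreg k
      obtain ⟨P, hP, Q, hQ, hQy, hPQ⟩ := hφ (r y) ⟨⟨r y, hΩ y hy⟩, hi, rfl⟩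
      set a := 𝒱.chart i (t ⟨r x, hΩ x hx⟩) k
      have hval : ∀ u : U, P₁ u ≠ 0 → Q u ≠ 0 → 𝒱.chart i (t u) k = P u / Q u := fun u h1 h2 => by
        rw [hφt u (hdom u h1), hPQ u ⟨u, hdom u h1, rfl⟩ h2]
      -- `P₁` vanishes at the points of `U` sent outside the chart domain and `Q` where the quotient
      -- formula is unavailable. At the other points of `U` the last factor vanishes exactly when
      -- the `k`-th coordinate is `a`.
      refine ⟨P₁ * Q * (P - (fun _ => a) * Q),
        mul_mem (mul_mem hP₁ hQ) (sub_mem hP (mul_mem (polyFun_const a) hQ)), ?_, ?_⟩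
      · simp only [Pi.mul_apply, Pi.sub_apply]
        refine mul_ne_zero (mul_ne_zero hP₁y hQy) fun h0 => hk ?_
        rw [hval ⟨r y, hΩ y hy⟩ hP₁y hQy, div_eq_iff hQy]
        linarith
      · intro u hu
        simp only [Pi.mul_apply, Pi.sub_apply]
        by_cases h1 : P₁ u = 0
        · simp [h1]
        by_cases h2 : Q u = 0
        · simp [h2]
        have := hval u h1 h2
        rw [hu, eq_div_iff h2] at this
        rw [show P u = a * Q u from this.symm]
        ring
    · exact ⟨P₁, hP₁, hP₁y, fun u hu => by_contra fun h => hxi (hu ▸ hdom u h)⟩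
  obtain ⟨s, hs, hne'⟩ := exists_apply_ne_zero htrans (polyFun_comp_affine r hP) hPy x
  obtain ⟨hx', he⟩ := hS s hs x hx
  exact hne' (hPx ⟨_, hΩ _ hx'⟩ he)

end Polynomials

/-! ### Orbits of an algebra along an affine family of vectors -/

section Commutant

variable {W A : Type*} [AddCommGroup W] [Module ℝ W] [Ring A] [Algebra ℝ A]

/-- The subspace `A a` of a representation `W` of an algebra `A`. -/
def orbitSpan (ρ : A →ₐ[ℝ] Module.End ℝ W) (a : W) : Submodule ℝ W :=
  LinearMap.range (ρ.toLinearMap.flip a)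

theorem mem_orbitSpan {ρ : A →ₐ[ℝ] Module.End ℝ W} {a b : W} :
    b ∈ orbitSpan ρ a ↔ ∃ z, ρ z a = b := Iff.rfl

theorem orbitSpan_le {ρ : A →ₐ[ℝ] Module.End ℝ W} {a b : W} (h : b ∈ orbitSpan ρ a) :
    orbitSpan ρ b ≤ orbitSpan ρ a := by
  obtain ⟨z, rfl⟩ := mem_orbitSpan.1 h
  intro c hc
  obtain ⟨z', rfl⟩ := mem_orbitSpan.1 hc
  exact mem_orbitSpan.2 ⟨z' * z, by simp⟩

theorem polyFun_det {V N : Type*} [AddCommGroup V] [Module ℝ V] [AddCommGroup N] [Module ℝ N]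
    [Module.Finite ℝ N] (T : V →ᵃ[ℝ] Module.End ℝ N) :
    (fun x => LinearMap.det (T x)) ∈ polyFun V := by
  classical
  let b := Module.finBasis ℝ N
  have : (fun x => LinearMap.det (T x)) = ∑ σ : Equiv.Perm (Fin (Module.finrank ℝ N)),
      (fun _ => ((Equiv.Perm.sign σ : ℤ) : ℝ)) *
        ∏ i, fun x => b.repr (T x (b i)) (σ i) := by
    ext x
    rw [← LinearMap.det_toMatrix b, Matrix.det_apply']
    simp [Finset.sum_apply, Finset.prod_apply, LinearMap.toMatrix_apply]
  rw [this]
  refine sum_mem fun σ _ => mul_mem (polyFun_const _) (prod_mem fun i _ => ?_)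
  exact polyFun_affine_coord T
    ((b.coord (σ i)).comp (LinearMap.applyₗ (b i) : Module.End ℝ N →ₗ[ℝ] N))

/-- If the values of an affine map lie in the subspace spanned by the orbit of one of them,
and the map is equivariant under a Zariski transitive set, the same holds for all of them. -/
theorem mem_orbitSpan_of_equivariant [Module.Finite ℝ A] {m : ℕ} (ρ : A →ₐ[ℝ] Module.End ℝ W)
    {S : Set (Euc m ≃ᵃ[ℝ] Euc m)}
    (htrans : ∀ x y : Euc m, ∃ g ∈ affZariskiClosure S, g x = y)
    (r : Euc m →ᵃ[ℝ] W)
    (hS : ∀ s ∈ S, ∃ p : W →ₗ[ℝ] W, (∀ x, r (s x) = p (r x)) ∧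
      ∀ a, orbitSpan ρ (p a) ≤ (orbitSpan ρ a).map p)
    {x₀ : Euc m} (h₀ : ∀ x, r x ∈ orbitSpan ρ (r x₀)) (x y : Euc m) :
    r y ∈ orbitSpan ρ (r x) := by
  set N := orbitSpan ρ (r x₀) with hN
  have hfin : ∀ a, Module.Finite ℝ (orbitSpan ρ a) := fun a => by
    unfold orbitSpan; infer_instance
  have := hfin (r x₀)
  -- `sec` picks linearly an algebra element carrying `r x₀` to `n`. Replacing `r x₀` by `r x` gives
  -- the endomorphism `T x` of `N`, affine in `x` and equal to `1` at `x₀`, so its determinant is a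
  -- polynomial that is not identically zero.
  obtain ⟨sec, hsec'⟩ : ∃ sec : N →ₗ[ℝ] A, ∀ n : N, ρ (sec n) (r x₀) = n := by
    obtain ⟨sec, hsec⟩ :=
      (ρ.toLinearMap.flip (r x₀)).rangeRestrict.exists_rightInverse_of_surjective
        (LinearMap.range_rangeRestrict _)
    exact ⟨sec, fun n => congrArg Subtype.val (LinearMap.congr_fun hsec n)⟩
  have hmem : ∀ z x, ρ z (r x) ∈ N := fun z x => orbitSpan_le (h₀ x) (mem_orbitSpan.2 ⟨z, rfl⟩)
  let T (x : Euc m) : Module.End ℝ N :=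
    { toFun := fun n => ⟨ρ (sec n) (r x), hmem _ _⟩
      map_add' := fun n n' => by ext; simp
      map_smul' := fun a n => by ext; simp }
  have hlin : ∀ z v, ρ z (r.linear v) ∈ N := fun z v => by
    have : r.linear v = r v - r 0 := by
      have := congrFun r.decomp v
      simp only [Pi.add_apply] at this
      rw [this]; simp
    rw [this, map_sub]
    exact sub_mem (hmem _ _) (hmem _ _)
  let T' : Euc m →ᵃ[ℝ] Module.End ℝ N :=
    { toFun := T
      linear :=
        { toFun := fun v =>
            { toFun := fun n => ⟨ρ (sec n) (r.linear v), hlin _ _⟩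
              map_add' := fun n n' => by ext; simp
              map_smul' := fun a n => by ext; simp }
          map_add' := fun v w => by ext n; simp
          map_smul' := fun a v => by ext n; simp }
      map_vadd' := fun x v => by
        ext n
        have h : r (v + x) = r.linear v + r x := r.map_vadd x v
        simp [T, h] }
  have hT₀ : T x₀ = 1 := by ext n; simp [T, hsec']
  obtain ⟨s, hs, hdet⟩ := exists_apply_ne_zero htrans (polyFun_det T') (y := x₀)
    (by change LinearMap.det (T x₀) ≠ 0; rw [hT₀]; simp) x
  obtain ⟨p, hp, hpρ⟩ := hS s hs
  -- Invertibility of `T (s x)` makes every element of `N` a multiple of `r (s x) = p (r x)`. So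
  -- `dim N` is at most the dimension of the orbit space of `r x`, which lies in `N`; the two
  -- coincide.
  have hle : N ≤ orbitSpan ρ (r (s x)) := by
    intro n hn
    have hu : IsUnit (T (s x)) := (LinearMap.isUnit_iff_isUnit_det _).2 (isUnit_iff_ne_zero.2 hdet)
    obtain ⟨n', hn'⟩ := ((Module.End.isUnit_iff _).1 hu).2 ⟨n, hn⟩
    exact mem_orbitSpan.2 ⟨sec n', congrArg Subtype.val hn'⟩
  have hx := hfin (r x)
  have h1 : Module.finrank ℝ N ≤ Module.finrank ℝ (orbitSpan ρ (r x)) := by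
    calc Module.finrank ℝ N ≤ Module.finrank ℝ ((orbitSpan ρ (r x)).map p) :=
          Submodule.finrank_mono (hle.trans (hp x ▸ hpρ _))
      _ ≤ _ := Submodule.finrank_map_le p _
  rw [Submodule.eq_of_le_of_finrank_le (orbitSpan_le (h₀ x)) h1]
  exact h₀ y

end Commutant

/-! ### Commutant, gauge group and affine families of classes -/

section Gauge

variable {Γ V : Type*} [Group Γ] [AddCommGroup V] [Module ℝ V] (L : Γ →* (V ≃ₗ[ℝ] V))

/-- The algebra of endomorphisms commuting with a representation. -/
def commutant : Subalgebra ℝ (Module.End ℝ V) :=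
  Subalgebra.centralizer ℝ (range fun γ => ((L γ : V →ₗ[ℝ] V) : Module.End ℝ V))

variable {L}

theorem mem_commutant {z : Module.End ℝ V} : z ∈ commutant L ↔ ∀ γ v, L γ (z v) = z (L γ v) := by
  simp only [commutant, Subalgebra.mem_centralizer_iff, forall_mem_range]
  exact forall_congr' fun γ => LinearMap.ext_iff

variable (L)

/-- The action of the commutant on cocycles. -/
def commutantCocycle (z : commutant L) : cocycles L →ₗ[ℝ] cocycles L where
  toFun c := ⟨fun γ => z.1 (c.1 γ), fun γ δ => by
    change z.1 (c.1 (γ * δ)) = z.1 (c.1 γ) + L γ (z.1 (c.1 δ))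
    rw [c.2, map_add, mem_commutant.1 z.2]⟩
  map_add' := by intro c d; ext γ; simp
  map_smul' := by intro a c; ext γ; simp

/-- The action of the commutant on cohomology. -/
def commutantH1 : commutant L →ₐ[ℝ] Module.End ℝ (H1 L) :=
  AlgHom.ofLinearMap
    { toFun := fun z => Submodule.mapQ _ _ (commutantCocycle L z) (by
        rintro _ ⟨v, rfl⟩
        refine ⟨z.1 v, ?_⟩
        ext γ
        simp [coboundary, commutantCocycle, mem_commutant.1 z.2])
      map_add' := fun z z' => by
        ext c
        simp only [LinearMap.comp_apply, LinearMap.add_apply, Submodule.mkQ_apply,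
          Submodule.mapQ_apply, ← Submodule.Quotient.mk_add]
        rfl
      map_smul' := fun a z => by
        ext c
        simp only [LinearMap.comp_apply, LinearMap.smul_apply, Submodule.mkQ_apply,
          Submodule.mapQ_apply, ← Submodule.Quotient.mk_smul]
        rfl }
    (by ext c; rfl)
    (fun z z' => by ext c; rfl)

variable {L}

/-- The linear part `B` of a gauge transformation normalizes the commutant, because `L(g γ) B = B
L(γ)`. Thus `z B = B (B⁻¹ z B)` with `B⁻¹ z B` again in the commutant. -/
theorem orbitSpan_gaugeH1_le (p : gaugeGroup L) (a : H1 L) :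
    orbitSpan (commutantH1 L) (gaugeH1 L p a) ≤
      (orbitSpan (commutantH1 L) a).map (gaugeH1 L p) := by
  intro b hb
  obtain ⟨z, rfl⟩ := mem_orbitSpan.1 hb
  obtain ⟨c, rfl⟩ := Submodule.Quotient.mk_surjective _ a
  have hp : ∀ γ v, L (p.1.1 γ) (p.1.2 v) = p.1.2 (L γ v) := fun γ v => by
    rw [p.2 γ]; simp [LinearEquiv.mul_apply, LinearEquiv.coe_inv]
  let z' : Module.End ℝ V := (p.1.2.symm : V →ₗ[ℝ] V) ∘ₗ z.1 ∘ₗ (p.1.2 : V →ₗ[ℝ] V)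
  have hz' : z' ∈ commutant L := mem_commutant.2 fun γ v => by
    apply p.1.2.injective
    simp only [z', LinearMap.comp_apply, LinearEquiv.coe_coe, LinearEquiv.apply_symm_apply]
    rw [← hp, LinearEquiv.apply_symm_apply, mem_commutant.1 z.2, hp]
  refine ⟨commutantH1 L ⟨z', hz'⟩ (Submodule.Quotient.mk c), mem_orbitSpan.2 ⟨_, rfl⟩, ?_⟩
  change Submodule.Quotient.mk _ = Submodule.Quotient.mk _
  congr 1
  ext γ
  simp [gaugeCocycle, commutantCocycle, z']

/-- The quotient `p' p⁻¹` has trivial automorphism, so its linear part commutes with `L`. -/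
theorem mem_orbitSpan_of_gauge {a b b' : H1 L} {p p' : gaugeGroup L} (hpp : p.1.1 = p'.1.1)
    (hb : b = gaugeH1 L p a) (hb' : b' = gaugeH1 L p' a) :
    b' ∈ orbitSpan (commutantH1 L) b := by
  subst hb hb'
  obtain ⟨c, rfl⟩ := Submodule.Quotient.mk_surjective _ a
  let q := p' * p⁻¹
  have hq1 : q.1.1 = 1 := by simp [q, hpp]
  have hq : (q.1.2 : V →ₗ[ℝ] V) ∈ commutant L := mem_commutant.2 fun γ v => by
    have := q.2 γ
    rw [hq1] at this
    simp only [MulAut.one_apply] at this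
    have h3 : q.1.2 * L γ = L γ * q.1.2 := by
      nth_rewrite 2 [this]; simp
    exact (LinearEquiv.congr_fun h3 v).symm
  refine mem_orbitSpan.2 ⟨⟨_, hq⟩, ?_⟩
  change Submodule.Quotient.mk _ = Submodule.Quotient.mk _
  congr 1
  ext γ
  simp [gaugeCocycle, commutantCocycle, q, hpp]

/-- An affine family of classes in a single gauge orbit is contained in the orbit of one of
its members under the commutant. -/
theorem exists_forall_mem_orbitSpan {m : ℕ} [Countable (MulAut Γ)] (r : Euc m →ᵃ[ℝ] H1 L)
    {Ω : Set (Euc m)} (hΩ : IsOpen Ω) (hne : Ω.Nonempty)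
    (h : ∀ x ∈ Ω, ∀ y ∈ Ω, ∃ p : gaugeGroup L, r y = gaugeH1 L p (r x)) :
    ∃ x₀, ∀ x, r x ∈ orbitSpan (commutantH1 L) (r x₀) := by
  classical
  obtain ⟨a, ha⟩ := hne
  choose! p hp using h a ha
  by_contra! hcon
  let σ (x₀ : Euc m) : AffineSubspace ℝ (Euc m) :=
    (orbitSpan (commutantH1 L) (r x₀)).toAffineSubspace.comap r
  have hσ : ∀ x₀, σ x₀ ≠ ⊤ := fun x₀ htop => by
    obtain ⟨x, hx⟩ := hcon x₀
    have : x ∈ σ x₀ := htop ▸ AffineSubspace.mem_top ℝ _ x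
    exact hx this
  -- One representative point is kept for each automorphism that occurs; all points with that
  -- automorphism lie in its subspace `σ`. A countable union of proper affine subspaces is null,
  -- whereas `Ω` is open and nonempty.
  let T : Set (MulAut Γ) := (fun x => (p x).1.1) '' Ω
  choose! x hx hxg using fun g (hg : g ∈ T) => hg
  have hcov : Ω ⊆ ⋃ g ∈ T, (σ (x g) : Set (Euc m)) := fun y hy => by
    have hg : (p y).1.1 ∈ T := ⟨y, hy, rfl⟩
    refine mem_iUnion₂.2 ⟨_, hg, ?_⟩
    exact mem_orbitSpan_of_gauge (hxg _ hg) (hp _ (hx _ hg)) (hp y hy)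
  have h0 : MeasureTheory.volume Ω = 0 := by
    refine MeasureTheory.measure_mono_null hcov ?_
    rw [MeasureTheory.measure_biUnion_null_iff (to_countable T)]
    exact fun g _ => MeasureTheory.Measure.addHaar_affineSubspace _ _ (hσ _)
  exact (hΩ.measure_pos MeasureTheory.volume ⟨a, ha⟩).ne' h0

/-- An affine family of cocycles whose classes lie in the commutant orbit of one class is
a linear perturbation of that class by the commutant. -/
theorem exists_linear_of_mem_orbitSpan {m : ℕ} (κ : Euc m →ᵃ[ℝ] cocycles L) (x₁ : Euc m)
    (h : ∀ x, (Submodule.Quotient.mk (κ x) : H1 L) ∈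
      orbitSpan (commutantH1 L) (Submodule.Quotient.mk (κ x₁))) :
    ∃ (σ : Euc m →ₗ[ℝ] Module.End ℝ V) (w : Euc m →ₗ[ℝ] V), (∀ u, σ u ∈ commutant L) ∧
      ∀ u γ, (κ (x₁ + u)).1 γ = (κ x₁).1 γ + σ u ((κ x₁).1 γ) + (L γ (w u) - w u) := by
  let b := Module.finBasis ℝ (Euc m)
  have h1 : ∀ v : Euc m, ∃ (z : commutant L) (w : V),
      ∀ γ, (κ.linear v).1 γ = z.1 ((κ x₁).1 γ) + (L γ w - w) := by
    intro v
    have hv : (Submodule.Quotient.mk (κ.linear v) : H1 L) ∈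
        orbitSpan (commutantH1 L) (Submodule.Quotient.mk (κ x₁)) := by
      have h2 : κ.linear v = κ (v +ᵥ x₁) - κ x₁ := by rw [κ.map_vadd]; simp
      rw [h2, Submodule.Quotient.mk_sub]
      exact sub_mem (h _) (h _)
    obtain ⟨z, hz⟩ := mem_orbitSpan.1 hv
    have hz' : (Submodule.Quotient.mk (commutantCocycle L z (κ x₁)) : H1 L) =
      Submodule.Quotient.mk (κ.linear v) := hz
    obtain ⟨w, hw⟩ := (Submodule.Quotient.eq _).1 hz'.symm
    refine ⟨z, w, fun γ => ?_⟩
    have := congrArg (fun c : cocycles L => c.1 γ) hw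
    simp only [coboundary, commutantCocycle, LinearMap.coe_mk, AddHom.coe_mk,
      Submodule.coe_sub, Pi.sub_apply] at this
    rw [this]; abel
  -- The commutant element and the coboundary are chosen only on a basis and extended linearly, so
  -- that they depend linearly on `u`.
  choose z w hzw using fun i => h1 (b i)
  refine ⟨b.constr ℝ fun i => (z i).1, b.constr ℝ w, fun u => ?_, fun u γ => ?_⟩
  · rw [Module.Basis.constr_apply_fintype (S := ℝ)]
    exact sum_mem fun i _ => (commutant L).smul_mem (z i).2 _
  · let ev : cocycles L →ₗ[ℝ] V := (LinearMap.proj γ).comp (cocycles L).subtype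
    have key : ev.comp κ.linear = (LinearMap.applyₗ ((κ x₁).1 γ)).comp
        (b.constr ℝ fun i => (z i).1) +
        ((L γ : V →ₗ[ℝ] V).comp (b.constr ℝ w) - b.constr ℝ w) := by
      refine b.ext fun i => ?_
      simp only [LinearMap.comp_apply, LinearMap.add_apply, LinearMap.sub_apply, Module.Basis.constr_basis]
      exact hzw i γ
    have h2 : κ (x₁ + u) = κ.linear u + κ x₁ := by
      rw [add_comm x₁ u]; exact κ.map_vadd x₁ u
    have h3 := LinearMap.congr_fun key u
    have h4 : (κ.linear u).1 γ = _ := h3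
    rw [h2, Submodule.coe_add, Pi.add_apply, h4]
    simp only [LinearMap.add_apply, LinearMap.comp_apply, LinearMap.sub_apply,
      LinearMap.applyₗ_apply_apply, LinearEquiv.coe_coe]
    abel

end Gauge

/-! ### Local topology of spaces étale over `ℝᵏ` -/

section LocalHomeomorph

variable {X Y Z : Type*} [TopologicalSpace X] [TopologicalSpace Y] [TopologicalSpace Z]

instance SimplyConnectedSpace.prod [SimplyConnectedSpace X] [SimplyConnectedSpace Y] :
    SimplyConnectedSpace (X × Y) := by
  refine simply_connected_iff_paths_homotopic.2 ⟨inferInstance, fun x y => ⟨fun p q => ?_⟩⟩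
  rw [← Path.Homotopic.prod_projLeft_projRight p, ← Path.Homotopic.prod_projLeft_projRight q]
  congr 1 <;> exact Subsingleton.elim _ _

/-- The charted space structure induced by a local homeomorphism. -/
@[reducible] def IsLocalHomeomorph.inducedChartedSpace {k : ℕ} {D : X → Euc k} (hD : IsLocalHomeomorph D) :
    ChartedSpace (Euc k) X where
  atlas := range fun x => (hD x).choose
  chartAt x := (hD x).choose
  mem_chart_source x := (hD x).choose_spec.1
  chart_mem_atlas x := ⟨x, rfl⟩

theorem IsLocalHomeomorph.locallyPathConnectedSpace {k : ℕ} {D : X → Euc k}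
    (hD : IsLocalHomeomorph D) : LocallyPathConnectedSpace X :=
  have := hD.inducedChartedSpace
  ChartedSpace.locallyPathConnectedSpace (H := Euc k) X

theorem IsLocalHomeomorph.locallyCompactSpace {k : ℕ} {D : X → Euc k}
    (hD : IsLocalHomeomorph D) : LocallyCompactSpace X :=
  have := hD.inducedChartedSpace
  ChartedSpace.locallyCompactSpace (Euc k) X

theorem IsLocalHomeomorph.exists_contractible_nhd {k : ℕ} {D : X → Euc k}
    (hD : IsLocalHomeomorph D) {x : X} {W : Set X} (hW : W ∈ 𝓝 x) :
    ∃ N, IsOpen N ∧ x ∈ N ∧ N ⊆ W ∧ ContractibleSpace N ∧ InjOn D N := by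
  obtain ⟨e, hxe, rfl⟩ := hD x
  have h1 : e.target ∩ e.symm ⁻¹' W ∈ 𝓝 (e x) := by
    refine inter_mem (e.open_target.mem_nhds (e.map_source hxe)) ?_
    refine (e.symm.continuousAt (e.map_source hxe)).preimage_mem_nhds ?_
    rwa [e.left_inv hxe]
  obtain ⟨ε, hε, hsub⟩ := Metric.mem_nhds_iff.1 h1
  have hball : Metric.ball (e x) ε ⊆ e.symm.source := fun z hz => (hsub hz).1
  refine ⟨e.symm '' Metric.ball (e x) ε, e.symm.isOpen_image_of_subset_source Metric.isOpen_ball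
    hball, ⟨e x, Metric.mem_ball_self hε, e.left_inv hxe⟩, ?_, ?_, ?_⟩
  · rintro _ ⟨z, hz, rfl⟩
    exact (hsub hz).2
  · have := Metric.contractibleSpace_ball (x := e x) hε
    exact (e.symm.homeomorphOfImageSubsetSource hball rfl).symm.contractibleSpace
  · refine e.injOn.mono ?_
    rintro _ ⟨z, hz, rfl⟩
    exact e.symm.map_source (hball hz)

end LocalHomeomorph

/-! ### Simply connected coverings -/

section Covering

variable {X Y Z : Type*} [TopologicalSpace X] [TopologicalSpace Y] [TopologicalSpace Z]

theorem IsCoveringMap.t2Space [T2Space Y] {p : X → Y} (hp : IsCoveringMap p) : T2Space X := by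
  refine ⟨fun x y hxy => ?_⟩
  by_cases h : p x = p y
  · exact hp.isSeparatedMap x y h hxy
  · obtain ⟨U, V, hU, hV, hx, hy, hd⟩ := t2_separation h
    exact ⟨p ⁻¹' U, p ⁻¹' V, hU.preimage hp.continuous, hV.preimage hp.continuous, hx, hy,
      hd.preimage p⟩

/-- Simply connected covering spaces of the same space are homeomorphic over that space. -/
theorem IsCoveringMap.exists_homeomorph [SimplyConnectedSpace X] [LocallyPathConnectedSpace X]
    [SimplyConnectedSpace Y] [LocallyPathConnectedSpace Y] {p : X → Z} {q : Y → Z}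
    (hp : IsCoveringMap p) (hq : IsCoveringMap q) {x₀ : X} {y₀ : Y} (h₀ : p x₀ = q y₀) :
    ∃ θ : X ≃ₜ Y, θ x₀ = y₀ ∧ ∀ x, q (θ x) = p x := by
  obtain ⟨F, ⟨hF₀, hF⟩, -⟩ :=
    hq.existsUnique_continuousMap_lifts ⟨p, hp.continuous⟩ x₀ y₀ h₀.symm
  obtain ⟨G, ⟨hG₀, hG⟩, -⟩ :=
    hp.existsUnique_continuousMap_lifts ⟨q, hq.continuous⟩ y₀ x₀ h₀
  have hF' : ∀ x, q (F x) = p x := congrFun hF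
  have hG' : ∀ y, p (G y) = q y := congrFun hG
  have h1 : G ∘ F = id := hp.eq_of_comp_eq (G.continuous.comp F.continuous) continuous_id
    (by ext x; simp [hF', hG']) x₀ (by simp [hF₀, hG₀])
  have h2 : F ∘ G = id := hq.eq_of_comp_eq (F.continuous.comp G.continuous) continuous_id
    (by ext x; simp [hF', hG']) y₀ (by simp [hF₀, hG₀])
  exact ⟨⟨⟨F, G, congrFun h1, congrFun h2⟩, F.continuous, G.continuous⟩, hF₀, hF'⟩

end Covering

/-! ### Deck groups: proper discontinuity and finite generation -/

section Deck

variable {X' X : Type*} [TopologicalSpace X'] [TopologicalSpace X] {p : X' → X}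

theorem IsUniversalCover.exists_deck [LocallyPathConnectedSpace X'] (hp : IsUniversalCover p)
    {x y : X'} (h : p x = p y) : ∃ γ : deckGroup p, γ.1 x = y := by
  have := hp.simplyConnected
  obtain ⟨θ, hθ, hθp⟩ := hp.isCoveringMap.exists_homeomorph hp.isCoveringMap h
  exact ⟨⟨θ, hθp⟩, hθ⟩

theorem IsUniversalCover.deck_ext (hp : IsUniversalCover p) {γ δ : deckGroup p} {x : X'}
    (h : γ.1 x = δ.1 x) : γ = δ := by
  have := hp.simplyConnected
  have h1 : (γ.1 : X' → X') = δ.1 := hp.isCoveringMap.eq_of_comp_eq γ.1.continuous δ.1.continuous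
    (by ext z; simp only [Function.comp_apply]; rw [γ.2 z, δ.2 z]) x h
  exact Subtype.ext (Homeomorph.ext (congrFun h1))

/-- Local injectivity of `p` gives each pair `(x, γ x)` a neighbourhood that meets the graph of no
other deck transformation. The pairs in `K × K` with equal image in `X` form a compact set, which
finitely many such neighbourhoods cover. -/
theorem IsUniversalCover.finite_deck [T2Space X] [LocallyPathConnectedSpace X'] (hp : IsUniversalCover p) {K : Set X'}
    (hK : IsCompact K) : {γ : deckGroup p | ∃ x ∈ K, γ.1 x ∈ K}.Finite := by
  let A : Set (X' × X') := {z | p z.1 = p z.2}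
  have hA : IsClosed A := isClosed_eq (hp.isCoveringMap.continuous.comp continuous_fst)
    (hp.isCoveringMap.continuous.comp continuous_snd)
  have hKA : IsCompact ((K ×ˢ K) ∩ A) := (hK.prod hK).inter_right hA
  have hloc : ∀ z : X' × X', ∃ W ∈ 𝓝 z, {γ : deckGroup p | ∃ x, (x, γ.1 x) ∈ W}.Finite := by
    rintro ⟨x, y⟩
    by_cases h : ∃ γ : deckGroup p, γ.1 x = y
    · obtain ⟨γ, rfl⟩ := h
      obtain ⟨U, hU, hxU, hinj⟩ := hp.isCoveringMap.isLocalHomeomorph.isLocallyInjective x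
      refine ⟨U ×ˢ (γ.1 '' U), prod_mem_nhds (hU.mem_nhds hxU)
        ((γ.1.isOpenMap U hU).mem_nhds ⟨x, hxU, rfl⟩), (finite_singleton γ).subset ?_⟩
      rintro δ ⟨u, hu, u', hu', he⟩
      have : u' = u := hinj hu' hu (by rw [← γ.2 u', he, δ.2 u])
      subst this
      exact hp.deck_ext he.symm
    · refine ⟨Aᶜ, hA.isOpen_compl.mem_nhds fun hxy => h (hp.exists_deck hxy), ?_⟩
      refine finite_empty.subset ?_
      rintro γ ⟨u, hu⟩
      exact hu (γ.2 u).symm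
  choose W hW hfin using hloc
  obtain ⟨t, -, ht⟩ := hKA.elim_nhds_subcover W fun z _ => hW z
  refine ((t.finite_toSet.biUnion fun z _ => hfin z)).subset ?_
  rintro γ ⟨x, hx, hγx⟩
  obtain ⟨z, hz, hzW⟩ := mem_iUnion₂.1 (ht (show (x, γ.1 x) ∈ (K ×ˢ K) ∩ A from
    ⟨⟨hx, hγx⟩, (γ.2 x).symm⟩))
  exact mem_iUnion₂.2 ⟨z, hz, x, hzW⟩

/-- The total space of a universal cover of a compact space is covered by the translates of
the interior of a compact set. -/
theorem IsUniversalCover.exists_compact [CompactSpace X] [LocallyPathConnectedSpace X']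
    [LocallyCompactSpace X'] (hp : IsUniversalCover p) :
    ∃ K : Set X', IsCompact K ∧ ∀ x, ∃ γ : deckGroup p, γ.1 x ∈ interior K := by
  choose K hK hKx using fun x : X' => exists_compact_mem_nhds x
  choose s hs using hp.surjective
  obtain ⟨t, ht⟩ := CompactSpace.elim_nhds_subcover (fun y => p '' interior (K (s y))) fun y =>
    (hp.isCoveringMap.isOpenMap _ isOpen_interior).mem_nhds
      ⟨s y, mem_interior_iff_mem_nhds.2 (hKx _), hs y⟩
  refine ⟨⋃ y ∈ t, K (s y), t.isCompact_biUnion fun y _ => hK _, fun x => ?_⟩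
  have hx : p x ∈ ⋃ y ∈ t, p '' interior (K (s y)) := by
    rw [ht]; trivial
  obtain ⟨y, hy, x', hx', he⟩ := mem_iUnion₂.1 hx
  obtain ⟨γ, rfl⟩ := hp.exists_deck he.symm
  exact ⟨γ, interior_mono (subset_biUnion_of_mem (u := fun y => K (s y)) hy) hx'⟩

/-- The finite set `S` of elements moving `K` to meet itself generates. The points that `H = ⟨S⟩`
can bring into the interior of `K`, and those that elements outside `H` can, form two disjoint open
sets covering the connected space `X'`. -/
theorem IsUniversalCover.fg_deck [T2Space X] [CompactSpace X] [LocallyPathConnectedSpace X']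
    [LocallyCompactSpace X'] (hp : IsUniversalCover p) : Group.FG (deckGroup p) := by
  have := hp.simplyConnected
  obtain ⟨K, hK, hcov⟩ := hp.exists_compact
  set S := {γ : deckGroup p | ∃ x ∈ K, γ.1 x ∈ K}
  refine ⟨(Subgroup.fg_iff _).2 ⟨S, ?_, hp.finite_deck hK⟩⟩
  set H := Subgroup.closure S
  let A : Set X' := ⋃ γ ∈ H, γ.1 ⁻¹' interior K
  let A' : Set X' := ⋃ γ ∈ (H : Set (deckGroup p))ᶜ, γ.1 ⁻¹' interior K
  have hS : ∀ {γ δ : deckGroup p} {x}, γ.1 x ∈ K → δ.1 x ∈ K → δ ∈ H → γ ∈ H := by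
    intro γ δ x h1 h2 h3
    have : γ * δ⁻¹ ∈ S := by
      refine ⟨δ.1 x, h2, ?_⟩
      change γ.1 (δ.1.symm (δ.1 x)) ∈ K
      rwa [δ.1.symm_apply_apply]
    simpa using mul_mem (Subgroup.subset_closure this) h3
  have hA : IsOpen A := isOpen_biUnion fun γ _ => isOpen_interior.preimage γ.1.continuous
  have hA' : IsOpen A' := isOpen_biUnion fun γ _ => isOpen_interior.preimage γ.1.continuous
  have hcompl : Aᶜ = A' := by
    ext x
    simp only [A, A', mem_compl_iff, mem_iUnion₂, not_exists, mem_preimage]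
    constructor
    · intro h
      obtain ⟨γ, hγ⟩ := hcov x
      exact ⟨γ, fun hH => h γ hH hγ, hγ⟩
    · rintro ⟨γ, hγ, hx⟩ δ hδ hx'
      exact hγ (hS (interior_subset hx) (interior_subset hx') hδ)
  have hclopen : IsClopen A := ⟨⟨hcompl ▸ hA'⟩, hA⟩
  obtain ⟨x₁⟩ : Nonempty X' := inferInstance
  obtain ⟨γ₁, h₁⟩ := hcov x₁
  set x₀ := γ₁.1 x₁
  have huniv : A = univ := hclopen.eq_univ ⟨x₀, mem_iUnion₂.2 ⟨1, one_mem H, h₁⟩⟩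
  refine eq_top_iff.2 fun γ _ => ?_
  have hx : γ.1.symm x₀ ∈ A := huniv ▸ mem_univ _
  obtain ⟨δ, hδ, hδx⟩ := mem_iUnion₂.1 hx
  refine hS (x := γ.1.symm x₀) ?_ (interior_subset hδx) hδ
  rw [γ.1.apply_symm_apply]
  exact interior_subset h₁

/-- The group is a quotient of a finitely generated free group, hence countable, and an automorphism
is determined by its values on finitely many generators. -/
theorem countable_mulAut {G : Type*} [Group G] [hG : Group.FG G] : Countable (MulAut G) := by
  obtain ⟨S, hS, hfin⟩ := (Subgroup.fg_iff _).1 hG.1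
  have : Finite S := hfin
  have hsurj : Function.Surjective (FreeGroup.lift (Subtype.val : S → G)) := by
    rw [← MonoidHom.range_eq_top, FreeGroup.range_lift_eq_closure, Subtype.range_coe, hS]
  have : Countable G := hsurj.countable
  refine Function.Injective.countable (f := fun (g : MulAut G) (s : S) => g s.1) fun g h hgh => ?_
  have : g.toMonoidHom = h.toMonoidHom :=
    MonoidHom.eq_of_eqOn_dense hS fun s hs => congrFun hgh ⟨s, hs⟩
  exact MulEquiv.ext fun x => DFunLike.congr_fun this x

end Deck

/-! ### Rigidity of locally affine functions -/

section LocallyAffine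

variable {E E' : Type*} [NormedAddCommGroup E] [NormedSpace ℝ E] [AddCommGroup E'] [Module ℝ E']

theorem AffineMap.eq_of_eventuallyEq {T T' : E →ᵃ[ℝ] E'} {a : E} (h : ∀ᶠ x in 𝓝 a, T x = T' x) :
    T = T' := by
  obtain ⟨U, hU, hUo, haU⟩ := eventually_nhds_iff.1 h
  have hspan := hUo.affineSpan_eq_top ⟨a, haU⟩
  ext x
  have hx : x ∈ affineSpan ℝ U := hspan ▸ AffineSubspace.mem_top ℝ E x
  refine affineSpan_induction (p := fun x => T x = T' x) hx hU fun c u v w hu hv hw => ?_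
  simp only [AffineMap.map_vadd, map_smul, AffineMap.linearMap_vsub, hu, hv, hw]

/-- `D'` is locally an affine function of `D`. -/
def IsLocallyAffineIn {X E E' : Type*} [TopologicalSpace X] [AddCommGroup E] [Module ℝ E]
    [AddCommGroup E'] [Module ℝ E'] (D : X → E) (D' : X → E') : Prop :=
  ∀ x, ∃ T : E →ᵃ[ℝ] E', ∀ᶠ x' in 𝓝 x, D' x' = T (D x')

variable {X : Type*} [TopologicalSpace X]

theorem AffineMap.eq_of_eventuallyEq_comp {D : X → E} {x : X} (hD : 𝓝 (D x) ≤ map D (𝓝 x))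
    {T T' : E →ᵃ[ℝ] E'} (h : ∀ᶠ x' in 𝓝 x, T (D x') = T' (D x')) : T = T' :=
  AffineMap.eq_of_eventuallyEq (a := D x) (hD (eventually_map.2 h))

/-- A locally affine function of an open map on a connected space is globally an affine
function of it. -/
theorem IsLocallyAffineIn.exists_eq [PreconnectedSpace X] [Nonempty X] {D : X → E} {D' : X → E'}
    (h : IsLocallyAffineIn D D') (hD : IsOpenMap D) : ∃ T : E →ᵃ[ℝ] E', ∀ x, D' x = T (D x) := by
  choose T hT using h
  -- Images under `D` of neighbourhoods contain open sets, which determine an affine map; so the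
  -- local maps at nearby points coincide.
  have hc : IsLocallyConstant T := (IsLocallyConstant.iff_eventually_eq T).2 fun x => by
    filter_upwards [(hT x).eventually_nhds] with y hy
    refine AffineMap.eq_of_eventuallyEq_comp (hD.nhds_le y) ?_
    filter_upwards [hy, hT y] with z h1 h2
    rw [← h1, ← h2]
  obtain ⟨x₀⟩ := ‹Nonempty X›
  refine ⟨T x₀, fun x => ?_⟩
  rw [hc.apply_eq_of_preconnectedSpace x₀ x]
  exact (hT x).self_of_nhds

end LocallyAffine

/-! ### Existence of developing maps -/

section Developing

variable {n : ℕ} {M : Type*} [TopologicalSpace M] [ChartedSpace (Euc n) M]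

theorem exists_affineMap_chart_change [HasGroupoid M (affineGroupoid n)] {a b p : M}
    (ha : p ∈ (chartAt (Euc n) a).source) (hb : p ∈ (chartAt (Euc n) b).source) :
    ∃ A : Euc n →ᵃ[ℝ] Euc n, ∀ᶠ q in 𝓝 p, chartAt (Euc n) b q = A (chartAt (Euc n) a q) := by
  have h := HasGroupoid.compatible (G := affineGroupoid n) (chart_mem_atlas (Euc n) a)
    (chart_mem_atlas (Euc n) b)
  obtain ⟨A, hA⟩ := (mem_groupoid_of_pregroupoid.1 h).1 (chartAt (Euc n) a p) (by simp [ha, hb])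
  refine ⟨A, ?_⟩
  filter_upwards [((chartAt (Euc n) a).continuousAt ha).eventually hA,
    (chartAt (Euc n) a).open_source.mem_nhds ha] with q hq hqa
  simpa [hqa] using hq

theorem exists_affineEquiv_chart_change [HasGroupoid M (affineGroupoid n)] {a b p : M}
    (ha : p ∈ (chartAt (Euc n) a).source) (hb : p ∈ (chartAt (Euc n) b).source) :
    ∃ A : Euc n ≃ᵃ[ℝ] Euc n, ∀ᶠ q in 𝓝 p, chartAt (Euc n) b q = A (chartAt (Euc n) a q) := by
  obtain ⟨A, hA⟩ := exists_affineMap_chart_change ha hb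
  obtain ⟨A', hA'⟩ := exists_affineMap_chart_change hb ha
  have h1 : A'.comp A = AffineMap.id ℝ _ :=
    AffineMap.eq_of_eventuallyEq_comp ((chartAt (Euc n) a).map_nhds_eq ha).ge <| by
      filter_upwards [hA, hA'] with q h1 h2
      simp only [AffineMap.comp_apply, AffineMap.id_apply]
      rw [← h1, ← h2]
  have h2 : A.comp A' = AffineMap.id ℝ _ :=
    AffineMap.eq_of_eventuallyEq_comp ((chartAt (Euc n) b).map_nhds_eq hb).ge <| by
      filter_upwards [hA, hA'] with q h1 h2
      simp only [AffineMap.comp_apply, AffineMap.id_apply]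
      rw [← h2, ← h1]
  exact ⟨AffineEquiv.ofBijective (φ := A) ⟨
    Function.LeftInverse.injective (g := A') fun x => DFunLike.congr_fun h1 x,
    Function.RightInverse.surjective (g := A') fun x => DFunLike.congr_fun h2 x⟩, hA⟩

/-- A simply connected space which is mapped to an affine manifold by a continuous open map has
a developing map. -/
theorem exists_developingMap [HasGroupoid M (affineGroupoid n)] {X : Type*} [TopologicalSpace X]
    [SimplyConnectedSpace X] [LocallyPathConnectedSpace X] {j : X → M} (hj : Continuous j)
    (hjo : IsOpenMap j) :
    ∃ D : X → Euc n, ∀ x, ∃ T : Euc n ≃ᵃ[ℝ] Euc n,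
      ∀ᶠ x' in 𝓝 x, D x' = T (chartAt (Euc n) (j x) (j x')) := by
  classical
  let G := Euc n ≃ᵃ[ℝ] Euc n
  let _ : TopologicalSpace G := ⊥
  have : DiscreteTopology G := ⟨rfl⟩
  let U : X → Set X := fun x => j ⁻¹' (chartAt (Euc n) (j x)).source
  have hU : ∀ x, IsOpen (U x) := fun x => (chartAt (Euc n) (j x)).open_source.preimage hj
  have hopen : ∀ x, ∀ z ∈ U x, 𝓝 (chartAt (Euc n) (j x) (j z)) ≤
      map (fun z => chartAt (Euc n) (j x) (j z)) (𝓝 z) := fun x z hz => by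
    rw [← (chartAt (Euc n) (j x)).map_nhds_eq hz]
    exact map_mono (m := chartAt (Euc n) (j x)) (hjo.nhds_le z)
  have key : ∀ x y z, ∃ T : G, z ∈ U x → z ∈ U y →
      ∀ᶠ z' in 𝓝 z, chartAt (Euc n) (j x) (j z') = T (chartAt (Euc n) (j y) (j z')) := by
    intro x y z
    by_cases h : z ∈ U x ∧ z ∈ U y
    · obtain ⟨T, hT⟩ := exists_affineEquiv_chart_change h.2 h.1
      exact ⟨T, fun _ _ => hj.continuousAt.eventually hT⟩
    · exact ⟨1, fun h1 h2 => (h ⟨h1, h2⟩).elim⟩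
  choose T hT using key
  have huniq : ∀ x, ∀ z ∈ U x, ∀ g g' : G, (∀ᶠ z' in 𝓝 z,
      g (chartAt (Euc n) (j x) (j z')) = g' (chartAt (Euc n) (j x) (j z'))) → g = g' := by
    intro x z hz g g' h
    have : (g : Euc n →ᵃ[ℝ] Euc n) = g' := AffineMap.eq_of_eventuallyEq_comp (hopen x z hz) h
    exact AffineEquiv.ext fun v => DFunLike.congr_fun this v
  -- The bundle of germs of affine coordinates, with fibre the affine group made discrete. Its total
  -- space covers the simply connected space `X`, so it has a global section `g`, which selects
  -- coherent charts.
  let Z : FiberBundleCore X X G :=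
    { baseSet := U
      isOpen_baseSet := hU
      indexAt := id
      mem_baseSet_at := fun x => mem_chart_source _ _
      coordChange := fun x y z g => g * T x y z
      coordChange_self := fun x z hz g => by
        rw [huniq x z hz (T x x z) 1 ?_, mul_one]
        filter_upwards [hT x x z hz hz] with z' h1
        rw [← h1]; rfl
      continuousOn_coordChange := fun x y => by
        rintro ⟨z, g⟩ ⟨⟨hx, hy⟩, -⟩
        refine ContinuousAt.continuousWithinAt ?_
        refine (continuousAt_const (y := g * T x y z)).congr ?_
        have hg : ∀ᶠ p in 𝓝 (z, g), p.2 = g := by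
          have : ({g} : Set G) ∈ 𝓝 g := (isOpen_discrete _).mem_nhds rfl
          exact (continuousAt_snd (p := (z, g))).preimage_mem_nhds this
        have hz : ∀ᶠ z' in 𝓝 z, T x y z' = T x y z := by
          filter_upwards [(hT x y z hx hy).eventually_nhds, (hU x).mem_nhds hx,
            (hU y).mem_nhds hy] with z' h1 hx' hy'
          refine huniq y z' hy' _ _ ?_
          filter_upwards [h1, hT x y z' hx' hy'] with w h2 h3
          rw [← h2, ← h3]
        filter_upwards [hg, (continuousAt_fst (p := (z, g))).eventually hz] with p h1 h2
        simp only [h1, h2]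
      coordChange_comp := fun x y w z ⟨⟨hx, hy⟩, hw⟩ g => by
        rw [mul_assoc, huniq w z hw (T x y z * T y w z) (T x w z) ?_]
        filter_upwards [hT x y z hx hy, hT y w z hy hw, hT x w z hx hw] with z' h1 h2 h3
        rw [← h3, h1, h2]; rfl }
  have hcov : IsCoveringMap (Bundle.TotalSpace.proj : Z.TotalSpace → X) :=
    FiberBundle.isCoveringMap (F := G) (E := Z.Fiber)
  obtain ⟨x₀⟩ : Nonempty X := inferInstance
  obtain ⟨F, ⟨-, hF⟩, -⟩ := hcov.existsUnique_continuousMap_lifts (ContinuousMap.id X) x₀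
    (⟨x₀, (1 : G)⟩ : Z.TotalSpace) rfl
  have hF' : ∀ x, (F x).proj = x := congrFun hF
  let g : X → G := fun x => (F x).2
  -- Each value is read in the chart at the point itself. Local constancy of the section, `g z * T z
  -- x z = g x` for `z` near `x`, rewrites it in the chart at `j x`.
  refine ⟨fun x => g x (chartAt (Euc n) (j x) (j x)), fun x => ⟨g x, ?_⟩⟩
  have hx : x ∈ U x := mem_chart_source _ _
  have hcont : ContinuousAt (fun z => ((Z.localTriv x) (F z)).2) x := by
    refine continuous_snd.continuousAt.comp (ContinuousAt.comp ?_ F.continuous.continuousAt)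
    refine (Z.localTriv x).continuousAt ?_
    rw [Z.mem_localTriv_source, hF' x]
    exact hx
  have hev : ∀ᶠ z in 𝓝 x, ((Z.localTriv x) (F z)).2 = ((Z.localTriv x) (F x)).2 :=
    hcont.preimage_mem_nhds ((isOpen_discrete {((Z.localTriv x) (F x)).2}).mem_nhds rfl)
  have hval : ∀ z, ((Z.localTriv x) (F z)).2 = g z * T z x z := fun z => by
    rw [Z.localTriv_apply]
    change g z * T (F z).proj x (F z).proj = _
    rw [hF' z]
  filter_upwards [hev, (hU x).mem_nhds hx] with z h1 hz
  have hzz : z ∈ U z := mem_chart_source _ _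
  have h2 : T x x x = 1 := huniq x x hx _ _ <| by
    filter_upwards [hT x x x hx hx] with z' h1
    rw [← h1]; rfl
  rw [hval, hval, h2, mul_one] at h1
  rw [← h1, (hT z x z hzz hz).self_of_nhds]
  rfl

end Developing

/-! ### Affine surjections and product coordinates -/

section Splitting

/-- A surjective affine map to `ℝᵐ` is the first component of an affine isomorphism. -/
theorem AffineMap.exists_splitting {m l : ℕ} (α : Euc (m + l) →ᵃ[ℝ] Euc m)
    (hα : Function.Surjective α) :
    ∃ T : Euc (m + l) ≃ᵃ[ℝ] (Euc m × Euc l), ∀ z, (T z).1 = α z := by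
  have hs : Function.Surjective α.linear := α.linear_surjective_iff.2 hα
  obtain ⟨s, hs'⟩ := α.linear.exists_rightInverse_of_surjective (LinearMap.range_eq_top.2 hs)
  have hs'' : ∀ x, α.linear (s x) = x := fun x => LinearMap.congr_fun hs' x
  have hdim : Module.finrank ℝ (LinearMap.ker α.linear) = Module.finrank ℝ (Euc l) := by
    have := α.linear.finrank_range_add_finrank_ker
    rw [LinearMap.range_eq_top.2 hs, finrank_top] at this
    simp only [finrank_euclideanSpace_fin] at this ⊢
    omega
  let e := LinearEquiv.ofFinrankEq _ _ hdim
  let P : Euc (m + l) →ₗ[ℝ] LinearMap.ker α.linear :=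
    LinearMap.codRestrict _ (LinearMap.id - s.comp α.linear) fun z => by simp [hs'']
  let S : Euc (m + l) →ᵃ[ℝ] (Euc m × Euc l) :=
    α.prod ((e : _ →ₗ[ℝ] Euc l).comp P).toAffineMap
  have hinj : Function.Injective S.linear := by
    refine (injective_iff_map_eq_zero _).2 fun z hz => ?_
    have h1 : α.linear z = 0 := congrArg Prod.fst hz
    have h2 : e (P z) = 0 := congrArg Prod.snd hz
    have h3 : P z = 0 := e.map_eq_zero_iff.1 h2
    have h4 : z - s (α.linear z) = 0 := congrArg Subtype.val h3
    simpa [h1] using h4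
  have hsurj : Function.Surjective S.linear :=
    (LinearMap.injective_iff_surjective_of_finrank_eq_finrank (by simp)).1 hinj
  exact ⟨AffineEquiv.ofBijective (φ := S) (S.linear_bijective_iff.1 ⟨hinj, hsurj⟩), fun z => rfl⟩

/-- The range of `T` is an affine subspace that contains a nonempty open set, and an open set spans
everything. -/
theorem AffineMap.surjective_of_isOpenMap {X E E' : Type*} [TopologicalSpace X]
    [AddCommGroup E] [Module ℝ E] [NormedAddCommGroup E'] [NormedSpace ℝ E']
    {D : X → E} {D' : X → E'} {x : X} (hD' : 𝓝 (D' x) ≤ map D' (𝓝 x)) {T : E →ᵃ[ℝ] E'}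
    (h : ∀ᶠ x' in 𝓝 x, D' x' = T (D x')) : Function.Surjective T := by
  have h1 : range T ∈ 𝓝 (D' x) := hD' <|
    mem_map.2 (h.mono fun x' hx' => ⟨D x', hx'.symm⟩)
  rw [← T.linear_surjective_iff, ← LinearMap.range_eq_top]
  by_contra hne
  have hsub : range T ⊆ ((LinearMap.range T.linear).toAffineSubspace.map
      (AffineEquiv.vaddConst ℝ (T 0) : E' →ᵃ[ℝ] E') : AffineSubspace ℝ E') := by
    rintro _ ⟨z, rfl⟩
    refine ⟨T.linear z, ⟨z, rfl⟩, ?_⟩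
    have := congrFun T.decomp z
    simpa using this.symm
  refine hne (eq_top_iff.2 fun v _ => ?_)
  have hspan := isOpen_interior.affineSpan_eq_top (u := interior (range T))
    ⟨D' x, mem_interior_iff_mem_nhds.2 h1⟩
  have hle : affineSpan ℝ (interior (range T)) ≤ _ :=
    affineSpan_le.2 (interior_subset.trans hsub)
  obtain ⟨w, hw, hwv⟩ := hle (hspan ▸ AffineSubspace.mem_top ℝ E' (v + T 0))
  have : w = v := by simpa using hwv
  exact this ▸ hw

end Splitting

/-! ### Smooth trivializations of the bundle -/

section Bundle

variable {m l : ℕ} {M B : Type*} [TopologicalSpace M] [ChartedSpace (Euc (m + l)) M]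
  [TopologicalSpace B] [ChartedSpace (Euc m) B]

/-- A smooth trivialization of `f` over `V`, with typical fibre `f⁻¹(b₀)`. -/
structure IsFibreTrivialization (m l : ℕ) {M B : Type*} [TopologicalSpace M]
    [ChartedSpace (Euc (m + l)) M] [TopologicalSpace B] [ChartedSpace (Euc m) B]
    (f : M → B) (b₀ : B) (V : Set B) (Φ : B × M → M) (Ψ : M → M) : Prop where
  isOpen : IsOpen V
  contMDiffOn : ContMDiffOn (𝓘(ℝ, Euc m).prod 𝓘(ℝ, Euc (m + l))) 𝓘(ℝ, Euc (m + l)) ∞ Φ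
    (V ×ˢ (f ⁻¹' {b₀}))
  contMDiffOn_inv : ContMDiffOn 𝓘(ℝ, Euc (m + l)) 𝓘(ℝ, Euc (m + l)) ∞ Ψ (f ⁻¹' V)
  proj : ∀ v ∈ V, ∀ y ∈ f ⁻¹' {b₀}, f (Φ (v, y)) = v
  left_inv : ∀ v ∈ V, ∀ y ∈ f ⁻¹' {b₀}, Ψ (Φ (v, y)) = y
  inv_mem : ∀ p ∈ f ⁻¹' V, Ψ p ∈ f ⁻¹' {b₀}
  right_inv : ∀ p ∈ f ⁻¹' V, Φ (f p, Ψ p) = p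

variable {f : M → B} {b₀ : B} {V : Set B} {Φ : B × M → M} {Ψ : M → M}

theorem IsSmoothlyLocallyTrivial.exists_fibreTrivialization
    (h : IsSmoothlyLocallyTrivial (m + l) m f b₀) (b : B) :
    ∃ V Φ Ψ, b ∈ V ∧ IsFibreTrivialization m l f b₀ V Φ Ψ := by
  obtain ⟨V, Φ, Ψ, hV, hb, h1, h2, h3, h4⟩ := h b
  exact ⟨V, Φ, Ψ, hb, hV, h1, h2, fun v hv y hy => (h3 v hv y hy).1,
    fun v hv y hy => (h3 v hv y hy).2, fun p hp => (h4 p hp).1, fun p hp => (h4 p hp).2⟩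

theorem IsFibreTrivialization.slice (h : IsFibreTrivialization m l f b₀ V Φ Ψ) {v : B}
    (hv : v ∈ V) : ContMDiffOn 𝓘(ℝ, Euc (m + l)) 𝓘(ℝ, Euc (m + l)) ∞ (fun y => Φ (v, y))
      (f ⁻¹' {b₀}) :=
  h.contMDiffOn.comp (contMDiffOn_const.prodMk contMDiffOn_id) fun _ hy => ⟨hv, hy⟩

/-- Two trivializations can be made to agree on a given fibre, which may be parametrized by any
diffeomorphism. -/
theorem IsFibreTrivialization.change (h : IsFibreTrivialization m l f b₀ V Φ Ψ) {b : B}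
    (hb : b ∈ V) {s s' : M → M}
    (hs : ContMDiffOn 𝓘(ℝ, Euc (m + l)) 𝓘(ℝ, Euc (m + l)) ∞ s (f ⁻¹' {b₀}))
    (hs' : ContMDiffOn 𝓘(ℝ, Euc (m + l)) 𝓘(ℝ, Euc (m + l)) ∞ s' (f ⁻¹' {b}))
    (hm : MapsTo s (f ⁻¹' {b₀}) (f ⁻¹' {b})) (hm' : MapsTo s' (f ⁻¹' {b}) (f ⁻¹' {b₀}))
    (hl : LeftInvOn s' s (f ⁻¹' {b₀})) (hr : RightInvOn s' s (f ⁻¹' {b})) :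
    ∃ Φ' Ψ', IsFibreTrivialization m l f b₀ V Φ' Ψ' ∧ ∀ y ∈ f ⁻¹' {b₀}, Φ' (b, y) = s y := by
  have hsub : f ⁻¹' {b} ⊆ f ⁻¹' V := fun p hp => by
    rw [mem_preimage, show f p = b from hp]; exact hb
  have hΨs : MapsTo (fun y => Ψ (s y)) (f ⁻¹' {b₀}) (f ⁻¹' {b₀}) := fun y hy =>
    h.inv_mem _ (hsub (hm hy))
  have hΦb : MapsTo (fun y => Φ (b, y)) (f ⁻¹' {b₀}) (f ⁻¹' {b}) := fun y hy => h.proj b hb y hy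
  have hright : ∀ p ∈ f ⁻¹' {b}, Φ (b, Ψ p) = p := fun p hp => by
    have := h.right_inv p (hsub hp)
    rwa [show f p = b from hp] at this
  -- The trivialization is precomposed, over every `v`, with the same self-diffeomorphism `Ψ ∘ s` of
  -- the typical fibre; at `v = b` this cancels `Φ (b, ·)` and leaves `s`.
  refine ⟨fun z => Φ (z.1, Ψ (s z.2)), fun p => s' (Φ (b, Ψ p)), ⟨h.isOpen, ?_, ?_, ?_, ?_, ?_, ?_⟩,
    ?_⟩
  · have h1 : ContMDiffOn 𝓘(ℝ, Euc (m + l)) 𝓘(ℝ, Euc (m + l)) ∞ (fun y => Ψ (s y)) (f ⁻¹' {b₀}) :=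
      h.contMDiffOn_inv.comp hs fun y hy => hsub (hm hy)
    refine h.contMDiffOn.comp
      (contMDiffOn_fst.prodMk (h1.comp contMDiffOn_snd fun z hz => hz.2)) ?_
    rintro ⟨v, y⟩ ⟨hv, hy⟩
    exact ⟨hv, hΨs hy⟩
  · exact hs'.comp ((h.slice hb).comp h.contMDiffOn_inv fun p hp => h.inv_mem p hp)
      fun p hp => hΦb (h.inv_mem p hp)
  · exact fun v hv y hy => h.proj v hv _ (hΨs hy)
  · intro v hv y hy
    change s' (Φ (b, Ψ (Φ (v, Ψ (s y))))) = y
    rw [h.left_inv v hv _ (hΨs hy), hright _ (hm hy)]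
    exact hl hy
  · exact fun p hp => hm' (hΦb (h.inv_mem p hp))
  · intro p hp
    change Φ (f p, Ψ (s (s' (Φ (b, Ψ p))))) = p
    rw [hr (hΦb (h.inv_mem p hp)), h.left_inv b hb _ (h.inv_mem p hp), h.right_inv p hp]
  · exact fun y hy => hright _ (hm hy)

variable {B' F' : Type*} {pB : B' → B} {pF : F' → f ⁻¹' {b₀}}

/-- The parametrization of the fibres of `f` by the universal cover of the typical fibre. -/
def fibreMap (Φ : B × M → M) (pB : B' → B) (pF : F' → f ⁻¹' {b₀}) (z : B' × F') : M :=
  Φ (pB z.1, (pF z.2 : M))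

theorem IsFibreTrivialization.proj_fibreMap (h : IsFibreTrivialization m l f b₀ V Φ Ψ)
    {z : B' × F'} (hz : pB z.1 ∈ V) : f (fibreMap Φ pB pF z) = pB z.1 :=
  h.proj _ hz _ (pF z.2).2

theorem IsFibreTrivialization.inv_fibreMap (h : IsFibreTrivialization m l f b₀ V Φ Ψ)
    {z : B' × F'} (hz : pB z.1 ∈ V) : Ψ (fibreMap Φ pB pF z) = pF z.2 :=
  h.left_inv _ hz _ (pF z.2).2

variable [TopologicalSpace B'] [TopologicalSpace F'] {N : Set B'}

theorem IsFibreTrivialization.continuousOn_fibreMap (h : IsFibreTrivialization m l f b₀ V Φ Ψ)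
    (hpB : Continuous pB) (hpF : Continuous pF) (hNV : MapsTo pB N V) :
    ContinuousOn (fibreMap Φ pB pF) (N ×ˢ univ) := by
  refine h.contMDiffOn.continuousOn.comp (f := fun z : B' × F' => (pB z.1, (pF z.2 : M)))
    (by fun_prop) ?_
  rintro ⟨v, y⟩ ⟨hv, -⟩
  exact ⟨hNV hv, (pF y).2⟩

/-- Openness of the parametrization: `p ↦ (f p, Ψ p)` is a continuous inverse of `Φ`, and the
coverings `pB` and `pF` are open. -/
theorem IsFibreTrivialization.nhds_fibreMap_le (h : IsFibreTrivialization m l f b₀ V Φ Ψ)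
    (hf : Continuous f) (hpB : IsOpenMap pB) (hpF : IsOpenMap pF) {z : B' × F'}
    (hz : pB z.1 ∈ V) : 𝓝 (fibreMap Φ pB pF z) ≤ map (fibreMap Φ pB pF) (𝓝 z) := by
  intro W hW
  have hopen : Prod.map pB pF '' (fibreMap Φ pB pF ⁻¹' W) ∈ 𝓝 (pB z.1, pF z.2) :=
    (hpB.prodMap hpF).image_mem_nhds hW
  rw [nhds_prod_eq, mem_prod_iff] at hopen
  obtain ⟨W₁, hW₁, W₂, hW₂, hsub⟩ := hopen
  rw [nhds_subtype_eq_comap, mem_comap] at hW₂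
  obtain ⟨W₃, hW₃, hW₃₂⟩ := hW₂
  have hV : f ⁻¹' V ∈ 𝓝 (fibreMap Φ pB pF z) :=
    (h.isOpen.preimage hf).mem_nhds (by rw [mem_preimage, h.proj_fibreMap hz]; exact hz)
  have h1 : f ⁻¹' W₁ ∈ 𝓝 (fibreMap Φ pB pF z) := hf.continuousAt.preimage_mem_nhds
    (by rw [h.proj_fibreMap hz]; exact hW₁)
  have h2 : Ψ ⁻¹' W₃ ∈ 𝓝 (fibreMap Φ pB pF z) :=
    (h.contMDiffOn_inv.continuousOn.continuousAt hV).preimage_mem_nhds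
      (by rw [h.inv_fibreMap hz]; exact hW₃)
  filter_upwards [hV, h1, h2] with p hp hp1 hp2
  obtain ⟨⟨v, y⟩, hvy, he⟩ := hsub (show (f p, (⟨Ψ p, h.inv_mem p hp⟩ : f ⁻¹' {b₀})) ∈ W₁ ×ˢ W₂
    from ⟨hp1, hW₃₂ hp2⟩)
  have he1 : pB v = f p := congrArg Prod.fst he
  have he2 : pF y = ⟨Ψ p, h.inv_mem p hp⟩ := congrArg Prod.snd he
  have : fibreMap Φ pB pF (v, y) = p := by
    simp only [fibreMap, he1, he2]
    exact h.right_inv p hp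
  exact this ▸ hvy

end Bundle

/-! ### Developing maps of the total space over small open sets -/

section Families

variable {m l : ℕ} {M B : Type*} [TopologicalSpace M] [ChartedSpace (Euc (m + l)) M]
  [TopologicalSpace B] [ChartedSpace (Euc m) B] {B' F' : Type*} [TopologicalSpace B']
  [TopologicalSpace F']

/-- An affine map `f : M → B` together with developing maps of its base and of a fibre. -/
structure IsDevelopedBundle (m l : ℕ) {M B : Type*} [TopologicalSpace M]
    [ChartedSpace (Euc (m + l)) M] [TopologicalSpace B] [ChartedSpace (Euc m) B]
    {B' F' : Type*} [TopologicalSpace B'] [TopologicalSpace F'] (f : M → B) (b₀ : B) (pB : B' → B)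
    (DB : B' → Euc m) (hB : deckGroup pB →* (Euc m ≃ᵃ[ℝ] Euc m)) (pF : F' → f ⁻¹' {b₀})
    (DF : F' → Euc l) (hF : deckGroup pF →* (Euc l ≃ᵃ[ℝ] Euc l)) : Prop where
  affine : IsAffineAlong (n := m + l) (k := m) (id : M → M) (id : B → B) f
  coverB : IsUniversalCover pB
  devB : IsDevelopingPair (n := m) pB (id : B → B) DB hB
  coverF : IsUniversalCover pF
  devF : IsDevelopingPair (n := m + l) pF (Subtype.val : f ⁻¹' {b₀} → M) DF hF

variable {f : M → B} {b₀ : B} {pB : B' → B} {DB : B' → Euc m}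
  {hB : deckGroup pB →* (Euc m ≃ᵃ[ℝ] Euc m)} {pF : F' → f ⁻¹' {b₀}} {DF : F' → Euc l}
  {hF : deckGroup pF →* (Euc l ≃ᵃ[ℝ] Euc l)}
  {V V₁ V₂ : Set B} {Φ Φ₁ Φ₂ : B × M → M} {Ψ Ψ₁ Ψ₂ : M → M} {N N₁ N₂ : Set B'}
  {E E₁ E₂ : B' × F' → Euc l}

/-- The function `(DB, E)` is a developing map for the affine structure induced from `M` over `N`. -/
def IsAffineFamily (Φ : B × M → M) (pB : B' → B) (DB : B' → Euc m) (pF : F' → f ⁻¹' {b₀})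
    (N : Set B') (E : B' × F' → Euc l) : Prop :=
  ∀ z : B' × F', z.1 ∈ N → ∃ T : (Euc m × Euc l) ≃ᵃ[ℝ] Euc (m + l), ∀ᶠ z' in 𝓝 z,
    chartAt (Euc (m + l)) (fibreMap Φ pB pF z) (fibreMap Φ pB pF z') = T (DB z'.1, E z')

theorem nhds_comp_le {X Y Z : Type*} [TopologicalSpace X] [TopologicalSpace Y] [TopologicalSpace Z]
    {g : Y → Z} {h : X → Y} {x : X} (hg : 𝓝 (g (h x)) ≤ map g (𝓝 (h x)))
    (hh : 𝓝 (h x) ≤ map h (𝓝 x)) : 𝓝 (g (h x)) ≤ map (fun x => g (h x)) (𝓝 x) :=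
  hg.trans (map_mono (m := g) hh)

theorem AffineEquiv.nhds_le {E E' : Type*} [NormedAddCommGroup E] [NormedSpace ℝ E]
    [NormedAddCommGroup E'] [NormedSpace ℝ E'] [FiniteDimensional ℝ E'] (T : E ≃ᵃ[ℝ] E') (x : E) :
    𝓝 (T x) ≤ map T (𝓝 x) := by
  intro W hW
  have h1 : ContinuousAt T.symm (T x) :=
    (T.symm : E' →ᵃ[ℝ] E).continuous_of_finiteDimensional.continuousAt
  filter_upwards [h1.preimage_mem_nhds (t := T ⁻¹' W) (by simpa using hW)] with y hy
  rwa [mem_preimage, mem_preimage, T.apply_symm_apply] at hy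

namespace IsDevelopedBundle

theorem nhds_chart_fibreMap_le (S : IsDevelopedBundle m l f b₀ pB DB hB pF DF hF)
    (h : IsFibreTrivialization m l f b₀ V Φ Ψ) {z : B' × F'} (hz : pB z.1 ∈ V) :
    𝓝 (chartAt (Euc (m + l)) (fibreMap Φ pB pF z) (fibreMap Φ pB pF z)) ≤
      map (fun z' => chartAt (Euc (m + l)) (fibreMap Φ pB pF z) (fibreMap Φ pB pF z')) (𝓝 z) :=
  nhds_comp_le ((chartAt _ _).map_nhds_eq (mem_chart_source _ _)).ge
    (h.nhds_fibreMap_le S.affine.1 S.coverB.isCoveringMap.isOpenMap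
      S.coverF.isCoveringMap.isOpenMap hz)

theorem continuousAt_fibreMap (S : IsDevelopedBundle m l f b₀ pB DB hB pF DF hF)
    (h : IsFibreTrivialization m l f b₀ V Φ Ψ) {z : B' × F'} (hz : pB z.1 ∈ V) :
    ContinuousAt (fibreMap Φ pB pF) z := by
  have hopen : IsOpen (pB ⁻¹' V) := h.isOpen.preimage S.coverB.isCoveringMap.continuous
  exact (h.continuousOn_fibreMap S.coverB.isCoveringMap.continuous
    S.coverF.isCoveringMap.continuous (mapsTo_preimage pB V)).continuousAt
      ((hopen.prod isOpen_univ).mem_nhds ⟨hz, mem_univ _⟩)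

theorem nhds_DB_le (S : IsDevelopedBundle m l f b₀ pB DB hB pF DF hF) (v : B') :
    𝓝 (DB v) ≤ map DB (𝓝 v) :=
  (S.devB.isLocalHomeomorph.map_nhds_eq v).ge

/-- The base coordinate is locally an affine function of an affine chart of the total space. -/
theorem exists_affine_DB (S : IsDevelopedBundle m l f b₀ pB DB hB pF DF hF)
    (h : IsFibreTrivialization m l f b₀ V Φ Ψ) {z : B' × F'} (hz : pB z.1 ∈ V) :
    ∃ A : Euc (m + l) →ᵃ[ℝ] Euc m, ∀ᶠ z' in 𝓝 z,
      DB z'.1 = A (chartAt (Euc (m + l)) (fibreMap Φ pB pF z) (fibreMap Φ pB pF z')) := by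
  obtain ⟨A₁, hA₁⟩ := S.devB.isAffine.2 z.1
  obtain ⟨A₂, hA₂⟩ := S.affine.2 (fibreMap Φ pB pF z)
  have hV : ∀ᶠ z' : B' × F' in 𝓝 z, pB z'.1 ∈ V :=
    (S.coverB.isCoveringMap.continuous.comp continuous_fst).continuousAt.preimage_mem_nhds
      (h.isOpen.mem_nhds hz)
  refine ⟨A₁.comp A₂, ?_⟩
  filter_upwards [(S.continuousAt_fibreMap h hz).eventually hA₂,
    (continuous_fst.continuousAt (x := z)).eventually hA₁, hV] with z' h1 h2 h3
  simp only [id, h.proj_fibreMap hz, h.proj_fibreMap h3] at h1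
  simp only [id, Function.comp_apply, chartAt_self_eq, OpenPartialHomeomorph.refl_apply] at h2
  rw [h2, h1]
  rfl

theorem locallyPathConnectedSpace_prod (S : IsDevelopedBundle m l f b₀ pB DB hB pF DF hF)
    (hN : IsOpen N) : LocallyPathConnectedSpace (N × F') := by
  have := S.devB.isLocalHomeomorph.locallyPathConnectedSpace
  have := S.devF.isLocalHomeomorph.locallyPathConnectedSpace
  have := hN.locallyPathConnectedSpace
  infer_instance

/-- `N × F'` is simply connected, so the structure induced from `M` has a developing map `D` there.
As `f` is affine, `DB` is a surjective affine function `α` of `D`; completing `α` to an affine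
isomorphism brings `D` to the form `(DB, E)`. -/
theorem exists_affineFamily [HasGroupoid M (affineGroupoid (m + l))]
    (S : IsDevelopedBundle m l f b₀ pB DB hB pF DF hF)
    (h : IsFibreTrivialization m l f b₀ V Φ Ψ) (hN : IsOpen N) [ContractibleSpace N]
    (hNV : MapsTo pB N V) : ∃ E : B' × F' → Euc l, IsAffineFamily Φ pB DB pF N E := by
  classical
  have := S.coverF.simplyConnected
  have := S.locallyPathConnectedSpace_prod hN
  let ι : N × F' → B' × F' := Prod.map Subtype.val id
  have hι : IsOpenEmbedding ι := hN.isOpenEmbedding_subtypeVal.prodMap .id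
  let j : N × F' → M := fun x => fibreMap Φ pB pF (ι x)
  have hj : Continuous j := continuous_iff_continuousAt.2 fun x =>
    (S.continuousAt_fibreMap h (hNV x.1.2)).comp hι.continuous.continuousAt
  have hjo : IsOpenMap j := IsOpenMap.of_nhds_le fun x =>
    nhds_comp_le (h.nhds_fibreMap_le S.affine.1 S.coverB.isCoveringMap.isOpenMap
      S.coverF.isCoveringMap.isOpenMap (hNV x.1.2)) (hι.map_nhds_eq x).ge
  obtain ⟨D, hD⟩ := exists_developingMap (n := m + l) hj hjo
  have hDo : IsOpenMap D := IsOpenMap.of_nhds_le fun x => by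
    obtain ⟨T, hT⟩ := hD x
    have h1 : 𝓝 (T (chartAt (Euc (m + l)) (j x) (j x))) ≤
        map (fun x' => T (chartAt (Euc (m + l)) (j x) (j x'))) (𝓝 x) :=
      nhds_comp_le (T.nhds_le _) (nhds_comp_le
        ((chartAt _ _).map_nhds_eq (mem_chart_source _ _)).ge (hjo.nhds_le x))
    rwa [← map_congr hT, ← hT.self_of_nhds] at h1
  have hDB : IsLocallyAffineIn D fun x : N × F' => DB x.1 := fun x => by
    obtain ⟨T, hT⟩ := hD x
    obtain ⟨A, hA⟩ := S.exists_affine_DB (z := ι x) h (hNV x.1.2)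
    refine ⟨A.comp (T.symm : _ →ᵃ[ℝ] _), ?_⟩
    filter_upwards [hT, hι.continuous.continuousAt.eventually hA] with x' h1 h2
    rw [h1]
    change DB (ι x').1 = _
    rw [h2]
    simp [j]
  obtain ⟨α, hα⟩ := hDB.exists_eq hDo
  obtain ⟨x₀⟩ : Nonempty (N × F') := inferInstance
  have hαs : Function.Surjective α := AffineMap.surjective_of_isOpenMap (x := x₀) (D := D)
    (D' := fun x : N × F' => DB x.1)
    (nhds_comp_le (S.nhds_DB_le _)
      ((hN.isOpenEmbedding_subtypeVal.isOpenMap.comp isOpenMap_fst).nhds_le x₀))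
    (Eventually.of_forall hα)
  obtain ⟨T₀, hT₀⟩ := α.exists_splitting hαs
  refine ⟨fun z => if hz : z.1 ∈ N then (T₀ (D (⟨z.1, hz⟩, z.2))).2 else 0, ?_⟩
  rintro ⟨v, y⟩ hv
  let x : N × F' := (⟨v, hv⟩, y)
  obtain ⟨T, hT⟩ := hD x
  refine ⟨(T.trans T₀).symm, ?_⟩
  have h1 : ∀ᶠ z' in map ι (𝓝 x), z'.1 ∈ N ∧ ∀ hz : z'.1 ∈ N, D (⟨z'.1, hz⟩, z'.2) =
      T (chartAt (Euc (m + l)) (fibreMap Φ pB pF (v, y)) (fibreMap Φ pB pF z')) := by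
    rw [eventually_map]
    filter_upwards [hT] with x' hx'
    exact ⟨x'.1.2, fun _ => hx'⟩
  rw [hι.map_nhds_eq] at h1
  filter_upwards [h1] with z' ⟨hz, h2⟩
  have h3 : (DB z'.1, (T₀ (D (⟨z'.1, hz⟩, z'.2))).2) = T₀ (D (⟨z'.1, hz⟩, z'.2)) := by
    ext1
    · rw [hT₀, ← hα]
    · rfl
  simp only [dif_pos hz]
  rw [h3, h2 hz]
  exact ((congrArg T.symm (T₀.symm_apply_apply _)).trans (T.symm_apply_apply _)).symm

end IsDevelopedBundle

namespace IsAffineFamily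

theorem mono (hE : IsAffineFamily Φ pB DB pF N E) (h : N₁ ⊆ N) : IsAffineFamily Φ pB DB pF N₁ E :=
  fun z hz => hE z (h hz)

theorem eventually_eq (hE : IsAffineFamily Φ pB DB pF N E) {z : B' × F'} (hz : z.1 ∈ N) :
    ∃ T : Euc (m + l) ≃ᵃ[ℝ] (Euc m × Euc l), ∀ᶠ z' in 𝓝 z, (DB z'.1, E z') =
      T (chartAt (Euc (m + l)) (fibreMap Φ pB pF z) (fibreMap Φ pB pF z')) := by
  obtain ⟨T, hT⟩ := hE z hz
  refine ⟨T.symm, ?_⟩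
  filter_upwards [hT] with z' hz'
  rw [hz', T.symm_apply_apply]

theorem nhds_le (hE : IsAffineFamily Φ pB DB pF N E)
    (S : IsDevelopedBundle m l f b₀ pB DB hB pF DF hF)
    (h : IsFibreTrivialization m l f b₀ V Φ Ψ) (hNV : MapsTo pB N V) {z : B' × F'} (hz : z.1 ∈ N) :
    𝓝 (DB z.1, E z) ≤ map (fun z' => (DB z'.1, E z')) (𝓝 z) := by
  obtain ⟨T, hT⟩ := hE.eventually_eq hz
  have h1 := nhds_comp_le (T.nhds_le _) (S.nhds_chart_fibreMap_le h (hNV hz))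
  rwa [← map_congr hT, ← hT.self_of_nhds] at h1

theorem continuousAt (hE : IsAffineFamily Φ pB DB pF N E)
    (S : IsDevelopedBundle m l f b₀ pB DB hB pF DF hF)
    (h : IsFibreTrivialization m l f b₀ V Φ Ψ) (hNV : MapsTo pB N V) {z : B' × F'} (hz : z.1 ∈ N) : ContinuousAt E z := by
  obtain ⟨T, hT⟩ := hE.eventually_eq hz
  have h1 : ContinuousAt (fun z' => T (chartAt (Euc (m + l)) (fibreMap Φ pB pF z)
      (fibreMap Φ pB pF z'))) z :=
    ContinuousAt.comp (g := T)
      (T : Euc (m + l) →ᵃ[ℝ] Euc m × Euc l).continuous_of_finiteDimensional.continuousAt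
      (((chartAt _ _).continuousAt (mem_chart_source _ _)).comp
        (S.continuousAt_fibreMap h (hNV hz)))
  exact continuous_snd.continuousAt.comp (h1.congr (hT.mono fun _ => Eq.symm))

/-- Openness of `(DB, E)` restricts to a single fibre: where `DB` is injective, values with first
coordinate `DB v` can only come from the fibre over `v`. -/
theorem nhds_slice_le (hE : IsAffineFamily Φ pB DB pF N E)
    (S : IsDevelopedBundle m l f b₀ pB DB hB pF DF hF)
    (h : IsFibreTrivialization m l f b₀ V Φ Ψ) (hNV : MapsTo pB N V) {v : B'} (hv : v ∈ N) (y : F') :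
    𝓝 (E (v, y)) ≤ map (fun y' => E (v, y')) (𝓝 y) := by
  intro W hW
  obtain ⟨U, hU, hvU, hinj⟩ := S.devB.isLocalHomeomorph.isLocallyInjective v
  have h1 : (fun z' : B' × F' => (DB z'.1, E z')) ''
      (U ×ˢ ((fun y' => E (v, y')) ⁻¹' W)) ∈ 𝓝 (DB v, E (v, y)) :=
    hE.nhds_le S h hNV (z := (v, y)) hv
      (mem_map.2 (mem_of_superset (prod_mem_nhds (hU.mem_nhds hvU) hW)
        fun z' hz' => ⟨z', hz', rfl⟩))
  have h2 : Continuous fun e : Euc l => (DB v, e) := by fun_prop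
  filter_upwards [h2.continuousAt.preimage_mem_nhds h1] with e ⟨⟨v', y'⟩, ⟨hv', hy'⟩, he⟩
  obtain ⟨he1, rfl⟩ := Prod.mk.inj he
  obtain rfl : v' = v := hinj hv' hvU he1
  exact hy'

end IsAffineFamily

end Families

/-! ### Equivariant families and their cocycles -/

section Data

variable {m l : ℕ} {M B : Type*} [TopologicalSpace M] [ChartedSpace (Euc (m + l)) M]
  [TopologicalSpace B] [ChartedSpace (Euc m) B] {B' F' : Type*} [TopologicalSpace B']
  [TopologicalSpace F'] {f : M → B} {b₀ : B} {pB : B' → B} {DB : B' → Euc m}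
  {hB : deckGroup pB →* (Euc m ≃ᵃ[ℝ] Euc m)} {pF : F' → f ⁻¹' {b₀}} {DF : F' → Euc l}
  {hF : deckGroup pF →* (Euc l ≃ᵃ[ℝ] Euc l)}
  {V V₁ V₂ : Set B} {Φ Φ₁ Φ₂ : B × M → M} {Ψ Ψ₁ Ψ₂ : M → M} {N N₁ N₂ : Set B'}
  {E E₁ E₂ : B' × F' → Euc l}

/-- Affine families over the same part of the base are affine functions of each other. -/
theorem IsAffineFamily.exists_comparison (S : IsDevelopedBundle m l f b₀ pB DB hB pF DF hF)
    (h₁ : IsFibreTrivialization m l f b₀ V₁ Φ₁ Ψ₁) (hE₁ : IsAffineFamily Φ₁ pB DB pF N E₁)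
    (hN : IsOpen N) [ContractibleSpace N] (hNV₁ : MapsTo pB N V₁)
    (hE₂ : IsAffineFamily Φ₂ pB DB pF N E₂) {θ : N × F' → F'} (hθ : Continuous θ)
    (hθΦ : ∀ x : N × F', fibreMap Φ₂ pB pF (x.1, θ x) = fibreMap Φ₁ pB pF (x.1, x.2)) :
    ∃ T : (Euc m × Euc l) →ᵃ[ℝ] Euc l, ∀ x : N × F', E₂ (x.1, θ x) = T (DB x.1, E₁ (x.1, x.2)) := by
  have := S.coverF.simplyConnected
  let ι : N × F' → B' × F' := Prod.map Subtype.val id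
  have hι : IsOpenEmbedding ι := hN.isOpenEmbedding_subtypeVal.prodMap .id
  have hDo : IsOpenMap fun x : N × F' => (DB x.1, E₁ (x.1, x.2)) := IsOpenMap.of_nhds_le fun x =>
    nhds_comp_le (hE₁.nhds_le S h₁ hNV₁ (z := ι x) x.1.2) (hι.map_nhds_eq x).ge
  refine IsLocallyAffineIn.exists_eq (D := fun x : N × F' => (DB x.1, E₁ (x.1, x.2)))
    (D' := fun x : N × F' => E₂ (x.1, θ x)) (fun x => ?_) hDo
  obtain ⟨T₁, hT₁⟩ := hE₁ (ι x) x.1.2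
  obtain ⟨T₂, hT₂⟩ := hE₂.eventually_eq (z := ((x.1 : B'), θ x)) x.1.2
  have hc : Continuous fun x : N × F' => ((x.1 : B'), θ x) := by fun_prop
  refine ⟨((LinearMap.snd ℝ (Euc m) (Euc l)).toAffineMap.comp
    (T₂ : Euc (m + l) →ᵃ[ℝ] Euc m × Euc l)).comp (T₁ : Euc m × Euc l →ᵃ[ℝ] Euc (m + l)), ?_⟩
  filter_upwards [hι.continuous.continuousAt.eventually hT₁, hc.continuousAt.eventually hT₂]
    with x' h1 h2
  have h3 := congrArg Prod.snd h2
  simp only [hθΦ] at h3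
  rw [h3]
  exact congrArg (fun w => (T₂ w).2) h1

theorem AffineMap.bijective_of_isOpenMap {X : Type*} [TopologicalSpace X] {D D' : X → Euc l} {x : X}
    (hD' : 𝓝 (D' x) ≤ map D' (𝓝 x)) {T : Euc l →ᵃ[ℝ] Euc l}
    (h : ∀ᶠ x' in 𝓝 x, D' x' = T (D x')) : Function.Bijective T := by
  have hs := AffineMap.surjective_of_isOpenMap hD' h
  rw [← T.linear_bijective_iff]
  have hs' := T.linear_surjective_iff.2 hs
  exact ⟨LinearMap.injective_iff_surjective.2 hs', hs'⟩

/-- A trivialization together with an affine family over `N` which is equivariant under an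
affine action with linear part `L`, whose translation part depends on the base through `κ`. -/
structure IsDatum (f : M → B) (pB : B' → B) (DB : B' → Euc m) (pF : F' → f ⁻¹' {b₀})
    (L : deckGroup pF →* (Euc l ≃ₗ[ℝ] Euc l)) (V : Set B) (Φ : B × M → M) (Ψ : M → M) (N : Set B')
    (E : B' × F' → Euc l) (κ : Euc m →ᵃ[ℝ] cocycles L) : Prop where
  triv : IsFibreTrivialization m l f b₀ V Φ Ψ
  isOpen : IsOpen N
  mapsTo : MapsTo pB N V
  family : IsAffineFamily Φ pB DB pF N E
  equivariant : ∀ v ∈ N, ∀ (γ : deckGroup pF) (y : F'),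
    E (v, γ.1 y) = L γ (E (v, y)) + (κ (DB v)).1 γ

variable {L : deckGroup pF →* (Euc l ≃ₗ[ℝ] Euc l)} {κ κ₁ κ₂ : Euc m →ᵃ[ℝ] cocycles L}

theorem AffineMap.apply_prod_eq {T : (Euc m × Euc l) →ᵃ[ℝ] Euc l} (x : Euc m) (e : Euc l) :
    T (x, e) = T.linear (0, e) + T (x, 0) := by
  have := T.map_vadd (x, 0) (0, e)
  simpa using this

/-- A developing map of a fibre, equivariant with linear part `L`, extends to a datum over any
contractible open set over which `f` is trivialized. -/
theorem IsDevelopedBundle.exists_datum [HasGroupoid M (affineGroupoid (m + l))]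
    (S : IsDevelopedBundle m l f b₀ pB DB hB pF DF hF)
    (h : IsFibreTrivialization m l f b₀ V Φ Ψ) (hN : IsOpen N) [ContractibleSpace N]
    (hNV : MapsTo pB N V) {v₀ : B'} (hv₀ : v₀ ∈ N) {D : F' → Euc l} (hD : IsOpenMap D)
    (hDa : ∀ y, ∃ A : Euc (m + l) →ᵃ[ℝ] Euc l, ∀ᶠ y' in 𝓝 y, D y' =
      A (chartAt (Euc (m + l)) (fibreMap Φ pB pF (v₀, y)) (fibreMap Φ pB pF (v₀, y'))))
    (hDL : ∀ γ : deckGroup pF, ∃ c, ∀ y, D (γ.1 y) = L γ (D y) + c) :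
    ∃ E κ, IsDatum f pB DB pF L V Φ Ψ N E κ ∧ ∀ y, E (v₀, y) = D y := by
  have := S.coverF.simplyConnected
  obtain ⟨E₀, hE₀⟩ := S.exists_affineFamily h hN hNV
  have hloc : ∀ y, ∃ T : Euc l ≃ᵃ[ℝ] Euc l, ∀ᶠ y' in 𝓝 y, E₀ (v₀, y') = T (D y') := by
    intro y
    obtain ⟨A, hA⟩ := hDa y
    obtain ⟨T, hT⟩ := hE₀ (v₀, y) hv₀
    have hc : Continuous fun y' : F' => (v₀, y') := by fun_prop
    let T₁ : Euc l →ᵃ[ℝ] Euc l := (A.comp (T : Euc m × Euc l →ᵃ[ℝ] Euc (m + l))).comp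
      ((AffineMap.const ℝ (Euc l) (DB v₀)).prod (AffineMap.id ℝ (Euc l)))
    have h1 : ∀ᶠ y' in 𝓝 y, D y' = T₁ (E₀ (v₀, y')) := by
      filter_upwards [hA, hc.continuousAt.eventually hT] with y' h2 h3
      rw [h2, h3]; rfl
    have hb := AffineMap.bijective_of_isOpenMap (hD.nhds_le y) h1
    refine ⟨(AffineEquiv.ofBijective hb).symm, ?_⟩
    filter_upwards [h1] with y' h2
    rw [h2]
    exact ((AffineEquiv.ofBijective hb).symm_apply_apply _).symm
  obtain ⟨y₀⟩ : Nonempty F' := inferInstance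
  obtain ⟨T₂, hT₂⟩ := IsLocallyAffineIn.exists_eq (D := D) (D' := fun y => E₀ (v₀, y))
    (fun y => let ⟨T, hT⟩ := hloc y; ⟨(T : Euc l →ᵃ[ℝ] Euc l), hT⟩) hD
  obtain ⟨T₃, hT₃⟩ : ∃ T : Euc l ≃ᵃ[ℝ] Euc l, ∀ y, E₀ (v₀, y) = T (D y) := by
    obtain ⟨T, hT⟩ := hloc y₀
    have : T₂ = T := AffineMap.eq_of_eventuallyEq_comp (hD.nhds_le y₀) <| by
      filter_upwards [hT] with y' h1
      rw [← hT₂, h1]; rfl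
    exact ⟨T, fun y => by rw [hT₂, this]; rfl⟩
  -- Over `v₀` an arbitrary family differs from `D` by one affine isomorphism; removing it
  -- everywhere normalizes the family to equal `D` there.
  let E : B' × F' → Euc l := fun z => T₃.symm (E₀ z)
  have hE : IsAffineFamily Φ pB DB pF N E := fun z hz => by
    obtain ⟨T, hT⟩ := hE₀ z hz
    refine ⟨((AffineEquiv.refl ℝ (Euc m)).prodCongr T₃).trans T, ?_⟩
    filter_upwards [hT] with z' h1
    rw [h1]
    simp [E]
  have hED : ∀ y, E (v₀, y) = D y := fun y => by simp [E, hT₃]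
  -- Acting by `γ` on `F'` does not change the parametrized point of `M`, so `E` may be compared
  -- with its own translate. The linear part of `T γ` along the fibre is the same over all base
  -- points, hence is `L γ` as over `v₀`; only `T γ (x, 0)` varies, and affinely.
  have hM : ∀ γ : deckGroup pF, ∃ T : (Euc m × Euc l) →ᵃ[ℝ] Euc l, ∀ x : N × F',
      E (x.1, γ.1 x.2) = T (DB x.1, E (x.1, x.2)) := fun γ =>
    IsAffineFamily.exists_comparison S h hE hN hNV hE (θ := fun x => γ.1 x.2)
      (γ.1.continuous.comp continuous_snd) fun x => by simp only [fibreMap, γ.2 x.2]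
  choose T hT using hM
  have hTL : ∀ γ x e, T γ (x, e) = L γ e + T γ (x, 0) := by
    intro γ x e
    obtain ⟨c, hc⟩ := hDL γ
    have h1 : (T γ).comp ((AffineMap.const ℝ (Euc l) (DB v₀)).prod (AffineMap.id ℝ (Euc l))) =
        (L γ : Euc l →ₗ[ℝ] Euc l).toAffineMap + AffineMap.const ℝ (Euc l) c := by
      refine AffineMap.eq_of_eventuallyEq_comp (hD.nhds_le y₀) (Eventually.of_forall fun y => ?_)
      have := hT γ (⟨v₀, hv₀⟩, y)
      simp only [hED, hc] at this
      exact this.symm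
    have h2 := congrArg (fun A => A.linear e) h1
    have h3 : (T γ).linear (0, e) = L γ e := by simpa using h2
    rw [AffineMap.apply_prod_eq, h3]
  -- The cocycle identity holds on the image of `N`, a neighbourhood of `DB v₀`, and both sides are
  -- affine in `x`; so it holds on all of `ℝᵐ`.
  have hcoc : ∀ γ δ x, T (γ * δ) (x, 0) = T γ (x, 0) + L γ (T δ (x, 0)) := by
    intro γ δ x
    let i : Euc m →ᵃ[ℝ] Euc m × Euc l := (AffineMap.id ℝ (Euc m)).prod (AffineMap.const ℝ _ 0)
    have h1 : (T (γ * δ)).comp i = (T γ).comp i +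
        (L γ : Euc l →ₗ[ℝ] Euc l).toAffineMap.comp ((T δ).comp i) := by
      refine AffineMap.eq_of_eventuallyEq_comp (S.nhds_DB_le v₀) ?_
      filter_upwards [hN.mem_nhds hv₀] with v hv
      have e1 := hT (γ * δ) (⟨v, hv⟩, y₀)
      have e2 := hT γ (⟨v, hv⟩, δ.1 y₀)
      have e3 := hT δ (⟨v, hv⟩, y₀)
      simp only at e1 e2 e3
      rw [e3] at e2
      have e4 : (γ * δ).1 y₀ = γ.1 (δ.1 y₀) := rfl
      rw [e4, e2, hTL, hTL, hTL (γ * δ), map_add, map_mul, LinearEquiv.mul_apply] at e1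
      change T (γ * δ) (DB v, 0) = T γ (DB v, 0) + L γ (T δ (DB v, 0))
      rw [add_assoc] at e1
      rw [← add_left_cancel e1, add_comm]
    exact DFunLike.congr_fun h1 x
  have hlin : ∀ γ x, (T γ).linear (x, 0) = T γ (x, 0) - T γ (0, 0) := fun γ x => by
    have := (T γ).map_vadd (0, 0) (x, 0)
    simp only [vadd_eq_add, Prod.mk_add_mk, add_zero] at this
    rw [this]; abel
  let κ : Euc m →ᵃ[ℝ] cocycles L :=
    { toFun := fun x => ⟨fun γ => T γ (x, 0), fun γ δ => hcoc γ δ x⟩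
      linear :=
        { toFun := fun x => ⟨fun γ => (T γ).linear (x, 0), fun γ δ => by
            simp only [hlin, hcoc, map_sub]; abel⟩
          map_add' := fun x x' => by
            ext1; funext γ
            change (T γ).linear (x + x', 0) = (T γ).linear (x, 0) + (T γ).linear (x', 0)
            rw [← map_add]; simp
          map_smul' := fun a x => by
            ext1; funext γ
            change (T γ).linear (a • x, 0) = a • (T γ).linear (x, 0)
            rw [← map_smul]; simp }
      map_vadd' := fun x v => by
        ext1; funext γ
        change T γ (v + x, 0) = (T γ).linear (v, 0) + T γ (x, 0)
        have := (T γ).map_vadd (x, 0) (v, 0)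
        simpa using this }
  refine ⟨E, κ, ⟨h, hN, hNV, hE, fun v hv γ y => ?_⟩, hED⟩
  rw [hT γ (⟨v, hv⟩, y), hTL]
  rfl

namespace IsDatum

theorem mono (h : IsDatum f pB DB pF L V Φ Ψ N E κ) (hN₁ : IsOpen N₁) (hsub : N₁ ⊆ N) :
    IsDatum f pB DB pF L V Φ Ψ N₁ E κ :=
  ⟨h.triv, hN₁, h.mapsTo.mono_left hsub, h.family.mono hsub, fun v hv => h.equivariant v (hsub hv)⟩

/-- The data obtained by moving the base point by a deck transformation of the base. -/
theorem translate (h : IsDatum f pB DB pF L V Φ Ψ N E κ)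
    (S : IsDevelopedBundle m l f b₀ pB DB hB pF DF hF) (γ : deckGroup pB) :
    IsDatum f pB DB pF L V Φ Ψ (γ.1 '' N) (fun z => E (γ.1.symm z.1, z.2))
      (κ.comp ((hB γ).symm : Euc m →ᵃ[ℝ] Euc m)) := by
  have hDB : ∀ v, DB (γ.1.symm v) = (hB γ).symm (DB v) := fun v => by
    rw [AffineEquiv.eq_symm_apply, ← S.devB.equivariant, γ.1.apply_symm_apply]
  have hpB : ∀ v, pB (γ.1.symm v) = pB v := fun v => by
    rw [← γ.2, γ.1.apply_symm_apply]
  have hfib : ∀ z : B' × F', fibreMap Φ pB pF (γ.1.symm z.1, z.2) = fibreMap Φ pB pF z := fun z => by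
    simp only [fibreMap, hpB]
  refine ⟨h.triv, γ.1.isOpenMap _ h.isOpen, ?_, ?_, ?_⟩
  · rintro _ ⟨v, hv, rfl⟩
    rw [γ.2]
    exact h.mapsTo hv
  · rintro z ⟨v, hv, hvz⟩
    have hz : γ.1.symm z.1 = v := by rw [← hvz, γ.1.symm_apply_apply]
    obtain ⟨T, hT⟩ := h.family (γ.1.symm z.1, z.2) (by rwa [hz])
    refine ⟨((hB γ).symm.prodCongr (AffineEquiv.refl ℝ (Euc l))).trans T, ?_⟩
    have hc : Continuous fun z : B' × F' => (γ.1.symm z.1, z.2) := by fun_prop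
    filter_upwards [hc.continuousAt.eventually hT] with z' h1
    rw [hfib, hfib, hDB] at h1
    rw [h1]; rfl
  · rintro _ ⟨v, hv, rfl⟩ δ y
    have := h.equivariant v hv δ y
    simp only [γ.1.symm_apply_apply, this, AffineMap.comp_apply, AffineEquiv.coe_coe, ← hDB]

end IsDatum

end Data

/-! ### Comparison and continuation of the families of classes -/

section Holonomy

variable {m l : ℕ} {M B : Type*} [TopologicalSpace M] [ChartedSpace (Euc (m + l)) M]
  [TopologicalSpace B] [ChartedSpace (Euc m) B] {B' F' : Type*} [TopologicalSpace B']
  [TopologicalSpace F'] {f : M → B} {b₀ : B} {pB : B' → B} {DB : B' → Euc m}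
  {hB : deckGroup pB →* (Euc m ≃ᵃ[ℝ] Euc m)} {pF : F' → f ⁻¹' {b₀}} {DF : F' → Euc l}
  {hF : deckGroup pF →* (Euc l ≃ᵃ[ℝ] Euc l)}
  {V V₁ V₂ : Set B} {Φ Φ₁ Φ₂ : B × M → M} {Ψ Ψ₁ Ψ₂ : M → M} {N N₁ N₂ : Set B'}
  {E E₁ E₂ : B' × F' → Euc l}
  {L : deckGroup pF →* (Euc l ≃ₗ[ℝ] Euc l)} {κ κ₁ κ₂ : Euc m →ᵃ[ℝ] cocycles L}

/-- Conjugation by a homeomorphism normalizing the deck group. -/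
def deckConj {X' X : Type*} [TopologicalSpace X'] {p : X' → X} (θ : X' ≃ₜ X')
    (h : ∀ x y, p (θ x) = p (θ y) ↔ p x = p y) : MulAut (deckGroup p) where
  toFun γ := ⟨(θ.symm.trans γ.1).trans θ, fun x => by
    rw [← θ.apply_symm_apply x]
    refine (h _ _).2 ?_
    rw [← γ.2 (θ.symm x)]; simp⟩
  invFun γ := ⟨(θ.trans γ.1).trans θ.symm, fun x => by
    refine (h _ _).1 ?_
    rw [← γ.2 (θ x)]; simp⟩
  left_inv γ := by ext x; simp
  right_inv γ := by ext x; simp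
  map_mul' γ δ := by
    ext x
    change θ (γ.1 (δ.1 (θ.symm x))) = θ (γ.1 (θ.symm (θ (δ.1 (θ.symm x)))))
    rw [θ.symm_apply_apply]

theorem deckConj_apply {X' X : Type*} [TopologicalSpace X'] {p : X' → X} {θ : X' ≃ₜ X'}
    {h : ∀ x y, p (θ x) = p (θ y) ↔ p x = p y} (γ : deckGroup p) (x : X') :
    (deckConj θ h γ).1 (θ x) = θ (γ.1 x) := by
  change θ (γ.1 (θ.symm (θ x))) = _
  rw [θ.symm_apply_apply]

namespace IsDatum

/-- Two data near the same point, together with an identification of the fibres over this point,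
differ by a gauge transformation. -/
theorem exists_gauge (h₁ : IsDatum f pB DB pF L V₁ Φ₁ Ψ₁ N₁ E₁ κ₁)
    (h₂ : IsDatum f pB DB pF L V₂ Φ₂ Ψ₂ N₂ E₂ κ₂)
    (S : IsDevelopedBundle m l f b₀ pB DB hB pF DF hF) {v₀ : B'} (hv₁ : v₀ ∈ N₁) (hv₂ : v₀ ∈ N₂)
    (θ₀ : F' ≃ₜ F') (hθ₀ : ∀ y, fibreMap Φ₂ pB pF (v₀, θ₀ y) = fibreMap Φ₁ pB pF (v₀, y)) :
    ∃ (p : gaugeGroup L) (w : Euc l),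
      (∀ x, (Submodule.Quotient.mk (κ₂ x) : H1 L) =
        gaugeH1 L p (Submodule.Quotient.mk (κ₁ x))) ∧
      (∀ y, E₂ (v₀, θ₀ y) = p.1.2 (E₁ (v₀, y)) + w) ∧
      ∀ (γ : deckGroup pF) (y : F'), θ₀ (γ.1 y) = (p.1.1 γ).1 (θ₀ y) := by
  have := S.coverF.simplyConnected
  obtain ⟨N, hN, hvN, hNsub, hNc, -⟩ := S.devB.isLocalHomeomorph.exists_contractible_nhd
    (inter_mem (h₁.isOpen.mem_nhds hv₁) (h₂.isOpen.mem_nhds hv₂))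
  replace h₁ := h₁.mono hN (hNsub.trans inter_subset_left)
  replace h₂ := h₂.mono hN (hNsub.trans inter_subset_right)
  have := S.locallyPathConnectedSpace_prod hN
  obtain ⟨y₀⟩ : Nonempty F' := inferInstance
  let a : N := ⟨v₀, hvN⟩
  have hΦf : ∀ x : N × F', f (fibreMap Φ₁ pB pF (x.1, x.2)) = pB x.1 := fun x =>
    h₁.triv.proj_fibreMap (z := ((x.1 : B'), x.2)) (h₁.mapsTo x.1.2)
  have hΦV : ∀ x : N × F', fibreMap Φ₁ pB pF (x.1, x.2) ∈ f ⁻¹' V₂ := fun x => by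
    rw [mem_preimage, hΦf]; exact h₂.mapsTo x.1.2
  -- The change between the two trivializations, with values in the typical fibre. Its lift through
  -- `pF` extends `θ₀` from the fibre over `v₀` to the fibres over `N`.
  let c : N × F' → f ⁻¹' {b₀} := fun x =>
    ⟨Ψ₂ (fibreMap Φ₁ pB pF (x.1, x.2)), h₂.triv.inv_mem _ (hΦV x)⟩
  have hc : Continuous c := Continuous.subtype_mk
    (h₂.triv.contMDiffOn_inv.continuousOn.comp_continuous
      ((h₁.triv.continuousOn_fibreMap S.coverB.isCoveringMap.continuous
        S.coverF.isCoveringMap.continuous h₁.mapsTo).comp_continuous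
          (f := fun x : N × F' => ((x.1 : B'), x.2)) (by fun_prop) fun x => ⟨x.1.2, mem_univ _⟩)
      hΦV) _
  have hc₀ : ∀ y, pF (θ₀ y) = c (a, y) := fun y => by
    refine Subtype.ext ?_
    change (pF (θ₀ y) : M) = Ψ₂ (fibreMap Φ₁ pB pF (v₀, y))
    rw [← hθ₀ y]
    exact (h₂.triv.inv_fibreMap (z := (v₀, θ₀ y)) (h₂.mapsTo hvN)).symm
  obtain ⟨θ, ⟨hθy, hθ⟩, -⟩ := S.coverF.isCoveringMap.existsUnique_continuousMap_lifts ⟨c, hc⟩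
    (a, y₀) (θ₀ y₀) (hc₀ y₀)
  have hθc : ∀ x, pF (θ x) = c x := congrFun hθ
  have hθa : ∀ y, θ (a, y) = θ₀ y := by
    have : (fun y => θ (a, y)) = θ₀ :=
      S.coverF.isCoveringMap.eq_of_comp_eq (by fun_prop) θ₀.continuous
        (by ext y; simp only [Function.comp_apply, hθc, hc₀]) y₀ hθy
    exact congrFun this
  have hθΦ : ∀ x : N × F', fibreMap Φ₂ pB pF (x.1, θ x) = fibreMap Φ₁ pB pF (x.1, x.2) := by
    intro x
    have := h₂.triv.right_inv _ (hΦV x)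
    rw [hΦf] at this
    simp only [fibreMap, hθc]
    exact this
  obtain ⟨T, hT⟩ := h₁.family.exists_comparison S h₁.triv hN h₁.mapsTo h₂.family
    θ.continuous hθΦ
  have hconj : ∀ x y, pF (θ₀ x) = pF (θ₀ y) ↔ pF x = pF y := by
    intro x y
    constructor
    · intro hxy
      have h3 : fibreMap Φ₁ pB pF (v₀, x) = fibreMap Φ₁ pB pF (v₀, y) := by
        rw [← hθ₀, ← hθ₀]; simp only [fibreMap, hxy]
      have h4 := congrArg Ψ₁ h3
      rw [h₁.triv.inv_fibreMap (z := (v₀, x)) (h₁.mapsTo hvN),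
        h₁.triv.inv_fibreMap (z := (v₀, y)) (h₁.mapsTo hvN)] at h4
      exact Subtype.ext h4
    · intro hxy
      rw [hc₀, hc₀]
      simp only [c, fibreMap, hxy]
  let g : MulAut (deckGroup pF) := deckConj θ₀ hconj
  have hg : ∀ γ (x : N × F'), θ (x.1, γ.1 x.2) = (g γ).1 (θ x) := by
    intro γ
    have : (fun x : N × F' => θ (x.1, γ.1 x.2)) = fun x => (g γ).1 (θ x) := by
      refine S.coverF.isCoveringMap.eq_of_comp_eq
        (θ.continuous.comp (continuous_fst.prodMk (γ.1.continuous.comp continuous_snd)))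
        ((g γ).1.continuous.comp θ.continuous) ?_ (a, y₀) ?_
      · ext x
        simp only [Function.comp_apply, (g γ).2 (θ x), hθc]
        simp only [c, fibreMap, γ.2 x.2]
      · simp only [hθa]
        exact (deckConj_apply γ y₀).symm
    exact congrFun this
  let A : Euc l →ₗ[ℝ] Euc l := T.linear.comp (LinearMap.inr ℝ (Euc m) (Euc l))
  have hTA : ∀ x e, T (x, e) = A e + T (x, 0) := fun x e => AffineMap.apply_prod_eq x e
  have hslice : ∀ y, E₂ (v₀, θ₀ y) = A (E₁ (v₀, y)) + T (DB v₀, 0) := fun y => by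
    rw [← hTA, ← hθa]; exact hT (a, y)
  have hAb : Function.Bijective A := by
    let A' : Euc l →ᵃ[ℝ] Euc l := A.toAffineMap + AffineMap.const ℝ _ (T (DB v₀, 0))
    have hb : Function.Bijective A' := AffineMap.bijective_of_isOpenMap (x := y₀)
      (D := fun y => E₁ (v₀, y)) (D' := fun y => E₂ (v₀, θ₀ y))
      (nhds_comp_le (g := fun y => E₂ (v₀, y)) (h := θ₀) (h₂.family.nhds_slice_le S h₂.triv h₂.mapsTo hvN _)
        (θ₀.map_nhds_eq y₀).ge) (Eventually.of_forall hslice)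
    have : A'.linear = A := by simp [A']
    rw [← A'.linear_bijective_iff, this] at hb
    exact hb
  let Ae : Euc l ≃ₗ[ℝ] Euc l := LinearEquiv.ofBijective A hAb
  -- Two computations of `E₂ (v, θ (γ y))`. Their linear parts in `E₁` give the gauge condition on
  -- `(g, A)`; what remains compares the cocycles.
  have hmain : ∀ (v : N) (y : F') (γ : deckGroup pF),
      L (g γ) (A (E₁ (v, y)) + T (DB v, 0)) + (κ₂ (DB v)).1 (g γ) =
        A (L γ (E₁ (v, y)) + (κ₁ (DB v)).1 γ) + T (DB v, 0) := by
    intro v y γ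
    have e1 := hT (v, γ.1 y)
    simp only [hg γ (v, y)] at e1
    rw [h₂.equivariant v v.2, h₁.equivariant v v.2, hT (v, y)] at e1
    simpa only [hTA _ (E₁ _), hTA _ (_ + _)] using e1
  have hLA : ∀ γ e, L (g γ) (A e) = A (L γ e) := by
    intro γ e
    have h3 : (L (g γ) : Euc l →ₗ[ℝ] Euc l).toAffineMap.comp
        (A.toAffineMap + AffineMap.const ℝ _ (T (DB v₀, 0))) +
          AffineMap.const ℝ _ ((κ₂ (DB v₀)).1 (g γ)) =
        A.toAffineMap.comp ((L γ : Euc l →ₗ[ℝ] Euc l).toAffineMap +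
          AffineMap.const ℝ _ ((κ₁ (DB v₀)).1 γ)) + AffineMap.const ℝ _ (T (DB v₀, 0)) :=
      AffineMap.eq_of_eventuallyEq_comp
        (h₁.family.nhds_slice_le S h₁.triv h₁.mapsTo hvN y₀)
        (Eventually.of_forall fun y => hmain a y γ)
    have h4 := congrArg (fun T => T.linear e) h3
    simpa using h4
  let p : gaugeGroup L := ⟨(g, Ae), fun γ => by
    ext1 e
    change L (g γ) e = A (L γ (Ae.symm e))
    rw [← hLA]
    change L (g γ) e = L (g γ) (Ae (Ae.symm e))
    rw [Ae.apply_symm_apply]⟩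
  refine ⟨p, T (DB v₀, 0), fun x => ?_, hslice, fun γ y => (deckConj_apply (h := hconj) γ y).symm⟩
  have h5 : (LinearMap.range (coboundary L)).mkQ.toAffineMap.comp κ₂ =
      ((gaugeH1 L p).comp (LinearMap.range (coboundary L)).mkQ).toAffineMap.comp κ₁ := by
    refine AffineMap.eq_of_eventuallyEq_comp (S.nhds_DB_le v₀) ?_
    filter_upwards [hN.mem_nhds hvN] with v hv
    -- The shift of origin `T (DB v, 0)` in the fibre coordinate accounts for the coboundary.
    refine (Submodule.Quotient.eq _).2 ⟨-T (DB v, 0), ?_⟩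
    ext1; funext γ
    have e1 := hmain ⟨v, hv⟩ y₀ (g.symm γ)
    rw [g.apply_symm_apply] at e1
    have e2 := hLA (g.symm γ) (E₁ (v, y₀))
    rw [g.apply_symm_apply] at e2
    rw [map_add, map_add, e2] at e1
    change L γ (-T (DB v, 0)) - (-T (DB v, 0)) = (κ₂ (DB v)).1 γ - A ((κ₁ (DB v)).1 (g.symm γ))
    rw [map_neg]
    have e3 : L γ (T (DB v, 0)) + (κ₂ (DB v)).1 γ = A ((κ₁ (DB v)).1 (g.symm γ)) + T (DB v, 0) := by
      apply add_left_cancel (a := A (L (g.symm γ) (E₁ (v, y₀))))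
      rw [← add_assoc, ← add_assoc]; exact e1
    rw [sub_neg_eq_add, neg_add_eq_sub, eq_comm, sub_eq_sub_iff_add_eq_add, add_comm, e3, add_comm]
  exact DFunLike.congr_fun h5 x

/-- The fibres in two data at the same point can be identified. -/
theorem exists_homeomorph (h₁ : IsDatum f pB DB pF L V₁ Φ₁ Ψ₁ N₁ E₁ κ₁)
    (h₂ : IsDatum f pB DB pF L V₂ Φ₂ Ψ₂ N₂ E₂ κ₂)
    (S : IsDevelopedBundle m l f b₀ pB DB hB pF DF hF) {v₀ : B'} (hv₁ : v₀ ∈ N₁) (hv₂ : v₀ ∈ N₂) :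
    ∃ θ : F' ≃ₜ F', ∀ y, fibreMap Φ₂ pB pF (v₀, θ y) = fibreMap Φ₁ pB pF (v₀, y) := by
  have := S.coverF.simplyConnected
  have := S.devF.isLocalHomeomorph.locallyPathConnectedSpace
  have hb₁ := h₁.mapsTo hv₁
  have hb₂ := h₂.mapsTo hv₂
  have hmem : ∀ {W Φ Ψ}, IsFibreTrivialization m l f b₀ W Φ Ψ → pB v₀ ∈ W →
      ∀ {W' Φ' Ψ'}, IsFibreTrivialization m l f b₀ W' Φ' Ψ' → pB v₀ ∈ W' →
      ∀ y ∈ f ⁻¹' {b₀}, Φ (pB v₀, y) ∈ f ⁻¹' W' := fun h hb _ _ _ _ hb' y hy => by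
    rw [mem_preimage, h.proj _ hb y hy]; exact hb'
  have hcont : ∀ {W Φ Ψ} (h : IsFibreTrivialization m l f b₀ W Φ Ψ) (hb : pB v₀ ∈ W)
      {W' Φ' Ψ'} (h' : IsFibreTrivialization m l f b₀ W' Φ' Ψ') (hb' : pB v₀ ∈ W'),
      Continuous fun y : f ⁻¹' {b₀} => (⟨Ψ' (Φ (pB v₀, y)), h'.inv_mem _
        (hmem h hb h' hb' y y.2)⟩ : f ⁻¹' {b₀}) := fun h hb _ _ _ h' hb' =>
    Continuous.subtype_mk (h'.contMDiffOn_inv.continuousOn.comp_continuous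
      ((h.slice hb).continuousOn.comp_continuous continuous_subtype_val fun y => y.2)
      fun y => hmem h hb h' hb' y y.2) _
  have hinv : ∀ {W Φ Ψ}, IsFibreTrivialization m l f b₀ W Φ Ψ → pB v₀ ∈ W →
      ∀ {W' Φ' Ψ'}, IsFibreTrivialization m l f b₀ W' Φ' Ψ' → pB v₀ ∈ W' →
      ∀ y ∈ f ⁻¹' {b₀}, Ψ (Φ' (pB v₀, Ψ' (Φ (pB v₀, y)))) = y := by
    intro W Φ Ψ h hb W' Φ' Ψ' h' hb' y hy
    have := h'.right_inv _ (hmem h hb h' hb' y hy)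
    rw [h.proj _ hb y hy] at this
    rw [this, h.left_inv _ hb y hy]
  let e : f ⁻¹' {b₀} ≃ₜ f ⁻¹' {b₀} :=
    { toFun := fun y => ⟨Ψ₁ (Φ₂ (pB v₀, y)), h₁.triv.inv_mem _ (hmem h₂.triv hb₂ h₁.triv hb₁ y y.2)⟩
      invFun := fun y => ⟨Ψ₂ (Φ₁ (pB v₀, y)), h₂.triv.inv_mem _
        (hmem h₁.triv hb₁ h₂.triv hb₂ y y.2)⟩
      left_inv := fun y => Subtype.ext (hinv h₂.triv hb₂ h₁.triv hb₁ y y.2)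
      right_inv := fun y => Subtype.ext (hinv h₁.triv hb₁ h₂.triv hb₂ y y.2)
      continuous_toFun := hcont h₂.triv hb₂ h₁.triv hb₁
      continuous_invFun := hcont h₁.triv hb₁ h₂.triv hb₂ }
  obtain ⟨y₀⟩ : Nonempty F' := inferInstance
  obtain ⟨y₁, hy₁⟩ := S.coverF.surjective (e.symm (pF y₀))
  obtain ⟨θ, -, hθ⟩ := S.coverF.isCoveringMap.exists_homeomorph
    (S.coverF.isCoveringMap.homeomorph_comp e) (x₀ := y₀) (y₀ := y₁) (by simp [hy₁])
  refine ⟨θ, fun y => ?_⟩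
  have h3 : Ψ₁ (Φ₂ (pB v₀, pF (θ y))) = pF y := congrArg Subtype.val (hθ y)
  have h4 := h₁.triv.right_inv _ (hmem h₂.triv hb₂ h₁.triv hb₁ (pF (θ y)) (pF (θ y)).2)
  rw [h₂.triv.proj _ hb₂ _ (pF (θ y)).2, h3] at h4
  exact h4.symm

/-- Two data which agree on one fibre have the same cohomology classes. -/
theorem mk_eq_mk (h₁ : IsDatum f pB DB pF L V₁ Φ₁ Ψ₁ N₁ E₁ κ₁)
    (h₂ : IsDatum f pB DB pF L V₂ Φ₂ Ψ₂ N₂ E₂ κ₂)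
    (S : IsDevelopedBundle m l f b₀ pB DB hB pF DF hF) {v₀ : B'} (hv₁ : v₀ ∈ N₁) (hv₂ : v₀ ∈ N₂)
    (hΦ : ∀ y, fibreMap Φ₂ pB pF (v₀, y) = fibreMap Φ₁ pB pF (v₀, y))
    (hE : ∀ y, E₂ (v₀, y) = E₁ (v₀, y)) (x : Euc m) :
    (Submodule.Quotient.mk (κ₂ x) : H1 L) = Submodule.Quotient.mk (κ₁ x) := by
  have := S.coverF.simplyConnected
  obtain ⟨y₀⟩ : Nonempty F' := inferInstance
  obtain ⟨p, w, hp, hpE, hpθ⟩ := h₁.exists_gauge h₂ S hv₁ hv₂ (Homeomorph.refl F') hΦ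
  -- The fibres are identified by the identity of `F'`, so the automorphism is trivial because deck
  -- transformations act freely. The linear part is trivial because the developing maps agree.
  have h1 : p.1.1 = 1 := MulEquiv.ext fun γ => S.coverF.deck_ext (x := y₀) (hpθ γ y₀).symm
  have h2 : AffineMap.id ℝ (Euc l) =
      (p.1.2 : Euc l →ₗ[ℝ] Euc l).toAffineMap + AffineMap.const ℝ _ w :=
    AffineMap.eq_of_eventuallyEq_comp (h₁.family.nhds_slice_le S h₁.triv h₁.mapsTo hv₁ y₀)
      (Eventually.of_forall fun y => by
        have := hpE y
        rw [Homeomorph.refl_apply, hE] at this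
        exact this)
  have h3 : p.1.2 = 1 := by
    ext1 e
    have := congrArg (fun T => T.linear e) h2
    simpa using this.symm
  have h4 : p = 1 := Subtype.ext (Prod.ext h1 h3)
  rw [hp, h4]
  exact one_smul (gaugeGroup L) (Submodule.Quotient.mk (κ₁ x) : H1 L)

end IsDatum

/-- There are data near every point of the universal cover of the base which
define the same affine family of cohomology classes. -/
theorem IsDevelopedBundle.exists_classes [HasGroupoid M (affineGroupoid (m + l))]
    (S : IsDevelopedBundle m l f b₀ pB DB hB pF DF hF)
    (htriv : IsSmoothlyLocallyTrivial (m + l) m f b₀) :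
    ∃ κ₀ : Euc m →ᵃ[ℝ] cocycles (linearHolonomy hF),
      (∀ v, ∃ V Φ Ψ N E κ, v ∈ N ∧ IsDatum f pB DB pF (linearHolonomy hF) V Φ Ψ N E κ ∧
        ∀ x, (Submodule.Quotient.mk (κ x) : H1 (linearHolonomy hF)) =
          Submodule.Quotient.mk (κ₀ x)) ∧
      ∃ v V Φ Ψ N E κ, v ∈ N ∧ IsDatum f pB DB pF (linearHolonomy hF) V Φ Ψ N E κ ∧
        (∀ y, fibreMap Φ pB pF (v, y) = pF y) ∧ ∀ y, E (v, y) = DF y := by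
  have := S.coverF.simplyConnected
  have := S.coverB.simplyConnected
  set L := linearHolonomy hF with hL
  obtain ⟨v₀, hv₀⟩ := S.coverB.surjective b₀
  have htr : ∀ v : B', ∃ V Φ Ψ, ∃ N : Set B', IsFibreTrivialization m l f b₀ V Φ Ψ ∧ IsOpen N ∧
      v ∈ N ∧ MapsTo pB N V ∧ ContractibleSpace N := fun v => by
    obtain ⟨V, Φ, Ψ, hv, h⟩ := htriv.exists_fibreTrivialization (pB v)
    obtain ⟨N, hN, hvN, hsub, hc, -⟩ := S.devB.isLocalHomeomorph.exists_contractible_nhd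
      (S.coverB.isCoveringMap.continuous.continuousAt.preimage_mem_nhds (h.isOpen.mem_nhds hv))
    exact ⟨V, Φ, Ψ, N, h, hN, hvN, hsub, hc⟩
  obtain ⟨V, Φ₀, Ψ₀, N, h₀, hN, hvN, hNV, hNc⟩ := htr v₀
  have hb₀ : b₀ ∈ V := hv₀ ▸ hNV hvN
  obtain ⟨Φ, Ψ, h, hΦ⟩ := h₀.change (s := id) (s' := id) hb₀ contMDiffOn_id contMDiffOn_id
    (mapsTo_id _) (mapsTo_id _) (fun _ _ => rfl) (fun _ _ => rfl)
  have hΦ₀ : ∀ y, fibreMap Φ pB pF (v₀, y) = pF y := fun y => by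
    simp only [fibreMap, hv₀]; exact hΦ _ (pF y).2
  obtain ⟨E, κ₀, hd, hED⟩ := S.exists_datum h hN hNV hvN (L := L) S.devF.isLocalHomeomorph.isOpenMap
    (fun y => by
      obtain ⟨A, hA⟩ := S.devF.isAffine.2 y
      refine ⟨A, ?_⟩
      filter_upwards [hA] with y' h1
      simpa only [hΦ₀, id, chartAt_self_eq, OpenPartialHomeomorph.refl_apply] using! h1)
    (fun γ => ⟨hF γ 0, fun y => by
      rw [S.devF.equivariant]
      have := (hF γ).map_vadd 0 (DF y)
      simpa using! this⟩)
  refine ⟨κ₀, ?_, v₀, V, Φ, Ψ, N, E, κ₀, hvN, hd, hΦ₀, hED⟩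
  -- Continuation by connectedness. Near a limit point `v` of `Q`, a trivialized contractible
  -- neighbourhood contains some `v' ∈ Q`; the datum on the fibre over `v'` extends over this
  -- neighbourhood, with unchanged classes.
  let Q : Set B' := {v | ∃ V Φ Ψ N E κ, v ∈ N ∧ IsDatum f pB DB pF L V Φ Ψ N E κ ∧
    ∀ x, (Submodule.Quotient.mk (κ x) : H1 L) = Submodule.Quotient.mk (κ₀ x)}
  have hQo : IsOpen Q := isOpen_iff_mem_nhds.2 fun v ⟨V, Φ, Ψ, N, E, κ, hv, hd, hκ⟩ => by
    filter_upwards [hd.isOpen.mem_nhds hv] with v' hv'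
    exact ⟨V, Φ, Ψ, N, E, κ, hv', hd, hκ⟩
  have hQc : IsClosed Q := by
    refine isClosed_of_closure_subset fun v hv => ?_
    obtain ⟨V₂, Φ₂, Ψ₂, N₂, h₂, hN₂, hvN₂, hNV₂, hNc₂⟩ := htr v
    obtain ⟨v', hv'₂, V₁, Φ₁, Ψ₁, N₁, E₁, κ₁, hv'₁, hd₁, hκ₁⟩ :=
      mem_closure_iff.1 hv N₂ hN₂ hvN₂
    have hb₁ : pB v' ∈ V₁ := hd₁.mapsTo hv'₁
    have hb₂ : pB v' ∈ V₂ := hNV₂ hv'₂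
    have hsub : f ⁻¹' {pB v'} ⊆ f ⁻¹' V₁ := fun p hp => by
      rw [mem_preimage, show f p = pB v' from hp]; exact hb₁
    obtain ⟨Φ₃, Ψ₃, h₃, hΦ₃⟩ := h₂.change hb₂ (hd₁.triv.slice hb₁)
      (hd₁.triv.contMDiffOn_inv.mono hsub) (fun y hy => hd₁.triv.proj _ hb₁ y hy)
      (fun p hp => hd₁.triv.inv_mem p (hsub hp)) (fun y hy => hd₁.triv.left_inv _ hb₁ y hy)
      (fun p hp => by
        have := hd₁.triv.right_inv p (hsub hp)
        rwa [show f p = pB v' from hp] at this)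
    have hΦ₃' : ∀ y, fibreMap Φ₃ pB pF (v', y) = fibreMap Φ₁ pB pF (v', y) := fun y =>
      hΦ₃ _ (pF y).2
    obtain ⟨E₃, κ₃, hd₃, hE₃⟩ := S.exists_datum h₃ hN₂ hNV₂ hv'₂ (L := L)
      (D := fun y => E₁ (v', y))
      (IsOpenMap.of_nhds_le (hd₁.family.nhds_slice_le S hd₁.triv hd₁.mapsTo hv'₁))
      (fun y => by
        obtain ⟨T, hT⟩ := hd₁.family.eventually_eq (z := (v', y)) hv'₁
        have hc : Continuous fun y' : F' => (v', y') := by fun_prop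
        refine ⟨(LinearMap.snd ℝ (Euc m) (Euc l)).toAffineMap.comp
          (T : Euc (m + l) →ᵃ[ℝ] Euc m × Euc l), ?_⟩
        filter_upwards [hc.continuousAt.eventually hT] with y' h1
        rw [hΦ₃', hΦ₃']
        exact congrArg Prod.snd h1)
      (fun γ => ⟨_, fun y => hd₁.equivariant v' hv'₁ γ y⟩)
    exact ⟨V₂, Φ₃, Ψ₃, N₂, E₃, κ₃, hvN₂, hd₃, fun x =>
      (hd₁.mk_eq_mk hd₃ S hv'₁ hv'₂ hΦ₃' hE₃ x).trans (hκ₁ x)⟩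
  intro v
  have : Q = univ := IsClopen.eq_univ ⟨hQc, hQo⟩
    ⟨v₀, V, Φ, Ψ, N, E, κ₀, hvN, hd, fun _ => rfl⟩
  exact (this.symm ▸ mem_univ v : v ∈ Q)

end Holonomy

/-! ### From data to affine structures and isomorphisms of fibres -/

section Fibres

variable {m l : ℕ} {M B : Type*} [TopologicalSpace M] [ChartedSpace (Euc (m + l)) M]
  [TopologicalSpace B] [ChartedSpace (Euc m) B] {B' F' : Type*} [TopologicalSpace B']
  [TopologicalSpace F'] {f : M → B} {b₀ : B} {pB : B' → B} {DB : B' → Euc m}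
  {hB : deckGroup pB →* (Euc m ≃ᵃ[ℝ] Euc m)} {pF : F' → f ⁻¹' {b₀}} {DF : F' → Euc l}
  {hF : deckGroup pF →* (Euc l ≃ᵃ[ℝ] Euc l)}
  {V V₁ V₂ : Set B} {Φ Φ₁ Φ₂ : B × M → M} {Ψ Ψ₁ Ψ₂ : M → M} {N N₁ N₂ : Set B'}
  {E E₁ E₂ : B' × F' → Euc l}
  {L : deckGroup pF →* (Euc l ≃ₗ[ℝ] Euc l)} {κ κ₁ κ₂ : Euc m →ᵃ[ℝ] cocycles L}

theorem AffineMap.contDiff_euc {n k : ℕ} (T : Euc n →ᵃ[ℝ] Euc k) : ContDiff ℝ ∞ T := by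
  have h : (T : Euc n → Euc k) = fun x => LinearMap.toContinuousLinearMap T.linear x + T 0 :=
    T.decomp
  rw [h]
  exact (ContinuousLinearMap.contDiff _).add contDiff_const

/-- A smooth map between affine manifolds, read in affine coordinates of submanifolds. -/
theorem exists_contDiffAt_of_contMDiffOn {n : ℕ} {M : Type*} [TopologicalSpace M]
    [ChartedSpace (Euc n) M] {s : M → M} {A : Set M}
    (hs : ContMDiffOn 𝓘(ℝ, Euc n) 𝓘(ℝ, Euc n) ∞ s A) {q : F' → M} (hqA : ∀ y, q y ∈ A)
    (hq : Continuous q) {D₁ D₂ : F' → Euc l} {y : F'} (hD₁ : 𝓝 (D₁ y) ≤ map D₁ (𝓝 y))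
    {T₁ : Euc l →ᵃ[ℝ] Euc n} (h₁ : ∀ᶠ y' in 𝓝 y, chartAt (Euc n) (q y) (q y') = T₁ (D₁ y'))
    {T₂ : Euc n →ᵃ[ℝ] Euc l}
    (h₂ : ∀ᶠ y' in 𝓝 y, D₂ y' = T₂ (chartAt (Euc n) (s (q y)) (s (q y')))) :
    ∃ ψ : Euc l → Euc l, ContDiffAt ℝ ∞ ψ (D₁ y) ∧ ∀ᶠ y' in 𝓝 y, D₂ y' = ψ (D₁ y') := by
  have hsrc : ∀ᶠ y' in 𝓝 y, q y' ∈ (chartAt (Euc n) (q y)).source :=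
    hq.continuousAt.preimage_mem_nhds
      ((chartAt _ _).open_source.mem_nhds (mem_chart_source _ _))
  have hinv : ∀ᶠ y' in 𝓝 y, (chartAt (Euc n) (q y)).symm (T₁ (D₁ y')) = q y' := by
    filter_upwards [hsrc, h₁] with y' h3 h4
    rw [← h4, (chartAt (Euc n) (q y)).left_inv h3]
  refine ⟨fun z => T₂ (chartAt (Euc n) (s (q y)) (s ((chartAt (Euc n) (q y)).symm (T₁ z)))), ?_, ?_⟩
  · have h5 := ((contMDiffWithinAt_iff.1 (hs (q y) (hqA y))).2)
    simp only [extChartAt, mfld_simps] at h5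
    rw [h₁.self_of_nhds] at h5
    have hT₁ : ContDiffWithinAt ℝ ∞ T₁ {z | (chartAt (Euc n) (q y)).symm (T₁ z) ∈ A} (D₁ y) :=
      T₁.contDiff_euc.contDiffWithinAt
    have h6 := ContDiffWithinAt.comp (D₁ y) h5 hT₁ fun z hz => hz
    -- Smoothness of `s` is known only within `A`; since `D₁` is open and `q` takes values in `A`,
    -- the affine coordinates near `D₁ y` parametrize points of `A`, so smoothness holds on a full
    -- neighbourhood.
    have hmem : {z | (chartAt (Euc n) (q y)).symm (T₁ z) ∈ A} ∈ 𝓝 (D₁ y) :=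
      hD₁ (mem_map.2 (hinv.mono fun y' h => by
        change (chartAt (Euc n) (q y)).symm (T₁ (D₁ y')) ∈ A
        rw [h]; exact hqA y'))
    exact T₂.contDiff_euc.contDiffAt.comp (D₁ y) (h6.contDiffAt hmem)
  · filter_upwards [hinv, h₂] with y' h3 h4
    rw [h3, h4]

/-- The homeomorphism of the typical fibre onto a fibre, given by a trivialization. -/
def IsFibreTrivialization.sliceHomeomorph (h : IsFibreTrivialization m l f b₀ V Φ Ψ) {b : B}
    (hb : b ∈ V) : f ⁻¹' {b₀} ≃ₜ f ⁻¹' {b} where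
  toFun y := ⟨Φ (b, y), h.proj b hb y y.2⟩
  invFun p := ⟨Ψ p, h.inv_mem p (by rw [mem_preimage, show f p = b from p.2]; exact hb)⟩
  left_inv y := Subtype.ext (h.left_inv b hb y y.2)
  right_inv p := Subtype.ext (by
    have := h.right_inv p (by rw [mem_preimage, show f p = b from p.2]; exact hb)
    rwa [show f p = b from p.2] at this)
  continuous_toFun := Continuous.subtype_mk
    ((h.slice hb).continuousOn.comp_continuous continuous_subtype_val fun y => y.2) _
  continuous_invFun := Continuous.subtype_mk
    (h.contMDiffOn_inv.continuousOn.comp_continuous continuous_subtype_val fun p => by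
      rw [mem_preimage, show f p = b from p.2]; exact hb) _

namespace IsDatum

theorem slice_eq (h : IsDatum f pB DB pF L V Φ Ψ N E κ) {v : B'} (hv : v ∈ N) (y : F') :
    ∃ T : (Euc m × Euc l) ≃ᵃ[ℝ] Euc (m + l), ∀ᶠ y' in 𝓝 y,
      chartAt (Euc (m + l)) (fibreMap Φ pB pF (v, y)) (fibreMap Φ pB pF (v, y')) =
        T (DB v, E (v, y')) := by
  obtain ⟨T, hT⟩ := h.family (v, y) hv
  have hc : Continuous fun y' : F' => (v, y') := by fun_prop
  exact ⟨T, hc.continuousAt.eventually hT⟩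

theorem slice_eq_symm (h : IsDatum f pB DB pF L V Φ Ψ N E κ) {v : B'} (hv : v ∈ N) (y : F') :
    ∃ T : Euc (m + l) →ᵃ[ℝ] Euc l, ∀ᶠ y' in 𝓝 y, E (v, y') =
      T (chartAt (Euc (m + l)) (fibreMap Φ pB pF (v, y)) (fibreMap Φ pB pF (v, y'))) := by
  obtain ⟨T, hT⟩ := h.slice_eq hv y
  refine ⟨(LinearMap.snd ℝ (Euc m) (Euc l)).toAffineMap.comp
    (T.symm : Euc (m + l) →ᵃ[ℝ] Euc m × Euc l), ?_⟩
  filter_upwards [hT] with y' h1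
  rw [h1]
  exact (congrArg Prod.snd (T.symm_apply_apply (DB v, E (v, y')))).symm

/-- The classes defined by a datum are classes of affine structures on the typical fibre. -/
theorem mk_mem_affineClasses (h : IsDatum f pB DB pF L V Φ Ψ N E κ)
    (S : IsDevelopedBundle m l f b₀ pB DB hB pF DF hF) {v : B'} (hv : v ∈ N)
    (h₀ : IsDatum f pB DB pF L V₁ Φ₁ Ψ₁ N₁ E₁ κ₁) {v₀ : B'} (hv₀ : v₀ ∈ N₁)
    (hΦ₀ : ∀ y, fibreMap Φ₁ pB pF (v₀, y) = pF y) (hE₀ : ∀ y, E₁ (v₀, y) = DF y) :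
    (Submodule.Quotient.mk (κ (DB v)) : H1 L) ∈ affineClasses pF DF L := by
  refine ⟨κ (DB v), rfl, fun y => E (v, y), fun y => ?_, fun γ y => h.equivariant v hv γ y⟩
  have hb := h.mapsTo hv
  obtain ⟨T₀, hT₀⟩ := h₀.slice_eq hv₀ y
  obtain ⟨T, hT⟩ := h.slice_eq hv y
  obtain ⟨T', hT'⟩ := h.slice_eq_symm hv y
  obtain ⟨A, hA⟩ := S.devF.isAffine.2 y
  simp only [hΦ₀, hE₀] at hT₀
  simp only [id, chartAt_self_eq, OpenPartialHomeomorph.refl_apply, Function.comp_apply] at hA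
  have hDF := S.devF.isLocalHomeomorph.isOpenMap.nhds_le y
  have hpF := S.coverF.isCoveringMap.continuous
  let i (x : Euc m) : Euc l →ᵃ[ℝ] Euc m × Euc l :=
    (AffineMap.const ℝ _ x).prod (AffineMap.id ℝ (Euc l))
  obtain ⟨ψ, hψ, hψe⟩ := exists_contDiffAt_of_contMDiffOn (h.triv.slice hb)
    (q := fun y => (pF y : M)) (fun y => (pF y).2) (by fun_prop) hDF
    (T₁ := (T₀ : Euc m × Euc l →ᵃ[ℝ] Euc (m + l)).comp (i (DB v₀))) hT₀ hT'
  have hinv : ∀ y, Ψ (fibreMap Φ pB pF (v, y)) = pF y := fun y => h.triv.inv_fibreMap (z := (v, y)) hb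
  obtain ⟨ψ', hψ', hψe'⟩ := exists_contDiffAt_of_contMDiffOn h.triv.contMDiffOn_inv
    (q := fun y => fibreMap Φ pB pF (v, y))
    (fun y => by rw [mem_preimage, h.triv.proj_fibreMap (z := (v, y)) hb]; exact hb)
    (((h.triv.slice hb).continuousOn.comp_continuous (f := fun y => (pF y : M)) (by fun_prop)
      fun y => (pF y).2))
    (h.family.nhds_slice_le S h.triv h.mapsTo hv y)
    (T₁ := (T : Euc m × Euc l →ᵃ[ℝ] Euc (m + l)).comp (i (DB v))) hT (D₂ := DF) (T₂ := A)
    (by simpa only [hinv] using hA)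
  refine ⟨ψ, hψ, ?_, hψe⟩
  have hy : E (v, y) = ψ (DF y) := hψe.self_of_nhds
  -- `ψ` and `ψ'` read `Φ (pB v, ·)` and `Ψ` in the two developing maps. The chain rule makes the
  -- derivative of `ψ` injective, hence bijective.
  have hid : ψ' ∘ ψ =ᶠ[𝓝 (DF y)] id := hDF <| mem_map.2 <| by
    filter_upwards [hψe, hψe'] with y' h1 h2
    change ψ' (ψ (DF y')) = DF y'
    rw [← h1, ← h2]
  rw [hy] at hψ'
  have hd := (hψ'.differentiableAt (by simp)).hasFDerivAt.comp (DF y)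
    (hψ.differentiableAt (by simp)).hasFDerivAt
  have hcomp := (hd.congr_of_eventuallyEq hid.symm).unique (hasFDerivAt_id (DF y))
  have hinj : Function.Injective (fderiv ℝ ψ (DF y)) :=
    Function.LeftInverse.injective (g := fderiv ℝ ψ' (ψ (DF y))) fun e => DFunLike.congr_fun hcomp e
  exact ⟨hinj, (LinearMap.injective_iff_surjective
    (f := (fderiv ℝ ψ (DF y) : Euc l →ₗ[ℝ] Euc l))).1 hinj⟩

theorem isAffineAlong (h₁ : IsDatum f pB DB pF L V₁ Φ₁ Ψ₁ N₁ E₁ κ₁)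
    (h₂ : IsDatum f pB DB pF L V₂ Φ₂ Ψ₂ N₂ E₂ κ₂)
    (S : IsDevelopedBundle m l f b₀ pB DB hB pF DF hF) {v₁ v₂ : B'} (hv₁ : v₁ ∈ N₁) (hv₂ : v₂ ∈ N₂)
    {φ : F' → F'} (hφ : Continuous φ) {T : Euc l →ᵃ[ℝ] Euc l}
    (hT : ∀ y, E₂ (v₂, φ y) = T (E₁ (v₁, y)))
    {g : f ⁻¹' {pB v₁} → f ⁻¹' {pB v₂}} (hg : Continuous g)
    (hgφ : ∀ y, g (h₁.triv.sliceHomeomorph (h₁.mapsTo hv₁) (pF y)) =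
      h₂.triv.sliceHomeomorph (h₂.mapsTo hv₂) (pF (φ y))) :
    IsAffineAlong (n := m + l) (k := m + l) (Subtype.val : f ⁻¹' {pB v₁} → M)
      (Subtype.val : f ⁻¹' {pB v₂} → M) g := by
  refine ⟨hg, fun x => ?_⟩
  obtain ⟨y, hy⟩ := S.coverF.surjective ((h₁.triv.sliceHomeomorph (h₁.mapsTo hv₁)).symm x)
  rw [Homeomorph.eq_symm_apply] at hy
  subst hy
  obtain ⟨T₁, hT₁⟩ := h₁.slice_eq_symm hv₁ y
  obtain ⟨T₂, hT₂⟩ := h₂.slice_eq hv₂ (φ y)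
  refine ⟨(T₂ : Euc m × Euc l →ᵃ[ℝ] Euc (m + l)).comp
    ((AffineMap.const ℝ _ (DB v₂)).prod (T.comp T₁)), ?_⟩
  have hopen := nhds_comp_le
    ((h₁.triv.sliceHomeomorph (h₁.mapsTo hv₁)).map_nhds_eq (pF y)).ge
    (S.coverF.isCoveringMap.isOpenMap.nhds_le y)
  refine hopen (mem_map.2 ?_)
  filter_upwards [hT₁, hφ.continuousAt.eventually hT₂] with y' h3 h4
  rw [mem_preimage, mem_ofPred_eq, hgφ, hgφ]
  refine Eq.trans h4 ?_
  rw [hT, h3]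
  rfl

/-- An equivariant homeomorphism which is affine in the developing maps induces an affine
isomorphism of the fibres. -/
theorem fibresAffinelyIsomorphic (h₁ : IsDatum f pB DB pF L V₁ Φ₁ Ψ₁ N₁ E₁ κ₁)
    (h₂ : IsDatum f pB DB pF L V₂ Φ₂ Ψ₂ N₂ E₂ κ₂)
    (S : IsDevelopedBundle m l f b₀ pB DB hB pF DF hF) {v₁ v₂ : B'} (hv₁ : v₁ ∈ N₁) (hv₂ : v₂ ∈ N₂)
    (φ : F' ≃ₜ F') (hφ : ∀ x y, pF (φ x) = pF (φ y) ↔ pF x = pF y) (T : Euc l ≃ᵃ[ℝ] Euc l)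
    (hT : ∀ y, E₂ (v₂, φ y) = T (E₁ (v₁, y))) :
    FibresAffinelyIsomorphic (m + l) f (pB v₁) (pB v₂) := by
  have hq := S.coverF.isCoveringMap.isQuotientMap S.coverF.surjective
  have hpF := S.coverF.isCoveringMap.continuous
  have hφ' : ∀ x y, pF (φ.symm x) = pF (φ.symm y) ↔ pF x = pF y := fun x y => by
    rw [← hφ]; simp
  have hlift : ∀ θ : F' ≃ₜ F', (∀ x y, pF (θ x) = pF (θ y) ↔ pF x = pF y) →
      ∃ a : f ⁻¹' {b₀} → f ⁻¹' {b₀}, Continuous a ∧ ∀ y, a (pF y) = pF (θ y) := fun θ hθ => by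
    have ha : ∀ y, pF (θ (Function.surjInv S.coverF.surjective (pF y))) = pF (θ y) := fun y =>
      (hθ _ _).2 (Function.surjInv_eq _ _)
    refine ⟨fun z => pF (θ (Function.surjInv S.coverF.surjective z)), hq.continuous_iff.2 ?_, ha⟩
    exact (hpF.comp θ.continuous).congr fun y => (ha y).symm
  obtain ⟨a, hac, ha⟩ := hlift φ hφ
  obtain ⟨a', hac', ha'⟩ := hlift φ.symm hφ'
  let e : f ⁻¹' {b₀} ≃ₜ f ⁻¹' {b₀} :=
    { toFun := a
      invFun := a'
      left_inv := fun z => by obtain ⟨y, rfl⟩ := S.coverF.surjective z; simp [ha, ha']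
      right_inv := fun z => by obtain ⟨y, rfl⟩ := S.coverF.surjective z; simp [ha, ha']
      continuous_toFun := hac
      continuous_invFun := hac' }
  let e₁ := h₁.triv.sliceHomeomorph (h₁.mapsTo hv₁)
  let e₂ := h₂.triv.sliceHomeomorph (h₂.mapsTo hv₂)
  refine ⟨(e₁.symm.trans e).trans e₂, ?_, ?_⟩
  · refine h₁.isAffineAlong h₂ S hv₁ hv₂ φ.continuous (T := T) hT (Homeomorph.continuous _) fun y => ?_
    change e₂ (e (e₁.symm (e₁ (pF y)))) = e₂ (pF (φ y))
    rw [e₁.symm_apply_apply]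
    exact congrArg e₂ (ha y)
  · refine h₂.isAffineAlong h₁ S hv₂ hv₁ φ.symm.continuous (T := T.symm) (fun y => ?_)
      (Homeomorph.continuous _) fun y => ?_
    · rw [AffineEquiv.coe_coe, AffineEquiv.eq_symm_apply, ← hT, φ.apply_symm_apply]
    · change e₁ (e.symm (e₂.symm (e₂ (pF y)))) = e₁ (pF (φ.symm y))
      rw [e₂.symm_apply_apply]
      exact congrArg e₁ (ha' y)

end IsDatum

end Fibres

/-! ### Isomorphism of fibres as an equivalence relation -/

section Isomorphisms

variable {n : ℕ} {M B : Type*} [TopologicalSpace M] [ChartedSpace (Euc n) M] {f : M → B}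

theorem IsAffineAlong.comp {X Y Z N P : Type*} [TopologicalSpace X] [TopologicalSpace Y]
    [TopologicalSpace Z] [TopologicalSpace N] [TopologicalSpace P] {j k : ℕ}
    [ChartedSpace (Euc j) N] [ChartedSpace (Euc k) P] {a : X → M} {b : Y → N} {c : Z → P}
    {ψ : Y → Z} {φ : X → Y} (hψ : IsAffineAlong (n := j) (k := k) b c ψ)
    (hφ : IsAffineAlong (n := n) (k := j) a b φ) : IsAffineAlong (n := n) (k := k) a c (ψ ∘ φ) := by
  refine ⟨hψ.1.comp hφ.1, fun x => ?_⟩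
  obtain ⟨A, hA⟩ := hφ.2 x
  obtain ⟨A', hA'⟩ := hψ.2 (φ x)
  refine ⟨A'.comp A, ?_⟩
  filter_upwards [hA, hφ.1.continuousAt.eventually hA'] with x' h1 h2
  rw [Function.comp_apply, Function.comp_apply, h2, h1]
  rfl

theorem FibresAffinelyIsomorphic.symm {b b' : B} (h : FibresAffinelyIsomorphic n f b b') :
    FibresAffinelyIsomorphic n f b' b := by
  obtain ⟨φ, h1, h2⟩ := h
  exact ⟨φ.symm, h2, h1⟩

theorem FibresAffinelyIsomorphic.trans {b b' b'' : B} (h : FibresAffinelyIsomorphic n f b b')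
    (h' : FibresAffinelyIsomorphic n f b' b'') : FibresAffinelyIsomorphic n f b b'' := by
  obtain ⟨φ, h1, h2⟩ := h
  obtain ⟨φ', h3, h4⟩ := h'
  exact ⟨φ.trans φ', h3.comp h1, h2.comp h4⟩

end Isomorphisms

/-! ### Complete fibres -/

section Complete

variable {m l : ℕ} {M B : Type*} [TopologicalSpace M] [ChartedSpace (Euc (m + l)) M]
  [TopologicalSpace B] [ChartedSpace (Euc m) B] {B' F' : Type*} [TopologicalSpace B']
  [TopologicalSpace F'] {f : M → B} {b₀ : B} {pB : B' → B} {DB : B' → Euc m}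
  {hB : deckGroup pB →* (Euc m ≃ᵃ[ℝ] Euc m)} {pF : F' → f ⁻¹' {b₀}} {DF : F' → Euc l}
  {hF : deckGroup pF →* (Euc l ≃ᵃ[ℝ] Euc l)}
  {V V₁ V₂ : Set B} {Φ Φ₁ Φ₂ : B × M → M} {Ψ Ψ₁ Ψ₂ : M → M} {N N₁ N₂ : Set B'}
  {E E₁ E₂ : B' × F' → Euc l}
  {L : deckGroup pF →* (Euc l ≃ₗ[ℝ] Euc l)} {κ κ₁ κ₂ : Euc m →ᵃ[ℝ] cocycles L}

namespace IsDatum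

/-- The developing map of a complete fibre is a homeomorphism. -/
theorem exists_homeomorph_of_fibreComplete (h : IsDatum f pB DB pF L V Φ Ψ N E κ)
    (S : IsDevelopedBundle m l f b₀ pB DB hB pF DF hF) {v : B'} (hv : v ∈ N)
    (hc : FibreComplete (m + l) l f (pB v)) : ∃ e : F' ≃ₜ Euc l, ∀ y, e y = E (v, y) := by
  have := S.coverF.simplyConnected
  have := S.devF.isLocalHomeomorph.locallyPathConnectedSpace
  obtain ⟨y₀⟩ : Nonempty F' := inferInstance
  obtain ⟨q, hq, hqs, hqa⟩ := hc
  let J := h.triv.sliceHomeomorph (h.mapsTo hv)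
  obtain ⟨x₀, hx₀⟩ := hqs (J (pF y₀))
  have : LocallyPathConnectedSpace (Euc l) := inferInstance
  have : SimplyConnectedSpace (Euc l) := inferInstance
  -- `F'` and `ℝˡ` are both simply connected coverings of the fibre. Through the resulting
  -- homeomorphism `θ`, the developing map is locally, hence globally, affine on `ℝˡ`, and openness
  -- makes it bijective.
  obtain ⟨θ, -, hθ⟩ := (S.coverF.isCoveringMap.homeomorph_comp J).exists_homeomorph hq
    (x₀ := y₀) (y₀ := x₀) hx₀.symm
  have hloc : IsLocallyAffineIn θ fun y => E (v, y) := fun y => by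
    obtain ⟨T, hT⟩ := h.slice_eq_symm hv y
    obtain ⟨A, hA⟩ := hqa.2 (θ y)
    refine ⟨T.comp A, ?_⟩
    filter_upwards [hT, θ.continuous.continuousAt.eventually hA] with y' h1 h2
    simp only [hθ, id, chartAt_self_eq, OpenPartialHomeomorph.refl_apply] at h2
    rw [h1]
    exact congrArg T h2
  obtain ⟨T, hT⟩ := hloc.exists_eq θ.isOpenMap
  have hb : Function.Bijective T := AffineMap.bijective_of_isOpenMap
    (h.family.nhds_slice_le S h.triv h.mapsTo hv y₀) (Eventually.of_forall hT)
  exact ⟨θ.trans (AffineEquiv.toContinuousAffineEquiv (AffineEquiv.ofBijective hb)).toHomeomorph, fun y => (hT y).symm⟩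

/-- Gauge equivalence of the classes says that an affine map `T` conjugates the two holonomy
actions, up to an automorphism of `π₁(F)`. Developing maps that are homeomorphisms carry `T` back to
an equivariant homeomorphism of `F'`. -/
theorem fibresAffinelyIsomorphic_of_homeomorph (h₁ : IsDatum f pB DB pF L V₁ Φ₁ Ψ₁ N₁ E₁ κ₁)
    (h₂ : IsDatum f pB DB pF L V₂ Φ₂ Ψ₂ N₂ E₂ κ₂)
    (S : IsDevelopedBundle m l f b₀ pB DB hB pF DF hF) {v₁ v₂ : B'} (hv₁ : v₁ ∈ N₁) (hv₂ : v₂ ∈ N₂)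
    {e₁ e₂ : F' ≃ₜ Euc l} (he₁ : ∀ y, e₁ y = E₁ (v₁, y)) (he₂ : ∀ y, e₂ y = E₂ (v₂, y))
    {p : gaugeGroup L} (hp : (Submodule.Quotient.mk (κ₂ (DB v₂)) : H1 L) =
      gaugeH1 L p (Submodule.Quotient.mk (κ₁ (DB v₁)))) :
    FibresAffinelyIsomorphic (m + l) f (pB v₁) (pB v₂) := by
  have := S.coverF.simplyConnected
  have := S.devF.isLocalHomeomorph.locallyPathConnectedSpace
  obtain ⟨w, hw⟩ := (Submodule.Quotient.eq _).1 hp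
  have hw' : ∀ γ, L (p.1.1 γ) w - w = (κ₂ (DB v₂)).1 (p.1.1 γ) - p.1.2 ((κ₁ (DB v₁)).1 γ) := by
    intro γ
    have h1 := congrFun (congrArg Subtype.val hw) (p.1.1 γ)
    have h2 : p.1.1⁻¹ (p.1.1 γ) = γ := p.1.1.symm_apply_apply γ
    change L (p.1.1 γ) w - w =
      (κ₂ (DB v₂)).1 (p.1.1 γ) - p.1.2 ((κ₁ (DB v₁)).1 (p.1.1⁻¹ (p.1.1 γ))) at h1
    rwa [h2] at h1
  have hκ : ∀ γ, (κ₂ (DB v₂)).1 (p.1.1 γ) = L (p.1.1 γ) w - w + p.1.2 ((κ₁ (DB v₁)).1 γ) :=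
    fun γ => by rw [hw' γ, sub_add_cancel]
  have hL : ∀ γ e, L (p.1.1 γ) (p.1.2 e) = p.1.2 (L γ e) := fun γ e => by
    rw [p.2 γ]
    simp only [LinearEquiv.mul_apply, LinearEquiv.coe_inv, LinearEquiv.symm_apply_apply]
  -- The translation by `-w` absorbs the coboundary `L(g γ) w - w` by which `κ₂` differs from the
  -- transformed `κ₁`.
  let T : Euc l ≃ᵃ[ℝ] Euc l := p.1.2.toAffineEquiv.trans (AffineEquiv.constVAdd ℝ (Euc l) (-w))
  have hT : ∀ e, T e = -w + p.1.2 e := fun e => rfl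
  let φ : F' ≃ₜ F' := (e₁.trans (AffineEquiv.toContinuousAffineEquiv T).toHomeomorph).trans e₂.symm
  have hφ : ∀ y, E₂ (v₂, φ y) = T (E₁ (v₁, y)) := fun y => by
    rw [← he₂, ← he₁]
    exact e₂.apply_symm_apply _
  have heq : ∀ γ y, φ (γ.1 y) = (p.1.1 γ).1 (φ y) := fun γ y => by
    apply e₂.injective
    rw [he₂, he₂, hφ, h₁.equivariant v₁ hv₁, h₂.equivariant v₂ hv₂, hφ, hT, hT, map_add, map_add,
      map_neg, hκ γ, hL]
    abel
  refine h₁.fibresAffinelyIsomorphic h₂ S hv₁ hv₂ φ (fun x y => ⟨fun hxy => ?_, fun hxy => ?_⟩) T hφ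
  · obtain ⟨γ, hγ⟩ := S.coverF.exists_deck hxy
    have : φ (p.1.1.symm γ |>.1 x) = φ y := by
      rw [heq, p.1.1.apply_symm_apply, hγ]
    rw [← φ.injective this, (p.1.1.symm γ).2]
  · obtain ⟨γ, rfl⟩ := S.coverF.exists_deck hxy
    rw [heq, (p.1.1 γ).2]

end IsDatum

end Complete

/-! ### Rigidity of families of developing maps with constant holonomy -/

section Sections

variable {X Y Z : Type*} [TopologicalSpace X] [TopologicalSpace Y] [TopologicalSpace Z]

theorem IsLocalHomeomorph.of_isLocallyInjective {p : X → Y} (hp : Continuous p) (ho : IsOpenMap p)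
    (hi : IsLocallyInjective p) : IsLocalHomeomorph p :=
  isLocalHomeomorph_iff_isOpenEmbedding_restrict.2 fun x => by
    obtain ⟨U, hU, hxU, hinj⟩ := hi x
    exact ⟨U, hU.mem_nhds hxU, .of_continuous_injective_isOpenMap (hp.comp continuous_subtype_val)
      (injOn_iff_injective.1 hinj) (ho.comp hU.isOpenMap_subtype_val)⟩

variable {E : X × Y → Z}

/-- Near a given point, a family of local homeomorphisms `y ↦ E (x, y)` has local sections along
which it is constant. -/
theorem exists_local_sections (hE : IsLocalHomeomorph fun z : X × Y => (z.1, E z)) (x₁ : X) (y : Y) :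
    ∃ (U : Set X) (W : Set Y) (σ : X → X → Y → Y), IsOpen U ∧ IsOpen W ∧ x₁ ∈ U ∧ y ∈ W ∧
      ∀ x ∈ U, (∀ y' ∈ W, σ x x y' = y') ∧ (∀ y' ∈ W, ContinuousOn (fun x' => σ x x' y') U) ∧
        ∀ x' ∈ U, ContinuousOn (σ x x') W ∧ ∀ y' ∈ W, E (x', σ x x' y') = E (x, y') := by
  obtain ⟨e, hye, he⟩ := hE (x₁, y)
  have he' : ∀ z, e z = (z.1, E z) := fun z => (congrFun he z).symm
  have hcE : Continuous E := continuous_snd.comp hE.continuous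
  obtain ⟨U₁, C, hU₁, hC, hx₁U, hyC, hsub⟩ := isOpen_prod_iff.1 e.open_target x₁ (E (x₁, y))
    (by rw [← he' (x₁, y)]; exact e.map_source hye)
  obtain ⟨U₂, W, hU₂, hW, hx₂U, hyW, hsub'⟩ := isOpen_prod_iff.1
    (e.open_source.inter (hC.preimage hcE)) x₁ y ⟨hye, hyC⟩
  have hmem : ∀ x ∈ U₁ ∩ U₂, ∀ y' ∈ W, ∀ x' ∈ U₁ ∩ U₂, (x', E (x, y')) ∈ e.target :=
    fun x hx y' hy' x' hx' => hsub ⟨hx'.1, (hsub' (mk_mem_prod hx.2 hy')).2⟩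
  -- The value `E (x, y')` is kept while the base point moves from `x` to `x'`; a local inverse of
  -- `(x, E)` returns the corresponding point of `Y`.
  refine ⟨U₁ ∩ U₂, W, fun x x' y' => (e.symm (x', E (x, y'))).2, hU₁.inter hU₂, hW, ⟨hx₁U, hx₂U⟩,
    hyW, fun x hx => ⟨fun y' hy' => ?_, fun y' hy' => ?_, fun x' hx' => ⟨?_, fun y' hy' => ?_⟩⟩⟩
  · change (e.symm (x, E (x, y'))).2 = y'
    have := e.left_inv (hsub' (mk_mem_prod hx.2 hy')).1
    rw [he'] at this
    rw [this]
  · exact continuous_snd.comp_continuousOn (e.continuousOn_symm.comp (by fun_prop)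
      fun x' hx' => hmem x hx y' hy' x' hx')
  · exact continuous_snd.comp_continuousOn (e.continuousOn_symm.comp
      (f := fun y' => (x', E (x, y'))) (by fun_prop) fun y' hy' => hmem x hx y' hy' x' hx')
  · have h1 := e.right_inv (hmem x hx y' hy' x' hx')
    rw [he'] at h1
    obtain ⟨h2, h3⟩ := Prod.mk.inj h1
    change E (x', (e.symm (x', E (x, y'))).2) = _
    conv_rhs => rw [← h3]
    congr 1
    exact Prod.ext h2.symm rfl

/-- The graphs `x ↦ (x, s x)` are lifts of one map through a local homeomorphism, so they agree as
soon as they agree at one point. -/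
theorem eqOn_of_section [T2Space X] [T2Space Y]
    (hE : IsLocalHomeomorph fun z : X × Y => (z.1, E z)) {U : Set X} (hU : IsPreconnected U)
    {s s' : X → Y} (hs : ContinuousOn s U) (hs' : ContinuousOn s' U)
    (h : ∀ x ∈ U, E (x, s x) = E (x, s' x)) {x₀ : X} (hx₀ : x₀ ∈ U) (h₀ : s x₀ = s' x₀) :
    EqOn s s' U := by
  have := IsSeparatedMap.eqOn_of_comp_eqOn (T2Space.isSeparatedMap _) hE.isLocallyInjective hU
    (g₁ := fun x => (x, s x)) (g₂ := fun x => (x, s' x)) (continuousOn_id.prodMk hs)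
    (continuousOn_id.prodMk hs') (fun x hx => Prod.ext rfl (h x hx)) hx₀ (Prod.ext rfl h₀)
  exact fun x hx => congrArg Prod.snd (this hx)

/-- A family of local homeomorphisms which is equivariant under a fixed cocompact action is locally
trivial. -/
theorem exists_equivariant_homeomorph [LocallyConnectedSpace X] [T2Space X] [T2Space Y]
    (G : Subgroup (Y ≃ₜ Y)) {K : Set Y} (hK : IsCompact K) (hGK : ∀ y, ∃ γ : G, γ.1 y ∈ K)
    (hE : IsLocalHomeomorph fun z : X × Y => (z.1, E z)) {ρ : G → Z → Z}
    (hρ : ∀ (γ : G) x y, E (x, γ.1 y) = ρ γ (E (x, y))) (x₁ : X) :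
    ∀ᶠ x in 𝓝 x₁, ∃ φ : Y ≃ₜ Y, (∀ (γ : G) y, φ (γ.1 y) = γ.1 (φ y)) ∧
      ∀ y, E (x, φ y) = E (x₁, y) := by
  choose U W σ hU hW hxU hyW hσ using exists_local_sections hE x₁
  obtain ⟨t, -, ht⟩ := hK.elim_nhds_subcover W fun y _ => (hW y).mem_nhds (hyW y)
  -- Finitely many `W i` cover `K`, and translates of `K` cover `Y`. Local sections moved by the
  -- group therefore exist through every `y` over one common connected neighbourhood `N`.
  have hcov : ∀ y, ∃ (γ : G) (i : Y), i ∈ t ∧ γ.1 y ∈ W i := fun y => by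
    obtain ⟨γ, hγ⟩ := hGK y
    obtain ⟨i, hi, h⟩ := mem_iUnion₂.1 (ht hγ)
    exact ⟨γ, i, hi, h⟩
  have hUt : (⋂ i ∈ t, U i) ∈ 𝓝 x₁ :=
    (biInter_finset_mem t).2 fun i _ => (hU i).mem_nhds (hxU i)
  obtain ⟨N, ⟨hNo, hxN, hNc⟩, hNsub⟩ :=
    (LocallyConnectedSpace.open_connected_basis x₁).mem_iff.1 hUt
  have hNU : ∀ i ∈ t, N ⊆ U i := fun i hi x hx => mem_iInter₂.1 (hNsub hx) i hi
  have hback : ∀ (γ : G) y, γ.1.symm (γ.1 y) = y := fun γ y => γ.1.symm_apply_apply y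
  have hinvE : ∀ (γ : G) x y x' y', E (x, y) = E (x', γ.1 y') → E (x, γ.1.symm y) = E (x', y') := by
    intro γ x y x' y' h
    have h1 := hρ γ⁻¹ x y
    have h2 := hρ γ⁻¹ x' (γ.1 y')
    rw [h, ← h2] at h1
    exact h1.trans (by rw [show (γ⁻¹).1 (γ.1 y') = y' from hback γ y'])
  have hlift : ∀ (x : X) (y : Y) (γ : G) (i : Y), x ∈ N → i ∈ t → γ.1 y ∈ W i →
      ContinuousOn (fun x' => γ.1.symm (σ i x x' (γ.1 y))) N ∧ γ.1.symm (σ i x x (γ.1 y)) = y ∧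
        ∀ x' ∈ N, E (x', γ.1.symm (σ i x x' (γ.1 y))) = E (x, y) := by
    intro x y γ i hx hi hy
    obtain ⟨h1, h2, h3⟩ := hσ i x (hNU i hi hx)
    refine ⟨γ.1.symm.continuous.comp_continuousOn ((h2 _ hy).mono (hNU i hi)), ?_, fun x' hx' => ?_⟩
    · rw [h1 _ hy, hback]
    · exact hinvE γ _ _ _ _ ((h3 x' (hNU i hi hx')).2 _ hy)
  have hex : ∀ x y, ∃ s : X → Y, x ∈ N → ContinuousOn s N ∧ s x = y ∧
      ∀ x' ∈ N, E (x', s x') = E (x, y) := fun x y => by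
    obtain ⟨γ, i, hi, hy⟩ := hcov y
    exact ⟨fun x' => γ.1.symm (σ i x x' (γ.1 y)), fun hx => hlift x y γ i hx hi hy⟩
  choose s hs using hex
  have huniq : ∀ x ∈ N, ∀ y, ∀ s' : X → Y, ContinuousOn s' N → s' x = y →
      (∀ x' ∈ N, E (x', s' x') = E (x, y)) → EqOn (s x y) s' N := by
    intro x hx y s' h1 h2 h3
    obtain ⟨h4, h5, h6⟩ := hs x y hx
    exact eqOn_of_section hE hNc.isPreconnected h4 h1 (fun x' hx' => (h6 x' hx').trans (h3 x' hx').symm)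
      hx (h5.trans h2.symm)
  -- The sections were chosen separately for each `y`; by uniqueness they agree near `y` with the
  -- explicit local ones, which are continuous in `y`.
  have hcont : ∀ x ∈ N, ∀ x' ∈ N, Continuous fun y => s x y x' := by
    intro x hx x' hx'
    refine continuous_iff_continuousAt.2 fun y => ?_
    obtain ⟨γ, i, hi, hy⟩ := hcov y
    have hWo : IsOpen (γ.1 ⁻¹' W i) := (hW i).preimage γ.1.continuous
    have h1 : ContinuousOn (fun y => γ.1.symm (σ i x x' (γ.1 y))) (γ.1 ⁻¹' W i) :=
      γ.1.symm.continuous.comp_continuousOn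
        (((hσ i x (hNU i hi hx)).2.2 x' (hNU i hi hx')).1.comp γ.1.continuous.continuousOn
          fun y hy => hy)
    refine (h1.continuousAt (hWo.mem_nhds hy)).congr ?_
    filter_upwards [hWo.mem_nhds hy] with y' hy'
    obtain ⟨h2, h3, h4⟩ := hlift x y' γ i hx hi hy'
    exact (huniq x hx y' _ h2 h3 h4 hx').symm
  have hinv : ∀ x ∈ N, ∀ x' ∈ N, ∀ y, s x' (s x y x') x = y := by
    intro x hx x' hx' y
    obtain ⟨h1, h2, h3⟩ := hs x y hx
    rw [huniq x' hx' _ (s x y) h1 rfl (fun x'' hx'' => (h3 x'' hx'').trans (h3 x' hx').symm) hx, h2]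
  filter_upwards [hNo.mem_nhds hxN] with x hx
  -- The homeomorphism follows sections from `x₁` to `x`. Its inverse follows them back, and
  -- equivariance holds because the translate of a section is a section.
  refine ⟨{ toFun := fun y => s x₁ y x
            invFun := fun y => s x y x₁
            left_inv := hinv x₁ hxN x hx
            right_inv := hinv x hx x₁ hxN
            continuous_toFun := hcont x₁ hxN x hx
            continuous_invFun := hcont x hx x₁ hxN }, fun γ y => ?_, fun y => (hs x₁ y hxN).2.2 x hx⟩
  obtain ⟨h1, h2, h3⟩ := hs x₁ y hxN
  exact huniq x₁ hxN (γ.1 y) (fun x' => γ.1 (s x₁ y x')) (γ.1.continuous.comp_continuousOn h1)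
    (by rw [h2]) (fun x' hx' => by rw [hρ, hρ, h3 x' hx']) hx

end Sections

/-! ### Compact fibres -/

section Compact

variable {m l : ℕ} {M B : Type*} [TopologicalSpace M] [ChartedSpace (Euc (m + l)) M]
  [TopologicalSpace B] [ChartedSpace (Euc m) B] {B' F' : Type*} [TopologicalSpace B']
  [TopologicalSpace F'] {f : M → B} {b₀ : B} {pB : B' → B} {DB : B' → Euc m}
  {hB : deckGroup pB →* (Euc m ≃ᵃ[ℝ] Euc m)} {pF : F' → f ⁻¹' {b₀}} {DF : F' → Euc l}
  {hF : deckGroup pF →* (Euc l ≃ᵃ[ℝ] Euc l)}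
  {V : Set B} {Φ : B × M → M} {Ψ : M → M} {N : Set B'} {E : B' × F' → Euc l}
  {L : deckGroup pF →* (Euc l ≃ₗ[ℝ] Euc l)} {κ : Euc m →ᵃ[ℝ] cocycles L}

namespace IsDatum

/-- The map `(DB, E)` is open. It is locally injective because an affine function of it is a chart
of `M`, and a point of `M` determines its typical-fibre coordinate through `Ψ`. Since `DB` is itself
a local homeomorphism, the property descends to the map with first component the base point. -/
theorem isLocalHomeomorph (h : IsDatum f pB DB pF L V Φ Ψ N E κ)
    (S : IsDevelopedBundle m l f b₀ pB DB hB pF DF hF) :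
    IsLocalHomeomorph fun z : N × F' => (z.1, E (z.1, z.2)) := by
  let ι : N × F' → B' × F' := Prod.map Subtype.val id
  have hι : IsOpenEmbedding ι := h.isOpen.isOpenEmbedding_subtypeVal.prodMap .id
  have hcE : Continuous fun z : N × F' => E (ι z) := continuous_iff_continuousAt.2 fun z =>
    (h.family.continuousAt S h.triv h.mapsTo (z := ι z) z.1.2).comp hι.continuous.continuousAt
  have hDB : IsLocalHomeomorph fun v : N => DB v :=
    S.devB.isLocalHomeomorph.comp h.isOpen.isOpenEmbedding_subtypeVal.isLocalHomeomorph
  refine IsLocalHomeomorph.of_comp (g := Prod.map (fun v : N => DB v) (id : Euc l → Euc l))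
    (.of_isLocallyInjective ?_ (IsOpenMap.of_nhds_le fun z => ?_) ?_)
    ?_ (continuous_fst.prodMk hcE)
  · exact (hDB.continuous.comp continuous_fst).prodMk hcE
  · exact nhds_comp_le (g := fun z => (DB z.1, E z)) (h := ι)
      (h.family.nhds_le S h.triv h.mapsTo z.1.2) (hι.map_nhds_eq z).ge
  · refine isLocallyInjective_iff_nhds.2 fun z => ?_
    obtain ⟨U, hU, hzU, hUi⟩ := S.devB.isLocalHomeomorph.isLocallyInjective z.1
    obtain ⟨W, hW, hzW, hWi⟩ := S.coverF.isCoveringMap.isLocalHomeomorph.isLocallyInjective z.2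
    obtain ⟨T, hT⟩ := h.family (ι z) z.1.2
    have hz : pB (ι z).1 ∈ V := h.mapsTo z.1.2
    have hsrc : ∀ᶠ z' in 𝓝 (ι z), fibreMap Φ pB pF z' ∈
        (chartAt (Euc (m + l)) (fibreMap Φ pB pF (ι z))).source :=
      (S.continuousAt_fibreMap h.triv hz).preimage_mem_nhds
        ((chartAt _ _).open_source.mem_nhds (mem_chart_source _ _))
    have hnhd : ∀ᶠ z' in 𝓝 (ι z), z' ∈ U ×ˢ W :=
      prod_mem_nhds (hU.mem_nhds hzU) (hW.mem_nhds hzW)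
    refine ⟨_, hι.continuous.continuousAt.eventually (hT.and (hsrc.and hnhd)), ?_⟩
    rintro x ⟨hx1, hx2, hx3⟩ y ⟨hy1, hy2, hy3⟩ hxy
    have h1 : (ι x).1 = (ι y).1 := hUi hx3.1 hy3.1 (congrArg Prod.fst hxy)
    have h2 : fibreMap Φ pB pF (ι x) = fibreMap Φ pB pF (ι y) := by
      refine (chartAt _ _).injOn hx2 hy2 ?_
      rw [hx1, hy1]
      exact congrArg T hxy
    have h3 := congrArg Ψ h2
    rw [h.triv.inv_fibreMap (h.mapsTo x.1.2), h.triv.inv_fibreMap (h.mapsTo y.1.2)] at h3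
    exact hι.injective (Prod.ext h1 (hWi hx3.2 hy3.2 (Subtype.ext h3)))
  · intro z
    obtain ⟨e, hz, he⟩ := hDB z.1
    exact ⟨e.prod (OpenPartialHomeomorph.refl _), ⟨hz, mem_univ _⟩, by rw [he]; rfl⟩

/-- If the affine structures on compact fibres are equivalent under the commutant of the linear
holonomy, then neighbouring fibres are isomorphic. -/
theorem eventually_fibresAffinelyIsomorphic [T2Space M] [T2Space B] [CompactSpace (f ⁻¹' {b₀})]
    (h : IsDatum f pB DB pF L V Φ Ψ N E κ) (S : IsDevelopedBundle m l f b₀ pB DB hB pF DF hF)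
    {v₁ : B'} (hv₁ : v₁ ∈ N) {σ : Euc m →ₗ[ℝ] Module.End ℝ (Euc l)} {w : Euc m →ₗ[ℝ] Euc l}
    (hσ : ∀ u, σ u ∈ commutant L) (hσw : ∀ u γ, (κ (DB v₁ + u)).1 γ =
      (κ (DB v₁)).1 γ + σ u ((κ (DB v₁)).1 γ) + (L γ (w u) - w u)) :
    ∀ᶠ v in 𝓝 v₁, FibresAffinelyIsomorphic (m + l) f (pB v₁) (pB v) := by
  have := S.coverF.simplyConnected
  have := S.devF.isLocalHomeomorph.locallyPathConnectedSpace
  have := S.devF.isLocalHomeomorph.locallyCompactSpace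
  have := S.devB.isLocalHomeomorph.locallyPathConnectedSpace
  have := S.coverF.isCoveringMap.t2Space
  have := S.coverB.isCoveringMap.t2Space
  obtain ⟨y₀⟩ : Nonempty F' := inferInstance
  -- The cocycle at `v` is `A v` applied to the one at `v₁`, plus the coboundary of `b v`, and `A v`
  -- commutes with `L`. So `(A v)⁻¹ (E (v, ·) + b v)` is equivariant under the holonomy of the fibre
  -- over `v₁`, wherever `A v` is invertible.
  let A : B' → (Euc l →L[ℝ] Euc l) := fun v => 1 + LinearMap.toContinuousLinearMap (σ (DB v - DB v₁))
  have hA : Continuous A := by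
    have h1 : Continuous ((LinearMap.toContinuousLinearMap :
        (Euc l →ₗ[ℝ] Euc l) ≃ₗ[ℝ] _).toLinearMap ∘ₗ σ) := LinearMap.continuous_of_finiteDimensional _
    exact continuous_const.add (h1.comp (S.devB.isLocalHomeomorph.continuous.sub continuous_const))
  let b : B' → Euc l := fun v => w (DB v - DB v₁)
  have hb : Continuous b := (LinearMap.continuous_of_finiteDimensional w).comp
    (S.devB.isLocalHomeomorph.continuous.sub continuous_const)
  have hA₁ : A v₁ = 1 := by simp [A]
  have hb₁ : b v₁ = 0 := by simp [b]
  have hcomm : ∀ v γ e, L γ (A v e) = A v (L γ e) := fun v γ e => by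
    have := mem_commutant.1 (hσ (DB v - DB v₁)) γ e
    change L γ (e + σ (DB v - DB v₁) e) = L γ e + σ (DB v - DB v₁) (L γ e)
    rw [map_add, this]
  have hκ : ∀ v γ, (κ (DB v)).1 γ = A v ((κ (DB v₁)).1 γ) + (L γ (b v) - b v) := fun v γ => by
    have := hσw (DB v - DB v₁) γ
    rw [add_sub_cancel] at this
    rw [this]; rfl
  -- Units are open and `A v₁ = 1`, so this is a neighbourhood of `v₁`; on it `Ring.inverse` is a
  -- genuine inverse and is continuous.
  let N' : Set B' := N ∩ A ⁻¹' {a | IsUnit a}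
  have hN' : IsOpen N' := h.isOpen.inter (Units.isOpen.preimage hA)
  have hvN' : v₁ ∈ N' := ⟨hv₁, by rw [mem_preimage, hA₁]; exact isUnit_one⟩
  have := hN'.locallyPathConnectedSpace
  have hri : ∀ v : N', ∀ e, A v (Ring.inverse (A v) e) = e := fun v e =>
    DFunLike.congr_fun (Ring.mul_inverse_cancel (A v) v.2.2) e
  have hli : ∀ v : N', ∀ e, Ring.inverse (A v) (A v e) = e := fun v e =>
    DFunLike.congr_fun (Ring.inverse_mul_cancel (A v) v.2.2) e
  have hAi : Continuous fun v : N' => Ring.inverse (A v) := continuous_iff_continuousAt.2 fun v => by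
    obtain ⟨a, ha⟩ := v.2.2
    have h1 := NormedRing.inverse_continuousAt a
    rw [ha] at h1
    exact h1.comp (f := fun v : N' => A v) (hA.comp continuous_subtype_val).continuousAt
  let H : N' × Euc l ≃ₜ N' × Euc l :=
    { toFun := fun z => (z.1, Ring.inverse (A z.1) (z.2 + b z.1))
      invFun := fun z => (z.1, A z.1 z.2 - b z.1)
      left_inv := fun z => Prod.ext rfl (by simp [hri])
      right_inv := fun z => Prod.ext rfl (by simp [hli])
      continuous_toFun := continuous_fst.prodMk ((hAi.comp continuous_fst).clm_apply
        (continuous_snd.add (hb.comp (continuous_subtype_val.comp continuous_fst))))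
      continuous_invFun := continuous_fst.prodMk
        (((hA.comp (continuous_subtype_val.comp continuous_fst)).clm_apply continuous_snd).sub
          (hb.comp (continuous_subtype_val.comp continuous_fst))) }
  replace h := h.mono hN' inter_subset_left
  obtain ⟨K, hK, hcov⟩ := S.coverF.exists_compact
  have key := exists_equivariant_homeomorph (deckGroup pF) hK
    (fun y => (hcov y).imp fun γ hγ => interior_subset hγ)
    (E := fun z : N' × F' => Ring.inverse (A z.1) (E (z.1, z.2) + b z.1))
    (H.isLocalHomeomorph.comp (h.isLocalHomeomorph S))
    (ρ := fun γ e => L γ e + (κ (DB v₁)).1 γ) (fun γ v y => by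
      have h1 : E (v, γ.1 y) + b v =
          A v (L γ (Ring.inverse (A v) (E (v, y) + b v)) + (κ (DB v₁)).1 γ) := by
        rw [map_add, ← hcomm, hri, h.equivariant v v.2, hκ, map_add]
        abel
      simp only [h1, hli]) ⟨v₁, hvN'⟩
  have key' := hN'.isOpenEmbedding_subtypeVal.map_nhds_eq ⟨v₁, hvN'⟩
  rw [← key', eventually_map]
  filter_upwards [key] with v ⟨φ, hφ, hφE⟩
  have hT : ∀ y, E (v, φ y) = A v (E (v₁, y)) + (-b v) := fun y => by
    have h1 := congrArg (A v) (hφE y)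
    simp only [hri, hA₁, hb₁, add_zero, Ring.inverse_one] at h1
    rw [← sub_eq_add_neg, eq_sub_iff_add_eq, h1]
    rfl
  let T : Euc l →ᵃ[ℝ] Euc l := (A v : Euc l →ₗ[ℝ] Euc l).toAffineMap + AffineMap.const ℝ _ (-b v)
  have hTb : Function.Bijective T := AffineMap.bijective_of_isOpenMap (x := y₀)
    (D := fun y => E (v₁, y)) (D' := fun y => E (v, φ y))
    (nhds_comp_le (g := fun y => E (v, y)) (h.family.nhds_slice_le S h.triv h.mapsTo v.2 _)
      (φ.map_nhds_eq y₀).ge) (Eventually.of_forall hT)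
  refine h.fibresAffinelyIsomorphic h S hvN' v.2 φ (fun x y => ⟨fun hxy => ?_, fun hxy => ?_⟩)
    (AffineEquiv.ofBijective hTb) hT
  · obtain ⟨γ, hγ⟩ := S.coverF.exists_deck hxy
    rw [← hφ] at hγ
    rw [← φ.injective hγ, γ.2]
  · obtain ⟨γ, rfl⟩ := S.coverF.exists_deck hxy
    rw [hφ, γ.2]

end IsDatum

end Compact

/-! ### Holonomy equivariance and propagation over the base -/

section Classes

variable {m l : ℕ} {M B : Type*} [TopologicalSpace M] [ChartedSpace (Euc (m + l)) M]
  [TopologicalSpace B] [ChartedSpace (Euc m) B] {B' F' : Type*} [TopologicalSpace B']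
  [TopologicalSpace F'] {f : M → B} {b₀ : B} {pB : B' → B} {DB : B' → Euc m}
  {hB : deckGroup pB →* (Euc m ≃ᵃ[ℝ] Euc m)} {pF : F' → f ⁻¹' {b₀}} {DF : F' → Euc l}
  {hF : deckGroup pF →* (Euc l ≃ᵃ[ℝ] Euc l)}
  {L : deckGroup pF →* (Euc l ≃ₗ[ℝ] Euc l)} {κ₀ : Euc m →ᵃ[ℝ] cocycles L}

/-- The family of cohomology classes is equivariant under the holonomy of the base, acting through
gauge transformations. -/
theorem IsDevelopedBundle.exists_gauge_deck (S : IsDevelopedBundle m l f b₀ pB DB hB pF DF hF)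
    (h : ∀ v, ∃ V Φ Ψ N E κ, v ∈ N ∧ IsDatum f pB DB pF L V Φ Ψ N E κ ∧
      ∀ x, (Submodule.Quotient.mk (κ x) : H1 L) = Submodule.Quotient.mk (κ₀ x)) (γ : deckGroup pB) :
    ∃ p : gaugeGroup L, ∀ x, (Submodule.Quotient.mk (κ₀ (hB γ x)) : H1 L) =
      gaugeH1 L p (Submodule.Quotient.mk (κ₀ x)) := by
  have := S.coverB.simplyConnected
  obtain ⟨v⟩ : Nonempty B' := inferInstance
  obtain ⟨V₁, Φ₁, Ψ₁, N₁, E₁, κ₁, hv₁, h₁, hκ₁⟩ := h v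
  obtain ⟨V₂, Φ₂, Ψ₂, N₂, E₂, κ₂, hv₂, h₂, hκ₂⟩ := h (γ.1 v)
  -- The datum at `v`, moved by `γ`, describes the same fibre as the datum at `γ v`, since both
  -- points lie over the same point of `B`.
  obtain ⟨θ, hθ⟩ := (h₁.translate S γ).exists_homeomorph h₂ S ⟨v, hv₁, rfl⟩ hv₂
  obtain ⟨p, -, hp, -⟩ := (h₁.translate S γ).exists_gauge h₂ S ⟨v, hv₁, rfl⟩ hv₂ θ hθ
  refine ⟨p, fun x => ?_⟩
  have h3 := hp (hB γ x)
  rw [hκ₂] at h3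
  rw [h3, AffineMap.comp_apply, AffineEquiv.coe_coe, AffineEquiv.symm_apply_apply, hκ₁]

/-- Over a connected base, fibres are isomorphic if neighbouring fibres are. -/
theorem fibresAffinelyIsomorphic_of_eventually [PreconnectedSpace B'] {n : ℕ} {M : Type*}
    [TopologicalSpace M] [ChartedSpace (Euc n) M] {f : M → B}
    (h : ∀ v₁, ∀ᶠ v in 𝓝 v₁, FibresAffinelyIsomorphic n f (pB v₁) (pB v)) (v v' : B') :
    FibresAffinelyIsomorphic n f (pB v) (pB v') := by
  let Q : Set B' := {v' | FibresAffinelyIsomorphic n f (pB v) (pB v')}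
  have hQo : IsOpen Q := isOpen_iff_mem_nhds.2 fun v₁ hv₁ =>
    (h v₁).mono fun v₂ hv₂ => FibresAffinelyIsomorphic.trans hv₁ hv₂
  have hQc : IsClosed Q := isClosed_of_closure_subset fun v₁ hv₁ => by
    obtain ⟨v₂, hv₂, hQ⟩ := mem_closure_iff_nhds.1 hv₁ _ (h v₁)
    exact FibresAffinelyIsomorphic.trans hQ (FibresAffinelyIsomorphic.symm hv₂)
  have hQ : Q = univ := IsClopen.eq_univ ⟨hQc, hQo⟩ ⟨v, (h v).self_of_nhds⟩
  exact (hQ.symm ▸ mem_univ v' : v' ∈ Q)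

theorem moduliProj_eq_iff {Γ V : Type*} [Group Γ] [AddCommGroup V] [Module ℝ V]
    {L : Γ →* (V ≃ₗ[ℝ] V)} {U : Set (H1 L)} {a b : U} :
    moduliProj L U a = moduliProj L U b ↔ ∃ p : gaugeGroup L, a.1 = gaugeH1 L p b.1 := by
  refine (Quotient.eq (r := gaugeSetoid L U)).trans ?_
  exact ⟨fun ⟨p, hp⟩ => ⟨p, hp.symm⟩, fun ⟨p, hp⟩ => ⟨p, hp.symm⟩⟩

end Classes

end

/-! ### Proof of the theorem -/

theorem proposition3p1 {m l : ℕ}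
    -- the affine manifolds `M` (dimension `m + l`) and `B` (dimension `m`)
    {M B : Type*} [TopologicalSpace M] [T2Space M] [SecondCountableTopology M]
    [ChartedSpace (Euc (m + l)) M] [HasGroupoid M (affineGroupoid (m + l))]
    [TopologicalSpace B] [T2Space B] [SecondCountableTopology B]
    [ChartedSpace (Euc m) B] [HasGroupoid B (affineGroupoid m)]
    -- the affine bundle `f : M → B`, with typical fibre `F = f⁻¹(b₀)`
    (f : M → B) (hf : IsAffineAlong (n := m + l) (k := m) (id : M → M) (id : B → B) f)
    (hsurj : Function.Surjective f) (b₀ : B)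
    (htriv : IsSmoothlyLocallyTrivial (m + l) m f b₀)
    -- the universal cover, a developing map and the holonomy of the base
    {B' : Type*} [TopologicalSpace B'] (pB : B' → B) (hpB : IsUniversalCover pB)
    (DB : B' → Euc m) (hB : deckGroup pB →* (Euc m ≃ᵃ[ℝ] Euc m))
    (hDB : IsDevelopingPair (n := m) pB (id : B → B) DB hB)
    -- the universal cover, a developing map and the holonomy of `F`
    {F' : Type*} [TopologicalSpace F'] (pF : F' → f ⁻¹' {b₀}) (hpF : IsUniversalCover pF)
    (DF : F' → Euc l) (hF : deckGroup pF →* (Euc l ≃ᵃ[ℝ] Euc l))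
    (hDF : IsDevelopingPair (n := m + l) pF (Subtype.val : f ⁻¹' {b₀} → M) DF hF)
    -- the fibres are compact, or they are complete
    (hfib : CompactSpace (f ⁻¹' {b₀}) ∨ ∀ b, FibreComplete (m + l) l f b)
    -- `U / G` is the moduli set: `U` is the set of classes of affine structures on `F` with linear
    -- holonomy that of `F`, or any larger subset of the first cohomology, for instance all of it
    (U : Set (H1 (linearHolonomy hF))) (hU : affineClasses pF DF (linearHolonomy hF) ⊆ U)
    (halg : ∃ 𝒱 : RealAlgebraicStructure (Moduli (linearHolonomy hF) U),
      𝒱.IsAlgebraicMap U (moduliProj (linearHolonomy hF) U))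
    -- the Zariski closure of the holonomy group of the base acts transitively
    (htrans : ∀ x y : Euc m, ∃ g ∈ affZariskiClosure (range hB), g x = y) :
    ∀ b b' : B, FibresAffinelyIsomorphic (m + l) f b b' := by
  have S : IsDevelopedBundle m l f b₀ pB DB hB pF DF hF := ⟨hf, hpB, hDB, hpF, hDF⟩
  have := hpB.simplyConnected
  have := hpF.simplyConnected
  have := hDF.isLocalHomeomorph.locallyPathConnectedSpace
  have := hDF.isLocalHomeomorph.locallyCompactSpace
  obtain ⟨𝒱, h𝒱⟩ := halg
  obtain ⟨κ₀, hdata, v₀, V₀, Φ₀, Ψ₀, N₀, E₀, κ', hv₀, h₀, hΦ₀, hE₀⟩ := S.exists_classes htriv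
  let L := linearHolonomy hF
  let r : Euc m →ᵃ[ℝ] H1 L := (LinearMap.range (coboundary L)).mkQ.toAffineMap.comp κ₀
  have hr : ∀ x, r x = Submodule.Quotient.mk (κ₀ x) := fun x => rfl
  have hΩ : ∀ x ∈ range DB, r x ∈ U := by
    rintro _ ⟨v, rfl⟩
    obtain ⟨V, Φ, Ψ, N, E, κ, hv, h, hκ⟩ := hdata v
    rw [hr, ← hκ]
    exact hU (h.mk_mem_affineClasses S hv h₀ hv₀ hΦ₀ hE₀)
  have hdeck := S.exists_gauge_deck hdata
  -- The developing image is stable under the holonomy of the base, and `r` is equivariant there up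
  -- to gauge; so the algebraic map `t ∘ r` is invariant, hence constant.
  have hgauge : ∀ x ∈ range DB, ∀ y ∈ range DB, ∃ p : gaugeGroup L, r y = gaugeH1 L p (r x) := by
    intro x hx y hy
    refine moduliProj_eq_iff.1 (h𝒱.eq_of_invariant htrans r hΩ ?_ hx hy)
    rintro _ ⟨γ, rfl⟩ _ ⟨v, rfl⟩
    obtain ⟨p, hp⟩ := hdeck γ
    exact ⟨⟨γ.1 v, hDB.equivariant γ v⟩, moduliProj_eq_iff.2 ⟨p, hp _⟩⟩
  suffices h : ∀ v v' : B', FibresAffinelyIsomorphic (m + l) f (pB v) (pB v') by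
    intro b b'
    obtain ⟨v, rfl⟩ := hpB.surjective b
    obtain ⟨v', rfl⟩ := hpB.surjective b'
    exact h v v'
  rcases hfib with hcomp | hcomp
  · have : Group.FG (deckGroup pF) := hpF.fg_deck
    have : Countable (MulAut (deckGroup pF)) := countable_mulAut
    have : Module.Finite ℝ (commutant L) :=
      inferInstanceAs (Module.Finite ℝ (Subalgebra.toSubmodule (commutant L)))
    obtain ⟨x₀, hx₀⟩ := exists_forall_mem_orbitSpan r hDB.isLocalHomeomorph.isOpenMap.isOpen_range
      ⟨DB v₀, mem_range_self v₀⟩ hgauge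
    have hspan := mem_orbitSpan_of_equivariant (commutantH1 L) htrans r (by
      rintro _ ⟨γ, rfl⟩
      obtain ⟨p, hp⟩ := hdeck γ
      exact ⟨gaugeH1 L p, hp, orbitSpan_gaugeH1_le p⟩) hx₀
    refine fibresAffinelyIsomorphic_of_eventually fun v => ?_
    obtain ⟨V, Φ, Ψ, N, E, κ, hv, h, hκ⟩ := hdata v
    -- The local argument is needed around every `v`, which is why the commutant orbit had to be
    -- shown independent of its base point and not only attained at `x₀`.
    obtain ⟨σ, w, hσ, hσw⟩ := exists_linear_of_mem_orbitSpan κ (DB v) fun x => by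
      rw [hκ, hκ]
      exact hspan (DB v) x
    exact h.eventually_fibresAffinelyIsomorphic S hv hσ hσw
  · intro v v'
    obtain ⟨V, Φ, Ψ, N, E, κ, hv, h, hκ⟩ := hdata v
    obtain ⟨V', Φ', Ψ', N', E', κ', hv', h', hκ'⟩ := hdata v'
    obtain ⟨e, he⟩ := h.exists_homeomorph_of_fibreComplete S hv (hcomp _)
    obtain ⟨e', he'⟩ := h'.exists_homeomorph_of_fibreComplete S hv' (hcomp _)
    obtain ⟨p, hp⟩ := hgauge _ (mem_range_self v) _ (mem_range_self v')
    refine h.fibresAffinelyIsomorphic_of_homeomorph h' S hv hv' he he' (p := p) ?_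
    rw [hκ, hκ']
    exact hp
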